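/- \textbf{Conventions.} Links and knots in $S^3$ are smooth and oriented; two knots are equivalent if an orientation preserving diffeomorphism of $S^3$ carries one to the other as oriented knots. A \emph{Seifert surface} $F\subset S^3$ is a smooth oriented compact surface with no closed components. A \emph{closed band} in $F$ is a set $S=Z\cap F$, where $Z\subset S^3$ is a cylinder with an orientation preserving diffeomorphism of triples of manifolds with corners $$\Psi\colon (Z,\;Z\cap F=S,\;Z\cap\partial F)\to \bigl(D^2\times[0,1],\;[-\tfrac12,\tfrac12]\times[0,1],\;\{-\tfrac12,\tfrac12\}\times[0,1]\bigr).$$ A \emph{zero-framed 1-tangle of knot type $K$} is the image $T_K$ of a smooth embedding $\phi\colon[-\tfrac12,\tfrac12]\times[0,1]\to D^2\times[0,1]$ that is the identity in a neighbourhood of $[-\tfrac12,\tfrac12]\times\{0,1\}$, such that $\phi(\{0\}\times[0,1])$ is the knot $K$ (as a long knot, oriented from $\phi(0,0)$ to $\phi(0,1)$) and $\phi(\{-\tfrac12\}\times[0,1])$ and $\phi(\{\tfrac12\}\times[0,1])$ have algebraic linking number zero. \emph{Tying} zero-framed knots $K_1,\dots,K_t$ into closed bands $S_1,\dots,S_t$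 of $F$, given by $(Z_i,\Psi_i)$ with the cylinders $Z_i$ pairwise disjoint, produces the surface $$F'=\Bigl(F\setminus\bigcup_i S_i\Bigr)\cup\bigcup_i\Psi_i^{-1}(T_{K_i}),$$ oriented like $F$ outside the bands and by $[-\tfrac12,\tfrac12]\times[0,1]$ on the bands. A link $L'\subset S^3$ is the \emph{satellite} with pattern a link $P\subset D^2\times S^1$ and companion a knot $K$ if there is an orientation preserving smooth embedding $D^2\times S^1\to S^3$ mapping $P$ to $L'$, mapping $\{0\}\times S^1$ to $K$ (up to equivalence of knots), and such that the images of $\{0\}\times S^1$ and $\{1\}\times S^1$ have algebraic linking number $0$. If $\eta\subset S^3$ is an oriented unknot and $L\subset S^3$ is a link disjoint from an open tubular neighbourhood $\nu(\eta)$, then $L$ is regarded as a pattern by identifying $S^3\setminus\nu(\eta)$ with $D^2\times S^1$, preserving orientation and so that $\{1\}\times S^1$ corresponds to a longitude that is null-homologous in the closure of $\nu(\eta)$ and links $\eta$ once positively. \textbf{Proposition.} Let $F$ be a Seifert surface with oriented boundary link $L$, let $S_1,\dots,S_t$ ($t\ge 0$) be closed bands in $F$ with pairwise disjoint cylinders $Z_1,\dots,Z_t$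 and diffeomorphisms $\Psi_1,\dots,\Psi_t$, let $K_1,\dots,K_t$ be knots, let $F'$ be obtained from $F$ by tying a zero-framed $K_i$ into $S_i$ for $i=1,\dots,t$, and let $L'=\partial F'$. Then there are links $L_0,\dots,L_t$ in $S^3$ with $L_0=L$ and $L_t=L'$ such that for every $i=1,\dots,t$ the curve $\eta_i=\Psi_i^{-1}(\partial D^2\times\{\tfrac12\})$, oriented as $\partial D^2$, is an unknot disjoint from $L_{i-1}$, and $L_i$ is the satellite link with companion $K_i$ and pattern $L_{i-1}$, where $L_{i-1}$ is regarded as a link in the solid torus $S^3\setminus\nu(\eta_i)\cong D^2\times S^1$ for a suitable open tubular neighbourhood $\nu(\eta_i)$. -/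

import Mathlib

open scoped ContDiff

namespace BandTying

noncomputable section

/-! ### The three-sphere, smooth maps, and oriented curves and surfaces -/

/-- Euclidean four-space, the ambient space of the three-sphere. -/
abbrev E4 : Type := EuclideanSpace ℝ (Fin 4)

/-- The three-sphere `S³ ⊂ ℝ⁴`. -/
def S3 : Set E4 := Metric.sphere 0 1

/-- The identification `ℂ² = ℝ⁴`. -/
def toE4 (p : ℂ × ℂ) : E4 := !₂[p.1.re, p.1.im, p.2.re, p.2.im]

/-- `(x, u, v, w)` is a positively oriented basis of `ℝ⁴`.  For `x ∈ S³` and `u, v, w` tangent to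
`S³` at `x` this says that `(u, v, w)` is a positive basis of `T_x S³`, where `S³` is oriented as
the boundary of the unit ball (outward normal first). -/
def PosFrame (x u v w : E4) : Prop :=
  0 < (Matrix.of fun i j : Fin 4 => (![x, u, v, w] i) j).det

section General

variable {E F : Type*} [NormedAddCommGroup E] [NormedSpace ℝ E]
  [NormedAddCommGroup F] [NormedSpace ℝ F]

/-- `f` is smooth (`C^∞`) on an open neighbourhood of the set `A`.  Smooth maps defined on a closed
subset are represented by such an `f`; only the restriction of `f` to `A` matters below. -/
def SmoothNear (f : E → F) (A : Set E) : Prop :=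
  ∃ U : Set E, IsOpen U ∧ A ⊆ U ∧ ContDiffOn ℝ ∞ f U

/-- Oriented one-dimensional submanifolds `C` are encoded by their sets of positively oriented
tangent vectors `(x, v)`, `v ∈ T_x C`.  This is the underlying set of points. -/
def curveCarrier (C : Set (E × E)) : Set E := Prod.fst '' C

/-- The image of an oriented curve under a map: positive tangent vectors are mapped by the
derivative. -/
def pushforward (f : E → F) (C : Set (E × E)) : Set (F × F) :=
  (fun p : E × E => (f p.1, fderiv ℝ f p.1 p.2)) '' C

/-- `C` is an oriented link in `M ⊆ E`: a compact smooth oriented one-dimensional submanifold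
without boundary, contained in `M`.  Around each point there is a smooth parametrization `c` of the
part of `C` in an open set `O` by an open set `U ⊆ ℝ`, with smooth inverse `r`, and the positive
tangent vectors are the positive multiples of the velocity of `c`. -/
structure IsLink (M : Set E) (C : Set (E × E)) : Prop where
  compact : IsCompact (curveCarrier C)
  subset : curveCarrier C ⊆ M
  chart : ∀ x ∈ curveCarrier C, ∃ (U : Set ℝ) (O : Set E) (c : ℝ → E) (r : E → ℝ),
    IsOpen U ∧ IsOpen O ∧ x ∈ O ∧ ContDiffOn ℝ ∞ c U ∧ ContDiffOn ℝ ∞ r O ∧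
    c '' U = curveCarrier C ∩ O ∧ (∀ t ∈ U, r (c t) = t) ∧
    ∀ t ∈ U, ∀ v, (c t, v) ∈ C ↔ ∃ a : ℝ, 0 < a ∧ v = a • deriv c t

/-- Oriented surfaces `F` are encoded by their sets of positively oriented tangent frames
`(x, v, w)`, where `(v, w)` is a positive basis of `T_x F`.  This is the underlying set of points. -/
def surfaceCarrier (S : Set (E × E × E)) : Set E := Prod.fst '' S

/-- The closed half-plane `{(s, t) : s ≤ 0}`, with outward normal `∂/∂s` along its boundary. -/
def halfPlane : Set (ℝ × ℝ) := {q | q.1 ≤ 0}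

/-- The determinant of two vectors of the plane. -/
def det2 (a b : ℝ × ℝ) : ℝ := a.1 * b.2 - a.2 * b.1

/-- `c`, restricted to `U ∩ {s ≤ 0}` with `U` open in the plane, is an oriented smooth
parametrization, with smooth inverse `r`, of the part of the oriented surface `S` in the open
set `O`. -/
def IsSurfaceChart (S : Set (E × E × E)) (U : Set (ℝ × ℝ)) (O : Set E)
    (c : ℝ × ℝ → E) (r : E → ℝ × ℝ) : Prop :=
  IsOpen U ∧ IsOpen O ∧ ContDiffOn ℝ ∞ c U ∧ ContDiffOn ℝ ∞ r O ∧
  c '' (U ∩ halfPlane) = surfaceCarrier S ∩ O ∧ (∀ q ∈ U ∩ halfPlane, r (c q) = q) ∧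
  ∀ q ∈ U ∩ halfPlane, ∀ v w, (c q, v, w) ∈ S ↔
    ∃ a b : ℝ × ℝ, 0 < det2 a b ∧ v = fderiv ℝ c q a ∧ w = fderiv ℝ c q b

/-- The oriented boundary of an oriented surface (outward normal first). -/
def boundary (S : Set (E × E × E)) : Set (E × E) :=
  {p | ∃ U O c r, IsSurfaceChart S U O c r ∧
    ∃ q ∈ U, q.1 = 0 ∧ p.1 = c q ∧ ∃ a : ℝ, 0 < a ∧ p.2 = a • fderiv ℝ c q (0, 1)}

end General

/-- A Seifert surface: a compact smooth oriented surface in `S³` (possibly with boundary, not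
necessarily connected) such that every connected component meets the boundary. -/
structure IsSeifertSurface (S : Set (E4 × E4 × E4)) : Prop where
  compact : IsCompact (surfaceCarrier S)
  subset : surfaceCarrier S ⊆ S3
  chart : ∀ x ∈ surfaceCarrier S, ∃ U O c r, x ∈ O ∧ IsSurfaceChart S U O c r
  no_closed_component : ∀ x ∈ surfaceCarrier S,
    ∃ y ∈ curveCarrier (boundary S), y ∈ connectedComponentIn (surfaceCarrier S) x

/-- A knot in `S³`: a link in `S³` with exactly one component. -/
def IsKnot (C : Set (E4 × E4)) : Prop :=
  IsLink S3 C ∧ IsConnected (curveCarrier C)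

/-- `h` restricts to an orientation preserving diffeomorphism of `S³`. -/
def IsOrientedDiffeo (h : E4 → E4) : Prop :=
  SmoothNear h S3 ∧ Set.MapsTo h S3 S3 ∧
  (∃ g : E4 → E4, SmoothNear g S3 ∧ Set.MapsTo g S3 S3 ∧
    ∀ x ∈ S3, g (h x) = x ∧ h (g x) = x) ∧
  ∀ x ∈ S3, ∀ u v w : E4, inner ℝ x u = 0 → inner ℝ x v = 0 → inner ℝ x w = 0 →
    PosFrame x u v w → PosFrame (h x) (fderiv ℝ h x u) (fderiv ℝ h x v) (fderiv ℝ h x w)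

/-- Equivalence of oriented knots in `S³`: an orientation preserving diffeomorphism of `S³` carries
one oriented knot to the other. -/
def KnotEquiv (C C' : Set (E4 × E4)) : Prop :=
  ∃ h : E4 → E4, IsOrientedDiffeo h ∧ pushforward h C = C'

/-- `γ` and `δ` are disjoint closed curves in `S³` (with `γ` continuous) of algebraic linking number
zero: `γ` represents zero in `H₁(S³ \ δ; ℤ)`, i.e. it induces the zero map
`H₁(S¹; ℤ) → H₁(S³ \ δ; ℤ)` on singular homology. -/
def LinkingNumberZero (γ δ : Circle → E4) : Prop :=
  ∃ f : C(Circle, ↥(S3 \ Set.range δ)), (∀ u, (f u : E4) = γ u) ∧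
    ((AlgebraicTopology.singularHomologyFunctor (ModuleCat.{0} ℤ) 1).obj (ModuleCat.of ℤ ℤ)).map
      (TopCat.ofHom f) = 0

/-! ### Solid tori and satellites -/

/-- The solid torus `D² × S¹ ⊂ ℂ × ℂ`. -/
def solidTorus : Set (ℂ × ℂ) := {p | ‖p.1‖ ≤ 1 ∧ ‖p.2‖ = 1}

/-- The core `{0} × S¹` of the solid torus, as an oriented curve. -/
def torusCore : Set ((ℂ × ℂ) × (ℂ × ℂ)) :=
  {p | ∃ (u : Circle) (a : ℝ), 0 < a ∧ p = ((0, (u : ℂ)), (0, (a : ℂ) * (Complex.I * u)))}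

/-- `e` restricts to an orientation preserving smooth embedding of `D² × S¹` into `S³` such that the
images of `{1} × S¹` and `{0} × S¹` have algebraic linking number zero. -/
structure IsZeroFramedEmbedding (e : ℂ × ℂ → E4) : Prop where
  smooth : SmoothNear e solidTorus
  mapsTo : Set.MapsTo e solidTorus S3
  injOn : Set.InjOn e solidTorus
  orientation : ∀ p ∈ solidTorus, PosFrame (e p) (fderiv ℝ e p (1, 0))
    (fderiv ℝ e p (Complex.I, 0)) (fderiv ℝ e p (0, Complex.I * p.2))
  framing : LinkingNumberZero (fun u => e (1, (u : ℂ))) (fun u => e (0, (u : ℂ)))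

/-- `L'` is the satellite link with pattern the link `P ⊂ D² × S¹` and companion the knot `K`. -/
def IsSatellite (P : Set ((ℂ × ℂ) × (ℂ × ℂ))) (K L' : Set (E4 × E4)) : Prop :=
  ∃ e : ℂ × ℂ → E4, IsZeroFramedEmbedding e ∧
    KnotEquiv (pushforward e torusCore) K ∧ pushforward e P = L'

/-- The standard unknotted solid torus `{(z, w) ∈ S³ : |z| ≤ |w|}`, parametrized by `D² × S¹` via
`(z, u) ↦ (z, u) / √(1 + |z|²)`. -/
def stdTorus (p : ℂ × ℂ) : E4 := (√(1 + ‖p.1‖ ^ 2))⁻¹ • toE4 p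

/-- The oriented great circle `{(u, 0) : |u| = 1}`, the core of the open solid torus
`{(z, w) ∈ S³ : |w| < |z|}` complementary to the standard one. -/
def dualCircle : Set (E4 × E4) :=
  {p | ∃ (u : Circle) (a : ℝ), 0 < a ∧ p = (toE4 ((u : ℂ), 0), a • toE4 (Complex.I * u, 0))}

/-- The link `L ⊂ S³` becomes the link `P ⊂ D² × S¹` when `S³ \ ν(η)`, the complement of an open
tubular neighbourhood of the unknot `η`, is identified with `D² × S¹`.  The identifications are
`h ∘ stdTorus`, for orientation preserving diffeomorphisms `h` of `S³` carrying the oriented circle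
`dualCircle` to `η`; here `ν(η)` is the image under `h` of `{(z, w) ∈ S³ : |w| < |z|}`.  Under such
an identification `{1} × S¹` is a longitude that is null-homologous in the closure of `ν(η)` and
links `η` once positively. -/
def IsPatternInComplement (η L : Set (E4 × E4)) (P : Set ((ℂ × ℂ) × (ℂ × ℂ))) : Prop :=
  ∃ h : E4 → E4, IsOrientedDiffeo h ∧ pushforward h dualCircle = η ∧
    pushforward (h ∘ stdTorus) P = L

/-- `L'` is the satellite link with companion `K` and pattern `L`, where `L` is regarded as a link
in the solid torus `S³ \ ν(η) ≅ D² × S¹`. -/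
def IsSatelliteAlong (η K L L' : Set (E4 × E4)) : Prop :=
  ∃ P : Set ((ℂ × ℂ) × (ℂ × ℂ)), IsLink solidTorus P ∧
    IsPatternInComplement η L P ∧ IsSatellite P K L'

/-! ### Closed bands and tying knots into them -/

/-- The cylinder `D² × [0,1] ⊂ ℂ × ℝ`. -/
def cylinder : Set (ℂ × ℝ) := {p | ‖p.1‖ ≤ 1 ∧ p.2 ∈ Set.Icc (0 : ℝ) 1}

/-- The rectangle `[-1/2, 1/2] × [0,1]`. -/
def rectangle : Set (ℝ × ℝ) := Set.Icc (-1 / 2 : ℝ) (1 / 2) ×ˢ Set.Icc (0 : ℝ) 1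

/-- The inclusion of the plane `ℝ × ℝ` in `ℂ × ℝ`. -/
def incl (q : ℝ × ℝ) : ℂ × ℝ := ((q.1 : ℂ), q.2)

/-- `G` is the inverse `Ψ⁻¹ : D² × [0,1] → Z ⊂ S³` of an orientation preserving diffeomorphism of
triples `(Z, Z ∩ S, Z ∩ ∂S) → (D² × [0,1], [-1/2,1/2] × [0,1], {-1/2,1/2} × [0,1])`;
that is, `G` exhibits `Z ∩ S` as a closed band in the surface `S`. -/
structure IsClosedBand (S : Set (E4 × E4 × E4)) (G : ℂ × ℝ → E4) : Prop where
  smooth : SmoothNear G cylinder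
  mapsTo : Set.MapsTo G cylinder S3
  injOn : Set.InjOn G cylinder
  orientation : ∀ p ∈ cylinder, PosFrame (G p) (fderiv ℝ G p (1, 0))
    (fderiv ℝ G p (Complex.I, 0)) (fderiv ℝ G p (0, 1))
  surface_inter : G '' cylinder ∩ surfaceCarrier S = G '' (incl '' rectangle)
  boundary_inter : G '' cylinder ∩ curveCarrier (boundary S) =
    G '' (incl '' {q ∈ rectangle | q.1 = -1 / 2 ∨ q.1 = 1 / 2})
  surface_orientation : ∀ q ∈ rectangle,
    (G (incl q), fderiv ℝ G (incl q) (1, 0), fderiv ℝ G (incl q) (0, 1)) ∈ S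

/-- The curve `η = Ψ⁻¹(∂D² × {1/2})` encircling the closed band, oriented as `∂D²`. -/
def meridian (G : ℂ × ℝ → E4) : Set (E4 × E4) :=
  {p | ∃ (u : Circle) (a : ℝ), 0 < a ∧
    p = (G ((u : ℂ), 1 / 2), a • fderiv ℝ G ((u : ℂ), 1 / 2) (Complex.I * u, 0))}

/-- The strand `t ↦ φ(x, t)` in `D² × [0,1]`, extended by the vertical line `(x, t)` for
`t ∉ [0,1]`. -/
def extendStrand (φ : ℝ × ℝ → ℂ × ℝ) (x t : ℝ) : ℂ × ℝ :=
  if t ∈ Set.Icc (0 : ℝ) 1 then φ (x, t) else incl (x, t)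

/-- The map `ℂ × ℝ → S³`, `(z, t) ↦ (z, exp(iπt)) / √(1 + |z|²)`.  It embeds `D² × [0,1]` in `S³` as
half of the standard solid torus; the other half is the image of `D² × [-1,0]`. -/
def closeUp (p : ℂ × ℝ) : E4 :=
  stdTorus (p.1, Complex.exp ((Real.pi * p.2 : ℝ) * Complex.I))

/-- The closed curve in `S³` obtained from the strand `φ({x} × [0,1])` by joining its ends with
the trivial arc `{x} × [-1,0]`, parametrized by the unit circle. -/
def closedStrand (φ : ℝ × ℝ → ℂ × ℝ) (x : ℝ) (u : Circle) : E4 :=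
  closeUp (extendStrand φ x (Complex.arg u / Real.pi))

/-- The oriented knot in `S³` that is the closure of the long knot `φ({0} × [0,1])`, oriented from
`φ(0, 0)` to `φ(0, 1)`. -/
def longKnotClosure (φ : ℝ × ℝ → ℂ × ℝ) : Set (E4 × E4) :=
  {p | ∃ t ∈ Set.Ioc (-1 : ℝ) 1, ∃ a : ℝ, 0 < a ∧
    p = (closeUp (extendStrand φ 0 t), a • deriv (fun s => closeUp (extendStrand φ 0 s)) t)}

/-- The image of `φ` is a zero-framed 1-tangle of knot type `K`. -/
structure IsZeroFramedTangle (φ : ℝ × ℝ → ℂ × ℝ) (K : Set (E4 × E4)) : Prop where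
  smooth : SmoothNear φ rectangle
  mapsTo : Set.MapsTo φ rectangle cylinder
  injOn : Set.InjOn φ rectangle
  immersion : ∀ q ∈ rectangle, Function.Injective (fderiv ℝ φ q)
  eq_near_ends : ∃ ε > (0 : ℝ), ∀ q ∈ rectangle, q.2 < ε ∨ 1 - ε < q.2 → φ q = incl q
  knotType : KnotEquiv (longKnotClosure φ) K
  framing : LinkingNumberZero (closedStrand φ (-1 / 2)) (closedStrand φ (1 / 2))

/-- The oriented surface `(S \ ⋃ S_i) ∪ ⋃ Ψ_i⁻¹(T_i)`, obtained from `S` by replacing each closed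
band `S_i = Ψ_i⁻¹([-1/2,1/2] × [0,1])` by the band `Ψ_i⁻¹(T_i)`, where `G i = Ψ_i⁻¹` and `T_i` is
the image of `φ i`.  It is oriented as `S` outside the bands and by `[-1/2,1/2] × [0,1]` on them. -/
def tie {t : ℕ} (S : Set (E4 × E4 × E4)) (G : Fin t → ℂ × ℝ → E4)
    (φ : Fin t → ℝ × ℝ → ℂ × ℝ) : Set (E4 × E4 × E4) :=
  {f ∈ S | ∀ i, f.1 ∉ G i '' (incl '' rectangle)} ∪
  {f | ∃ i, ∃ q ∈ rectangle, ∃ a b : ℝ × ℝ, 0 < det2 a b ∧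
    f = (G i (φ i q), fderiv ℝ (G i ∘ φ i) q a, fderiv ℝ (G i ∘ φ i) q b)}

end

end BandTying

/-!
The argument is elementary: no flows, isotopy extension or uniqueness of tubular neighbourhoods is
used, and all diffeomorphisms are written down.

*Diffeomorphisms of `S³`* are represented by norm preserving, positively homogeneous maps of `ℝ⁴`
that are smooth embeddings away from `0` (`IsConeDiffeo`).  Such a map is automatically onto, its
inverse is of the same kind, and it preserves orientation as soon as its derivative has positive
determinant at one point, since `ℝ⁴ \ {0}` is connected.  They are built by extending by the
identity a map given in a chart (`transfer`), usually a radial contraction with a cutoff function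
(`shrink`), whose injectivity and immersivity reduce to monotonicity along rays.

*Standard position.*  Any two smoothly parametrized cylinders in `S³` differ by a diffeomorphism
(`IsCylinder.exists_diffeo`): contract both towards their centres, match the `1`-jets there by a
linear map, and interpolate between the resulting germ and the identity.  It therefore suffices to
tie a knot into the band of the standard cylinder `closeUp`.

*Tying one knot.*  The tangle `φ` thickens, in the direction of its normal vector, to an embedding
of a neighbourhood of the standard band, which is the identity near the ends.  Transferred to the
sphere it becomes an embedding `T`, defined on the complement of a ring around the band, that
carries the band to the tied band and is the identity near the rest of the surface
(`IsZeroFramedTangle.exists_tying_map`).  A diffeomorphism `h` of the sphere carries the standard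
solid torus to a solid torus that contains the surface, misses the ring, and is complementary to a
tube around the meridian `η` (`IsRingData.exists_tube`).  Now `T ∘ h` embeds the standard solid
torus: its core follows the closure of the long knot, so it has the type of the companion, and the
embedding carries the pattern to the boundary of the tied surface.

*Framing.*  The hypothesis concerns the strands over `±1/2`, whereas satellites are defined with the
strands over `0` and `1`.  A self-map of the sphere that twists the fibres of the solid torus
carries one pair to the other, and functoriality of singular homology transports the vanishing of
the linking number (`linkingNumberZero_of_strands`).

*Induction.*  If `F_n` denotes the surface with the first `n` bands tied (`tieUpTo`), then
`F_{n+1}` is the image of `F_n` under a tying map, and taking boundaries commutes with embeddings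
(`boundary_pushFrames`).  Hence `∂F_{n+1}` is the satellite of `∂F_n` (`tieUpTo_succ`).
-/

namespace BandTying

noncomputable section

open Set Filter Topology Function

/-! ### Open smooth embeddings between spaces of the same dimension -/

section Embeddings

variable {E F H : Type*} [NormedAddCommGroup E] [NormedSpace ℝ E]
  [NormedAddCommGroup F] [NormedSpace ℝ F] [NormedAddCommGroup H] [NormedSpace ℝ H]

/-- `f` is smooth at `x` with injective derivative. -/
structure ImmersionAt (f : E → F) (x : E) : Prop where
  smooth : ContDiffAt ℝ ∞ f x
  inj : Injective (fderiv ℝ f x)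

theorem ImmersionAt.differentiableAt {f : E → F} {x : E} (h : ImmersionAt f x) :
    DifferentiableAt ℝ f x := h.smooth.differentiableAt (by simp)

theorem ImmersionAt.congr {f g : E → F} {x : E} (h : ImmersionAt f x) (hg : g =ᶠ[𝓝 x] f) :
    ImmersionAt g x :=
  ⟨h.smooth.congr_of_eventuallyEq hg, by rw [hg.fderiv_eq]; exact h.inj⟩

theorem immersionAt_id (x : E) : ImmersionAt (fun y : E => y) x :=
  ⟨contDiffAt_id, by simp [Function.Injective]⟩

theorem ImmersionAt.comp {g : F → H} {f : E → F} {x : E} (hg : ImmersionAt g (f x))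
    (hf : ImmersionAt f x) : ImmersionAt (fun y => g (f y)) x := by
  refine ⟨hg.smooth.comp x hf.smooth, ?_⟩
  have := fderiv_comp x hg.differentiableAt hf.differentiableAt
  rw [show (fun y => g (f y)) = g ∘ f from rfl, this]
  exact hg.inj.comp hf.inj

theorem ImmersionAt.of_leftInverse {f : E → F} {g : F → E} {x : E} (hf : ContDiffAt ℝ ∞ f x)
    (hg : DifferentiableAt ℝ g (f x)) (h : ∀ᶠ y in 𝓝 x, g (f y) = y) : ImmersionAt f x := by
  refine ⟨hf, ?_⟩
  have h1 := fderiv_comp x hg (hf.differentiableAt (by simp))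
  have h2 : (g ∘ f) =ᶠ[𝓝 x] fun y => y := h
  rw [h2.fderiv_eq] at h1
  intro a b hab
  have := congrArg (fderiv ℝ g (f x)) hab
  have h3 : ∀ v, fderiv ℝ g (f x) (fderiv ℝ f x v) = v := fun v => by
    have := congrArg (fun L : E →L[ℝ] E => L v) h1
    simpa [fderiv_fun_id] using this.symm
  rwa [h3, h3] at this

/-- `f` restricts to an embedding of the open set `U`, smooth with injective derivative.  Between
spaces of the same finite dimension this is a diffeomorphism onto an open set. -/
structure SmoothEmb (f : E → F) (U : Set E) : Prop where
  isOpen : IsOpen U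
  injOn : InjOn f U
  imm : ∀ x ∈ U, ImmersionAt f x

theorem SmoothEmb.contDiffOn {f : E → F} {U : Set E} (h : SmoothEmb f U) : ContDiffOn ℝ ∞ f U :=
  fun x hx => (h.imm x hx).smooth.contDiffWithinAt

theorem SmoothEmb.continuousOn {f : E → F} {U : Set E} (h : SmoothEmb f U) : ContinuousOn f U :=
  h.contDiffOn.continuousOn

theorem SmoothEmb.mono {f : E → F} {U V : Set E} (h : SmoothEmb f U) (hV : IsOpen V)
    (hVU : V ⊆ U) : SmoothEmb f V :=
  ⟨hV, h.injOn.mono hVU, fun x hx => h.imm x (hVU hx)⟩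

theorem SmoothEmb.comp {g : F → H} {f : E → F} {U : Set E} {V : Set F} (hg : SmoothEmb g V)
    (hf : SmoothEmb f U) (h : MapsTo f U V) : SmoothEmb (fun y => g (f y)) U :=
  ⟨hf.isOpen, fun _ hx _ hy hxy => hf.injOn hx hy (hg.injOn (h hx) (h hy) hxy),
    fun x hx => (hg.imm _ (h hx)).comp (hf.imm x hx)⟩

theorem SmoothEmb.of_leftInverse {f : E → F} {g : F → E} {U : Set E} (hU : IsOpen U)
    (hf : ∀ x ∈ U, ContDiffAt ℝ ∞ f x) (hg : ∀ x ∈ U, DifferentiableAt ℝ g (f x))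
    (h : ∀ x ∈ U, g (f x) = x) : SmoothEmb f U :=
  ⟨hU, fun x hx y hy hxy => by rw [← h x hx, ← h y hy, hxy],
    fun x hx => .of_leftInverse (hf x hx) (hg x hx)
      (by filter_upwards [hU.mem_nhds hx] with y hy using h y hy)⟩

/-- Two maps that agree on a convex set with nonempty interior have the same derivative at the
points of this set. -/
theorem fderiv_eq_of_eqOn_convex {f g : E → F} {s : Set E} (hs : Convex ℝ s)
    (hi : (interior s).Nonempty) {x : E} (hx : x ∈ s) (hf : DifferentiableAt ℝ f x)
    (hg : DifferentiableAt ℝ g x) (h : EqOn f g s) : fderiv ℝ f x = fderiv ℝ g x :=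
  (uniqueDiffOn_convex hs hi x hx).eq
    (hf.hasFDerivAt.hasFDerivWithinAt.congr (fun _ hy => (h hy).symm) (h hx).symm)
    hg.hasFDerivAt.hasFDerivWithinAt

variable [FiniteDimensional ℝ E] [FiniteDimensional ℝ F]

/-- The derivative of an immersion between spaces of the same dimension, as an equivalence. -/
theorem ImmersionAt.exists_equiv {f : E → F} {x : E} (h : ImmersionAt f x)
    (hd : Module.finrank ℝ E = Module.finrank ℝ F) :
    ∃ L : E ≃L[ℝ] F, HasStrictFDerivAt f (L : E →L[ℝ] F) x := by
  let L : E ≃L[ℝ] F :=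
    (LinearEquiv.ofInjectiveOfFinrankEq (fderiv ℝ f x).toLinearMap h.inj hd).toContinuousLinearEquiv
  refine ⟨L, ?_⟩
  have h2 : (L : E →L[ℝ] F) = fderiv ℝ f x := by ext v; rfl
  rw [h2]
  exact h.smooth.hasStrictFDerivAt (by simp)

theorem ImmersionAt.map_nhds {f : E → F} {x : E} (h : ImmersionAt f x)
    (hd : Module.finrank ℝ E = Module.finrank ℝ F) : map f (𝓝 x) = 𝓝 (f x) := by
  have : CompleteSpace E := FiniteDimensional.complete ℝ E
  obtain ⟨L, hL⟩ := h.exists_equiv hd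
  exact hL.map_nhds_eq_of_equiv

theorem SmoothEmb.isOpen_image {f : E → F} {U : Set E} (h : SmoothEmb f U)
    (hd : Module.finrank ℝ E = Module.finrank ℝ F) {V : Set E} (hV : IsOpen V) (hVU : V ⊆ U) :
    IsOpen (f '' V) := by
  rw [isOpen_iff_mem_nhds]
  rintro _ ⟨x, hx, rfl⟩
  rw [← (h.imm x (hVU hx)).map_nhds hd]
  exact image_mem_map (hV.mem_nhds hx)

theorem SmoothEmb.inv {f : E → F} {U : Set E} (h : SmoothEmb f U)
    (hd : Module.finrank ℝ E = Module.finrank ℝ F) : SmoothEmb (invFunOn f U) (f '' U) := by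
  have : CompleteSpace E := FiniteDimensional.complete ℝ E
  have hl : ∀ x ∈ U, invFunOn f U (f x) = x := fun x hx => h.injOn.leftInvOn_invFunOn hx
  refine ⟨h.isOpen_image hd h.isOpen Subset.rfl, ?_, ?_⟩
  · rintro _ ⟨x, hx, rfl⟩ _ ⟨y, hy, rfl⟩ hxy
    rw [hl x hx, hl y hy] at hxy
    rw [hxy]
  rintro _ ⟨x, hx, rfl⟩
  have hi := h.imm x hx
  obtain ⟨L, hL⟩ := hi.exists_equiv hd
  have hs : ContDiffAt ℝ ∞ (hi.smooth.localInverse hL.hasFDerivAt (by simp)) (f x) :=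
    hi.smooth.to_localInverse hL.hasFDerivAt (by simp)
  have he : invFunOn f U =ᶠ[𝓝 (f x)] hi.smooth.localInverse hL.hasFDerivAt (by simp) := by
    rw [EventuallyEq, ← hi.map_nhds hd, eventually_map]
    have h3 := (hi.smooth.hasStrictFDerivAt' hL.hasFDerivAt (by simp)).eventually_left_inverse
    filter_upwards [h3, h.isOpen.mem_nhds hx] with y hy hyU
    rw [hl y hyU]
    exact hy.symm
  refine .of_leftInverse (g := f) (hs.congr_of_eventuallyEq he) ?_ ?_
  · rw [hl x hx]; exact hi.differentiableAt
  · filter_upwards [(h.isOpen_image hd h.isOpen Subset.rfl).mem_nhds (mem_image_of_mem f hx)]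
    rintro _ ⟨y, hy, rfl⟩
    rw [hl y hy]

end Embeddings

/-! ### Radial contractions -/

section Shrink

variable {A V : Type*} [NormedAddCommGroup V] [NormedSpace ℝ V]

/-- Contraction of the second coordinate towards `c`: by the factor `s` where `χ = 1`, and by the
factor `1` where `χ = 0`. -/
def shrink (c : V) (s : ℝ) (χ : A × V → ℝ) (p : A × V) : A × V :=
  (p.1, c + (1 - (1 - s) * χ p) • (p.2 - c))

theorem shrink_of_eq_one {c : V} {s : ℝ} {χ : A × V → ℝ} {p : A × V} (h : χ p = 1) :
    shrink c s χ p = (p.1, c + s • (p.2 - c)) := by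
  simp [shrink, h]

theorem shrink_of_eq_zero {c : V} {s : ℝ} {χ : A × V → ℝ} {p : A × V} (h : χ p = 0) :
    shrink c s χ p = p := by
  simp [shrink, h]

variable [NormedAddCommGroup A] [NormedSpace ℝ A]

/-- A radial contraction is an embedding as soon as the cutoff function decreases along the rays
from the center: then the distance from the center is multiplied by an increasing factor. -/
theorem smoothEmb_shrink {c : V} {s : ℝ} (hs : 0 < s) (hs1 : s ≤ 1) {χ : A × V → ℝ}
    (h1 : ∀ p, χ p ≤ 1) {A0 : Set A} (hA : IsOpen A0)
    (hχ : ∀ p : A × V, p.1 ∈ A0 → ContDiffAt ℝ ∞ χ p)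
    (hanti : ∀ a ∈ A0, ∀ v, AntitoneOn (fun μ : ℝ => χ (a, c + μ • v)) (Ici 0)) :
    SmoothEmb (shrink c s χ) (A0 ×ˢ univ) := by
  have hm : ∀ p, 0 < 1 - (1 - s) * χ p := fun p => by
    nlinarith [h1 p, mul_nonneg (sub_nonneg.2 hs1) (sub_nonneg.2 (h1 p))]
  refine ⟨hA.prod isOpen_univ, ?_, ?_⟩
  · -- along a ray the map is strictly increasing
    have key : ∀ a ∈ A0, ∀ v w : V, ∀ r : ℝ, 0 ≤ r → r ≤ 1 → w = r • v →
        (1 - (1 - s) * χ (a, c + v)) • v = (1 - (1 - s) * χ (a, c + w)) • w → v = w := by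
      intro a ha v w r hr hr1 hw h
      have hle : χ (a, c + (1 : ℝ) • v) ≤ χ (a, c + r • v) :=
        hanti a ha v (mem_Ici.2 hr) (mem_Ici.2 zero_le_one) hr1
      rw [one_smul] at hle
      subst hw
      by_cases hv : v = 0
      · simp [hv]
      rw [smul_smul] at h
      have h2 := smul_left_injective ℝ hv h
      have h3 := hm (a, c + v)
      have h4 := hm (a, c + r • v)
      have : r = 1 := by
        nlinarith [mul_nonneg (sub_nonneg.2 hs1) (sub_nonneg.2 hle)]
      simp [this]
    rintro ⟨a, x⟩ ⟨ha, -⟩ ⟨b, y⟩ ⟨hb, -⟩ hxy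
    simp only [shrink, Prod.mk.injEq, add_right_inj] at hxy
    obtain ⟨rfl, hxy⟩ := hxy
    have ex : x = c + (x - c) := by abel
    have ey : y = c + (y - c) := by abel
    set v := x - c
    set w := y - c
    rw [ex, ey] at hxy
    have hmx := hm (a, c + v)
    have hmy := hm (a, c + w)
    set m := 1 - (1 - s) * χ (a, c + v) with hmdef
    set n := 1 - (1 - s) * χ (a, c + w) with hndef
    have hw : w = (m / n) • v := by
      rw [div_eq_inv_mul, mul_smul, hxy, smul_smul, inv_mul_cancel₀ hmy.ne', one_smul]
    have hv : v = (n / m) • w := by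
      rw [div_eq_inv_mul, mul_smul, ← hxy, smul_smul, inv_mul_cancel₀ hmx.ne', one_smul]
    have : v = w := by
      rcases le_total m n with hle | hle
      · exact key a ha v w (m / n) (by positivity) ((div_le_one hmy).2 hle) hw hxy
      · exact (key a ha w v (n / m) (by positivity) ((div_le_one hmx).2 hle) hv hxy.symm).symm
    rw [Prod.mk.injEq]
    exact ⟨rfl, by rw [ex, ey, this]⟩
  · rintro p ⟨hp, -⟩
    have hχp := hχ p hp
    have hd : DifferentiableAt ℝ χ p := hχp.differentiableAt (by simp)
    have hder : HasFDerivAt (shrink c s χ)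
        ((ContinuousLinearMap.fst ℝ A V).prod
          ((1 - (1 - s) * χ p) • (ContinuousLinearMap.snd ℝ A V) +
            (-((1 - s) • fderiv ℝ χ p)).smulRight (p.2 - c))) p := by
      refine HasFDerivAt.prodMk hasFDerivAt_fst ?_
      refine HasFDerivAt.const_add c ?_
      exact ((hd.hasFDerivAt.const_mul (1 - s)).const_sub 1).smul (hasFDerivAt_snd.sub_const c)
    refine ⟨?_, ?_⟩
    · refine contDiffAt_fst.prodMk (contDiffAt_const.add ?_)
      exact ((contDiffAt_const.sub (contDiffAt_const.mul hχp))).smul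
        (contDiffAt_snd.sub contDiffAt_const)
    · rw [hder.fderiv, injective_iff_map_eq_zero]
      rintro ⟨a, v⟩ hv
      simp only [ContinuousLinearMap.prod_apply, ContinuousLinearMap.coe_fst',
        _root_.add_apply, _root_.smul_apply,
        ContinuousLinearMap.coe_snd', ContinuousLinearMap.smulRight_apply,
        _root_.neg_apply, Prod.mk_eq_zero, smul_eq_mul] at hv
      obtain ⟨rfl, hv⟩ := hv
      have hmp := hm p
      -- the cutoff decreases in the radial direction
      have hδ : fderiv ℝ χ p (0, p.2 - c) ≤ 0 := by
        have hcurve : HasDerivAt (fun μ : ℝ => χ (p.1, c + μ • (p.2 - c)))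
            (fderiv ℝ χ p (0, p.2 - c)) 1 := by
          have h2 : HasDerivAt (fun μ : ℝ => (p.1, c + μ • (p.2 - c))) ((0 : A), p.2 - c) 1 := by
            refine (hasDerivAt_const _ _).prodMk ?_
            simpa using ((hasDerivAt_id (1 : ℝ)).smul_const (p.2 - c)).const_add c
          have h3 : HasFDerivAt χ (fderiv ℝ χ p) (p.1, c + (1 : ℝ) • (p.2 - c)) := by
            simpa using hd.hasFDerivAt
          exact h3.comp_hasDerivAt 1 h2
        have h4 := (hanti p.1 hp (p.2 - c)).derivWithin_nonpos (x := 1)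
        rwa [derivWithin_of_mem_nhds (Ici_mem_nhds one_pos), hcurve.deriv] at h4
      set m := 1 - (1 - s) * χ p
      set δ := fderiv ℝ χ p (0, p.2 - c)
      set τ := (1 - s) * fderiv ℝ χ p (0, v) / m with hτ
      have hv2 : v = τ • (p.2 - c) := by
        rw [hτ, div_eq_inv_mul, mul_smul, eq_inv_smul_iff₀ hmp.ne']
        rw [neg_smul, ← sub_eq_add_neg, sub_eq_zero] at hv
        exact hv
      have h5 : fderiv ℝ χ p (0, v) = τ * δ := by
        have : ((0 : A), v) = τ • ((0 : A), p.2 - c) := by simp [← hv2]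
        rw [this, map_smul, smul_eq_mul]
      have h6 : τ * (m - (1 - s) * δ) = 0 := by
        have : τ * m = (1 - s) * (τ * δ) := by rw [← h5, hτ]; field_simp
        linarith
      have h7 : 0 < m - (1 - s) * δ := by
        nlinarith [mul_nonneg (sub_nonneg.2 hs1) (neg_nonneg.2 hδ)]
      have h8 : τ = 0 := by
        rcases mul_eq_zero.1 h6 with h | h
        · exact h
        · exact absurd h h7.ne'
      simp [hv2, h8]

end Shrink

/-! ### Maps supported in a coordinate chart -/

section Transfer

variable {E F : Type*} [Nonempty E]

open Classical in
/-- The map that is `κ` in the coordinates `g : D → F`, and the identity outside of `g(D)`. -/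
def transfer (g : E → F) (D : Set E) (κ : E → E) (x : F) : F :=
  if x ∈ g '' D then g (κ (invFunOn g D x)) else x

theorem transfer_apply {g : E → F} {D : Set E} (hg : InjOn g D) (κ : E → E) {p : E} (hp : p ∈ D) :
    transfer g D κ (g p) = g (κ p) := by
  rw [transfer, if_pos (mem_image_of_mem g hp), hg.leftInvOn_invFunOn hp]

theorem transfer_eq_self {g : E → F} {D Kc : Set E} (hg : InjOn g D) {κ : E → E}
    (hid : ∀ p ∈ D, p ∉ Kc → κ p = p) {x : F} (hx : x ∉ g '' Kc) : transfer g D κ x = x := by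
  by_cases h : x ∈ g '' D
  · obtain ⟨p, hp, rfl⟩ := h
    rw [transfer_apply hg κ hp, hid p hp fun h => hx (mem_image_of_mem g h)]
  · rw [transfer, if_neg h]

theorem transfer_smul [AddCommGroup F] [Module ℝ F] {g : E → F} {D : Set E}
    {κ : E → E} (hg : InjOn g D)
    (h : ∀ p ∈ D, ∀ r : ℝ, 0 < r → ∃ q ∈ D, g q = r • g p ∧ g (κ q) = r • g (κ p))
    {r : ℝ} (hr : 0 < r) (x : F) : transfer g D κ (r • x) = r • transfer g D κ x := by
  by_cases hx : x ∈ g '' D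
  · obtain ⟨p, hp, rfl⟩ := hx
    obtain ⟨q, hq, h1, h2⟩ := h p hp r hr
    rw [transfer_apply hg κ hp, ← h1, transfer_apply hg κ hq, h2]
  · have hx' : r • x ∉ g '' D := by
      rintro ⟨p, hp, hpx⟩
      obtain ⟨q, hq, h1, -⟩ := h p hp r⁻¹ (inv_pos.2 hr)
      exact hx ⟨q, hq, by rw [h1, hpx, smul_smul, inv_mul_cancel₀ hr.ne', one_smul]⟩
    rw [transfer, if_neg hx', transfer, if_neg hx]

variable [NormedAddCommGroup E] [NormedSpace ℝ E] [NormedAddCommGroup F] [NormedSpace ℝ F]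

/-- Let `g` be a chart and `κ` an embedding, in coordinates, of an open set `W`.  If `κ` is the
identity outside of `Kc` and maps `W ∩ Kc` to `Kc`, where `g(Kc)` is closed apart from the origin,
then `κ` extends by the identity to an embedding of the complement of `g(Kc \ W)`. -/
theorem smoothEmb_transfer [FiniteDimensional ℝ E] [FiniteDimensional ℝ F]
    (hd : Module.finrank ℝ E = Module.finrank ℝ F)
    {g : E → F} {D W Kc : Set E} {κ : E → E} (hg : SmoothEmb g D) (hKD : Kc ⊆ D)
    (hκ : SmoothEmb κ W) (hκD : MapsTo κ W D) (hid : ∀ p ∈ D, p ∉ Kc → p ∈ W ∧ κ p = p)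
    (hκK : MapsTo κ (W ∩ Kc) Kc) (hK : IsClosed (insert 0 (g '' Kc)))
    (hKW : IsClosed (insert 0 (g '' (Kc \ W)))) :
    SmoothEmb (transfer g D κ) (insert 0 (g '' (Kc \ W)))ᶜ := by
  have hid' : ∀ p ∈ D, p ∉ Kc → κ p = p := fun p hp h => (hid p hp h).2
  have hW : ∀ p ∈ D, g p ∈ (insert 0 (g '' (Kc \ W)))ᶜ → p ∈ W := by
    intro p hp h
    by_contra hpW
    by_cases hpK : p ∈ Kc
    · exact h (Or.inr ⟨p, ⟨hpK, hpW⟩, rfl⟩)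
    · exact hpW (hid p hp hpK).1
  refine ⟨hKW.isOpen_compl, ?_, ?_⟩
  · have cross : ∀ x ∈ (insert 0 (g '' (Kc \ W)))ᶜ, x ∈ g '' Kc →
        ∃ p ∈ W, p ∈ Kc ∧ x = g p ∧ transfer g D κ x = g (κ p) := by
      rintro _ hx ⟨p, hp, rfl⟩
      exact ⟨p, hW p (hKD hp) hx, hp, rfl, transfer_apply hg.injOn κ (hKD hp)⟩
    intro x hx y hy hxy
    by_cases hxK : x ∈ g '' Kc <;> by_cases hyK : y ∈ g '' Kc
    · obtain ⟨p, hpW, hpK, rfl, hp⟩ := cross x hx hxK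
      obtain ⟨q, hqW, hqK, rfl, hq⟩ := cross y hy hyK
      rw [hp, hq] at hxy
      rw [hκ.injOn hpW hqW (hg.injOn (hκD hpW) (hκD hqW) hxy)]
    · obtain ⟨p, hpW, hpK, rfl, hp⟩ := cross x hx hxK
      rw [hp, transfer_eq_self hg.injOn hid' hyK] at hxy
      exact absurd (hxy ▸ mem_image_of_mem g (hκK ⟨hpW, hpK⟩)) hyK
    · obtain ⟨q, hqW, hqK, rfl, hq⟩ := cross y hy hyK
      rw [hq, transfer_eq_self hg.injOn hid' hxK] at hxy
      exact absurd (hxy ▸ mem_image_of_mem g (hκK ⟨hqW, hqK⟩)) hxK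
    · rwa [transfer_eq_self hg.injOn hid' hxK, transfer_eq_self hg.injOn hid' hyK] at hxy
  · intro x hx
    by_cases hxD : x ∈ g '' D
    · obtain ⟨p, hp, rfl⟩ := hxD
      have hpW := hW p hp hx
      have hl : ∀ q ∈ D, invFunOn g D (g q) = q := fun q hq => hg.injOn.leftInvOn_invFunOn hq
      have himm : ImmersionAt (fun y => g (κ (invFunOn g D y))) (g p) := by
        have h1 := (hg.inv hd).imm (g p) (mem_image_of_mem g hp)
        refine ImmersionAt.comp (g := fun q => g (κ q)) ?_ h1
        rw [hl p hp]
        exact (hg.imm _ (hκD hpW)).comp (hκ.imm p hpW)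
      refine himm.congr ?_
      filter_upwards [(hg.isOpen_image hd hg.isOpen Subset.rfl).mem_nhds
        (mem_image_of_mem g hp)] with y hy
      rw [transfer, if_pos hy]
    · refine (immersionAt_id x).congr ?_
      have hxK : x ∈ (insert 0 (g '' Kc))ᶜ := by
        rintro (h | ⟨p, hp, h⟩)
        · exact hx (Or.inl h)
        · exact hxD ⟨p, hKD hp, h⟩
      filter_upwards [hK.isOpen_compl.mem_nhds hxK] with y hy
      exact transfer_eq_self hg.injOn hid' fun h => hy (Or.inr h)

/-- A cone over a compact set that does not contain the origin is closed. -/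
theorem isClosed_insert_zero_cone {K S : Set F} (hK : IsCompact K) (h0 : (0 : F) ∉ K)
    (h1 : ∀ x ∈ S, ∃ r : ℝ, 0 < r ∧ ∃ k ∈ K, x = r • k)
    (h2 : ∀ r : ℝ, 0 < r → ∀ k ∈ K, r • k ∈ S) : IsClosed (insert 0 S) := by
  have hne : ∀ k ∈ K, k ≠ 0 := fun k hk h => h0 (h ▸ hk)
  have hK' : IsCompact ((fun k : F => ‖k‖⁻¹ • k) '' K) := by
    refine hK.image_of_continuousOn fun k hk => ?_
    exact ((continuousAt_id.norm.inv₀ (by simpa using hne k hk)).smul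
      continuousAt_id).continuousWithinAt
  rw [← isOpen_compl_iff, isOpen_iff_mem_nhds]
  intro x hx
  have hx0 : x ≠ 0 := fun h => hx (Or.inl h)
  have hxS : ‖x‖⁻¹ • x ∉ (fun k : F => ‖k‖⁻¹ • k) '' K := by
    rintro ⟨k, hk, hkx⟩
    refine hx (Or.inr ?_)
    have : x = (‖x‖ * ‖k‖⁻¹) • k := by
      rw [mul_smul]
      simp only at hkx
      rw [hkx, smul_smul, mul_inv_cancel₀ (by simpa using hx0), one_smul]
    rw [this]
    exact h2 _ (mul_pos (norm_pos_iff.2 hx0) (inv_pos.2 (norm_pos_iff.2 (hne k hk)))) k hk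
  have hc : ContinuousAt (fun y : F => ‖y‖⁻¹ • y) x :=
    (continuousAt_id.norm.inv₀ (by simpa using hx0)).smul continuousAt_id
  filter_upwards [hc.preimage_mem_nhds (hK'.isClosed.isOpen_compl.mem_nhds hxS),
    isOpen_ne.mem_nhds hx0] with y hy hy0
  rintro (h | hS)
  · exact hy0 h
  · obtain ⟨r, hr, k, hk, rfl⟩ := h1 y hS
    refine hy ⟨k, hk, ?_⟩
    simp only [norm_smul, Real.norm_eq_abs, abs_of_pos hr, smul_smul]
    congr 1
    field_simp

end Transfer

/-! ### Diffeomorphisms of the three-sphere as homogeneous maps -/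

theorem isPreconnected_compl_zero : IsPreconnected ({0}ᶜ : Set E4) :=
  (isConnected_compl_singleton_of_one_lt_rank (by
    rw [← Module.finrank_eq_rank]; simp) 0).isPreconnected

/-- `T` commutes with multiplication by positive scalars. -/
def PosHom (T : E4 → E4) : Prop := ∀ r : ℝ, 0 < r → ∀ x, T (r • x) = r • T x

/-- Euler's identity for positively homogeneous maps. -/
theorem PosHom.fderiv_self {T : E4 → E4} (h : PosHom T) {x : E4} (hd : DifferentiableAt ℝ T x) :
    fderiv ℝ T x x = T x := by
  have h1 : HasDerivAt (fun r : ℝ => T (r • x)) (fderiv ℝ T x x) 1 := by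
    have h2 : HasDerivAt (fun r : ℝ => r • x) x 1 := by
      simpa using (hasDerivAt_id (1 : ℝ)).smul_const x
    have h3 : HasFDerivAt T (fderiv ℝ T x) ((1 : ℝ) • x) := by simpa using hd.hasFDerivAt
    exact h3.comp_hasDerivAt 1 h2
  have h4 : HasDerivAt (fun r : ℝ => T (r • x)) (T x) 1 := by
    have h5 : HasDerivAt (fun r : ℝ => r • T x) (T x) 1 := by
      simpa using (hasDerivAt_id (1 : ℝ)).smul_const (T x)
    refine h5.congr_of_eventuallyEq ?_
    filter_upwards [lt_mem_nhds (zero_lt_one' ℝ)] with r hr using h r hr x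
  exact h1.unique h4

theorem PosHom.comp {S T : E4 → E4} (hS : PosHom S) (hT : PosHom T) :
    PosHom fun x => S (T x) := fun r hr x => by simp only [hT r hr, hS r hr]

/-- A diffeomorphism of `S³`, extended to `ℝ⁴` as a norm preserving map that is homogeneous of
degree one.  Surjectivity is automatic, see `IsConeDiffeo.surjective`. -/
structure IsConeDiffeo (h : E4 → E4) : Prop where
  emb : SmoothEmb h {0}ᶜ
  hom : PosHom h
  norm : ∀ x, ‖h x‖ = ‖x‖

theorem IsConeDiffeo.ne_zero {h : E4 → E4} (hh : IsConeDiffeo h) {x : E4} (hx : x ≠ 0) :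
    h x ≠ 0 := by
  rw [← norm_pos_iff, hh.norm]; exact norm_pos_iff.2 hx

theorem IsConeDiffeo.mapsTo_compl {h : E4 → E4} (hh : IsConeDiffeo h) :
    MapsTo h {0}ᶜ {0}ᶜ := fun _ hx => hh.ne_zero hx

theorem IsConeDiffeo.mapsTo_S3 {h : E4 → E4} (hh : IsConeDiffeo h) : MapsTo h S3 S3 := by
  intro x hx
  simp only [S3, mem_sphere_zero_iff_norm] at hx ⊢
  rw [hh.norm, hx]

theorem ne_zero_of_mem_S3 {x : E4} (hx : x ∈ S3) : x ≠ 0 := by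
  rintro rfl
  simp [S3] at hx

theorem IsConeDiffeo.comp {g h : E4 → E4} (hg : IsConeDiffeo g) (hh : IsConeDiffeo h) :
    IsConeDiffeo fun x => g (h x) :=
  ⟨hg.emb.comp hh.emb hh.mapsTo_compl, hg.hom.comp hh.hom, fun x => by rw [hg.norm, hh.norm]⟩

/-- The image is open and closed in the connected space `ℝ⁴ \ {0}`. -/
theorem IsConeDiffeo.surjective {h : E4 → E4} (hh : IsConeDiffeo h) : Surjective h := by
  have hz : h 0 = 0 := by rw [← norm_eq_zero, hh.norm, norm_zero]
  have ho : IsOpen (h '' {0}ᶜ) := hh.emb.isOpen_image rfl hh.emb.isOpen Subset.rfl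
  have hS0 : (0 : E4) ∉ h '' S3 := by
    rintro ⟨x, hx, h0⟩
    exact hh.ne_zero (ne_zero_of_mem_S3 hx) h0
  have hcl : IsClosed (insert 0 (h '' {0}ᶜ)) := by
    have hc : IsCompact (h '' S3) := (isCompact_sphere 0 1).image_of_continuousOn
      (hh.emb.continuousOn.mono fun x hx => ne_zero_of_mem_S3 hx)
    refine isClosed_insert_zero_cone hc hS0 ?_ ?_
    · rintro _ ⟨x, hx, rfl⟩
      have hx' : (0 : ℝ) < ‖x‖ := norm_pos_iff.2 hx
      refine ⟨‖x‖, hx', h (‖x‖⁻¹ • x), ⟨_, ?_, rfl⟩, ?_⟩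
      · simp [S3, norm_smul, hx'.ne']
      · rw [hh.hom _ (inv_pos.2 hx'), smul_smul, mul_inv_cancel₀ hx'.ne', one_smul]
    · rintro r hr _ ⟨x, hx, rfl⟩
      refine ⟨r • x, ?_, hh.hom r hr x⟩
      simp [hr.ne', ne_zero_of_mem_S3 hx]
  have hsub : ({0}ᶜ : Set E4) ⊆ h '' {0}ᶜ := by
    obtain ⟨x, hx⟩ := exists_ne (0 : E4)
    refine isPreconnected_compl_zero.subset_left_of_subset_union ho hcl.isOpen_compl ?_ ?_ ?_
    · exact disjoint_left.2 fun y hy hy' => hy' (Or.inr hy)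
    · intro y hy
      by_cases hyi : y ∈ h '' {0}ᶜ
      · exact Or.inl hyi
      · exact Or.inr fun h => h.elim (fun h => hy h) hyi
    · exact ⟨h x, hh.ne_zero hx, mem_image_of_mem h hx⟩
  intro y
  by_cases hy : y = 0
  · exact ⟨0, by rw [hz, hy]⟩
  · obtain ⟨x, -, hx⟩ := hsub hy
    exact ⟨x, hx⟩

theorem IsConeDiffeo.bijective {h : E4 → E4} (hh : IsConeDiffeo h) : Bijective h := by
  have hz : h 0 = 0 := by rw [← norm_eq_zero, hh.norm, norm_zero]
  refine ⟨fun x y hxy => ?_, hh.surjective⟩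
  by_cases hx : x = 0
  · subst hx
    by_contra hy
    exact hh.ne_zero (Ne.symm hy) (by rw [← hxy, hz])
  · have hy : y ≠ 0 := by
      rintro rfl
      exact hh.ne_zero hx (by rw [hxy, hz])
    exact hh.emb.injOn hx hy hxy

/-- Every cone diffeomorphism has an inverse of the same kind. -/
theorem IsConeDiffeo.exists_inverse {h : E4 → E4} (hh : IsConeDiffeo h) :
    ∃ g : E4 → E4, IsConeDiffeo g ∧ (∀ x, g (h x) = x) ∧ ∀ x, h (g x) = x := by
  obtain ⟨g, hgl, hgr⟩ := Function.bijective_iff_has_inverse.1 hh.bijective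
  have hn : ∀ x, ‖g x‖ = ‖x‖ := fun x => by rw [← hh.norm, hgr]
  have hg0 : ∀ x, x ≠ 0 → g x ≠ 0 := fun x hx => by
    rw [← norm_pos_iff, hn]; exact norm_pos_iff.2 hx
  refine ⟨g, ⟨⟨isOpen_compl_singleton, fun x _ y _ hxy => ?_, fun x hx => ?_⟩, fun r hr x => ?_,
    hn⟩, hgl, hgr⟩
  · rw [← hgr x, ← hgr y, hxy]
  · have hx' : x ∈ h '' {0}ᶜ := ⟨g x, hg0 x hx, hgr x⟩
    refine ((hh.emb.inv rfl).imm x hx').congr ?_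
    filter_upwards [isOpen_compl_singleton.mem_nhds hx] with y hy
    have : invFunOn h {0}ᶜ (h (g y)) = g y := hh.emb.injOn.leftInvOn_invFunOn (hg0 y hy)
    rw [hgr] at this
    exact this.symm
  · rw [← hgl (r • g x), hh.hom r hr, hgr]

/-- Rescaling of a positively homogeneous map to a norm preserving one. -/
def normalize (T : E4 → E4) (x : E4) : E4 := (‖x‖ / ‖T x‖) • T x

theorem normalize_of_norm_eq {T : E4 → E4} {x : E4} (h : ‖T x‖ = ‖x‖) : normalize T x = T x := by
  by_cases hx : x = 0
  · subst hx
    simp only [norm_zero, norm_eq_zero] at h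
    simp [normalize, h]
  · rw [normalize, h, div_self (norm_ne_zero_iff.2 hx), one_smul]

theorem isConeDiffeo_normalize {T : E4 → E4} (hT : SmoothEmb T {0}ᶜ) (hom : PosHom T)
    (h0 : ∀ x, x ≠ 0 → T x ≠ 0) : IsConeDiffeo (normalize T) := by
  have hn : ∀ x, ‖normalize T x‖ = ‖x‖ := fun x => by
    by_cases hx : x = 0
    · simp [normalize, hx]
    · rw [normalize, norm_smul, norm_div, norm_norm, norm_norm,
        div_mul_cancel₀ _ (norm_ne_zero_iff.2 (h0 x hx))]
  have hph : PosHom (normalize T) := fun r hr x => by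
    rw [normalize, normalize, hom r hr, norm_smul, norm_smul, smul_smul, smul_smul,
      mul_div_mul_left _ _ (by simpa using hr.ne'), mul_comm]
  have hsm : ∀ x ∈ ({0}ᶜ : Set E4), ContDiffAt ℝ ∞ (normalize T) x := fun x hx =>
    ((contDiffAt_id.norm ℝ hx).div ((hT.imm x hx).smooth.norm ℝ (h0 x hx))
      (norm_ne_zero_iff.2 (h0 x hx))).smul (hT.imm x hx).smooth
  refine ⟨⟨isOpen_compl_singleton, fun x hx y hy hxy => ?_, fun x hx => ⟨hsm x hx, ?_⟩⟩, hph, hn⟩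
  · have hxp : (0 : ℝ) < ‖x‖ := norm_pos_iff.2 hx
    have hyp : (0 : ℝ) < ‖y‖ := norm_pos_iff.2 hy
    have hTx := norm_pos_iff.2 (h0 x hx)
    have hTy := norm_pos_iff.2 (h0 y hy)
    have hnxy : ‖x‖ = ‖y‖ := by rw [← hn x, ← hn y, hxy]
    rw [normalize, normalize, ← hom _ (by positivity), ← hom _ (by positivity)] at hxy
    have h1 := hT.injOn (by simp [hxp.ne', hTx.ne', norm_pos_iff.1 hxp])
      (by simp [hyp.ne', hTy.ne', norm_pos_iff.1 hyp]) hxy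
    have h2 := congrArg norm h1
    rw [norm_smul, norm_smul, hnxy, norm_div, norm_div, norm_norm, norm_norm, norm_norm] at h2
    have h3 : ‖y‖ / ‖T x‖ = ‖y‖ / ‖T y‖ := mul_right_cancel₀ hyp.ne' h2
    rw [hnxy, h3] at h1
    exact smul_right_injective E4 (by positivity) h1
  · -- a vector killed by the derivative is radial, and radial vectors are not killed
    have hTd := (hT.imm x hx).differentiableAt
    have hl : DifferentiableAt ℝ (fun y => ‖y‖ / ‖T y‖) x :=
      (((contDiffAt_id (n := ∞)).norm ℝ hx).div ((hT.imm x hx).smooth.norm ℝ (h0 x hx))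
        (norm_ne_zero_iff.2 (h0 x hx))).differentiableAt (by simp)
    have hder := hl.hasFDerivAt.smul hTd.hasFDerivAt
    have hc : (0 : ℝ) < ‖x‖ / ‖T x‖ := div_pos (norm_pos_iff.2 hx) (norm_pos_iff.2 (h0 x hx))
    rw [injective_iff_map_eq_zero]
    intro v hv
    have hv' := hv
    rw [show normalize T = (fun y => ‖y‖ / ‖T y‖) • T from rfl, hder.fderiv] at hv'
    simp only [_root_.add_apply, _root_.smul_apply, ContinuousLinearMap.smulRight_apply] at hv'
    set a := fderiv ℝ (fun y => ‖y‖ / ‖T y‖) x v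
    have hrad : v = (-((‖x‖ / ‖T x‖)⁻¹ * a)) • x := by
      apply (hT.imm x hx).inj
      rw [map_smul, hom.fderiv_self hTd, neg_smul, mul_smul, ← smul_neg, eq_inv_smul_iff₀ hc.ne']
      exact eq_neg_of_add_eq_zero_left hv'
    rw [hrad, map_smul, hph.fderiv_self ((hsm x hx).differentiableAt (by simp))] at hv
    rcases smul_eq_zero.1 hv with h | h
    · rw [hrad, h, zero_smul]
    · exact absurd (by rw [← hn x, h, norm_zero]) (norm_ne_zero_iff.2 hx)

/-! ### Orientations -/

/-- The determinant of four vectors of `ℝ⁴`. -/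
def frameDet (x u v w : E4) : ℝ := (Matrix.of fun i j : Fin 4 => (![x, u, v, w] i) j).det

theorem frameDet_eq (x u v w : E4) :
    frameDet x u v w = (EuclideanSpace.basisFun (Fin 4) ℝ).toBasis.det ![x, u, v, w] := by
  rw [Module.Basis.det_apply, frameDet, ← Matrix.det_transpose]
  rfl

theorem frameDet_map (L : E4 →L[ℝ] E4) (x u v w : E4) :
    frameDet (L x) (L u) (L v) (L w) = L.det * frameDet x u v w := by
  rw [frameDet_eq, frameDet_eq, ContinuousLinearMap.det, ← Module.Basis.det_comp]
  congr 1
  ext i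
  fin_cases i <;> rfl

theorem continuous_frameDet :
    Continuous fun p : E4 × E4 × E4 × E4 => frameDet p.1 p.2.1 p.2.2.1 p.2.2.2 := by
  unfold frameDet
  refine Continuous.matrix_det ?_
  refine continuous_matrix fun i j => ?_
  fin_cases i <;> simp <;> fun_prop

/-- A frame with nonzero determinant is linearly independent. -/
theorem eq_zero_of_frameDet_ne_zero {x u v w : E4} (h : frameDet x u v w ≠ 0) {a b c d : ℝ}
    (h0 : a • x + b • u + c • v + d • w = 0) : a = 0 ∧ b = 0 ∧ c = 0 ∧ d = 0 := by
  have hli : LinearIndependent ℝ ![x, u, v, w] := by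
    rw [frameDet_eq] at h
    exact ((Module.Basis.is_basis_iff_det _).2 (isUnit_iff_ne_zero.2 h)).1
  rw [Fintype.linearIndependent_iff] at hli
  have := hli ![a, b, c, d] (by simpa [Fin.sum_univ_four] using h0)
  exact ⟨this 0, this 1, this 2, this 3⟩

theorem det_ne_zero_of_injective {L : E4 →L[ℝ] E4} (h : Injective L) : L.det ≠ 0 := by
  intro h0
  have h1 := LinearMap.bot_lt_ker_of_det_eq_zero (f := L.toLinearMap) h0
  rw [LinearMap.ker_eq_bot.2 h] at h1
  exact lt_irrefl _ h1

theorem ImmersionAt.continuousAt_fderiv {E F : Type*} [NormedAddCommGroup E] [NormedSpace ℝ E]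
    [NormedAddCommGroup F] [NormedSpace ℝ F] {f : E → F} {x : E} (h : ImmersionAt f x) :
    ContinuousAt (fderiv ℝ f) x :=
  (h.smooth.fderiv_right (m := 0) (by simp)).continuousAt

theorem pos_of_preconnected {X : Type*} [TopologicalSpace X] {s : Set X} (hs : IsPreconnected s)
    {f : X → ℝ} (hf : ContinuousOn f s) (h0 : ∀ x ∈ s, f x ≠ 0) {a : X} (ha : a ∈ s)
    (hpos : 0 < f a) {x : X} (hx : x ∈ s) : 0 < f x := by
  by_contra hneg
  have := hs.intermediate_value hx ha hf ⟨not_lt.1 hneg, hpos.le⟩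
  obtain ⟨y, hy, hy0⟩ := this
  exact h0 y hy hy0

theorem IsConeDiffeo.det_pos {h : E4 → E4} (hh : IsConeDiffeo h) {a : E4} (ha : a ≠ 0)
    (hpos : 0 < (fderiv ℝ h a).det) {x : E4} (hx : x ≠ 0) : 0 < (fderiv ℝ h x).det :=
  pos_of_preconnected isPreconnected_compl_zero
    (fun y hy => (ContinuousLinearMap.continuous_det.continuousAt.comp
      (hh.emb.imm y hy).continuousAt_fderiv).continuousWithinAt)
    (fun y hy => det_ne_zero_of_injective (hh.emb.imm y hy).inj) ha hpos hx

/-- A cone diffeomorphism with positive Jacobian determinant. -/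
structure IsOrientedConeDiffeo (h : E4 → E4) : Prop extends IsConeDiffeo h where
  det_pos' : ∀ x, x ≠ 0 → 0 < (fderiv ℝ h x).det

theorem IsOrientedConeDiffeo.comp {g h : E4 → E4} (hg : IsOrientedConeDiffeo g)
    (hh : IsOrientedConeDiffeo h) : IsOrientedConeDiffeo fun x => g (h x) := by
  refine ⟨hg.toIsConeDiffeo.comp hh.toIsConeDiffeo, fun x hx => ?_⟩
  have := fderiv_comp x (hg.emb.imm _ (hh.ne_zero hx)).differentiableAt
    (hh.emb.imm x hx).differentiableAt
  rw [show (fun y => g (h y)) = g ∘ h from rfl, this]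
  have h1 := mul_pos (hg.det_pos' _ (hh.ne_zero hx)) (hh.det_pos' x hx)
  rwa [ContinuousLinearMap.det, ContinuousLinearMap.det, ← LinearMap.det_comp] at h1

theorem IsOrientedConeDiffeo.exists_inverse {h : E4 → E4} (hh : IsOrientedConeDiffeo h) :
    ∃ g : E4 → E4, IsOrientedConeDiffeo g ∧ (∀ x, g (h x) = x) ∧ ∀ x, h (g x) = x := by
  obtain ⟨g, hg, hl, hr⟩ := hh.toIsConeDiffeo.exists_inverse
  refine ⟨g, ⟨hg, fun x hx => ?_⟩, hl, hr⟩
  have hc : (fun y => h (g y)) = fun y => y := funext hr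
  have := fderiv_comp x (hh.emb.imm _ (hg.ne_zero hx)).differentiableAt
    (hg.emb.imm x hx).differentiableAt
  rw [show h ∘ g = fun y => y from hc, fderiv_fun_id] at this
  have hd : (1 : ℝ) = (fderiv ℝ h (g x)).det * (fderiv ℝ g x).det := by
    rw [ContinuousLinearMap.det, ContinuousLinearMap.det, ← LinearMap.det_comp,
      ← ContinuousLinearMap.toLinearMap_comp, ← this]
    simp
  have h1 := hh.det_pos' (g x) (hg.ne_zero hx)
  by_contra hneg
  nlinarith [mul_nonneg h1.le (sub_nonneg.2 (not_lt.1 hneg))]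

theorem IsConeDiffeo.smoothNear {h : E4 → E4} (hh : IsConeDiffeo h) : SmoothNear h S3 :=
  ⟨{0}ᶜ, isOpen_compl_singleton, fun _ hx => ne_zero_of_mem_S3 hx, hh.emb.contDiffOn⟩

theorem IsOrientedConeDiffeo.isOrientedDiffeo {h : E4 → E4} (hh : IsOrientedConeDiffeo h) :
    IsOrientedDiffeo h := by
  obtain ⟨g, hg, hl, hr⟩ := hh.toIsConeDiffeo.exists_inverse
  refine ⟨hh.smoothNear, hh.mapsTo_S3, ⟨g, hg.smoothNear, hg.mapsTo_S3,
    fun x _ => ⟨hl x, hr x⟩⟩, fun x hx u v w _ _ _ hp => ?_⟩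
  have hx0 := ne_zero_of_mem_S3 hx
  have h1 : 0 < frameDet (fderiv ℝ h x x) (fderiv ℝ h x u) (fderiv ℝ h x v) (fderiv ℝ h x w) := by
    rw [frameDet_map]
    exact mul_pos (hh.det_pos' x hx0) hp
  rwa [hh.hom.fderiv_self (hh.emb.imm x hx0).differentiableAt] at h1

/-! ### Images of oriented curves and surfaces -/

section Push

variable {E F H : Type*} [NormedAddCommGroup E] [NormedSpace ℝ E]
  [NormedAddCommGroup F] [NormedSpace ℝ F] [NormedAddCommGroup H] [NormedSpace ℝ H]

theorem curveCarrier_pushforward (f : E → F) (C : Set (E × E)) :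
    curveCarrier (pushforward f C) = f '' curveCarrier C := by
  simp only [curveCarrier, pushforward, image_image]

theorem pushforward_comp {g : F → H} {f : E → F} {C : Set (E × E)}
    (hf : ∀ x ∈ curveCarrier C, DifferentiableAt ℝ f x)
    (hg : ∀ x ∈ curveCarrier C, DifferentiableAt ℝ g (f x)) :
    pushforward (g ∘ f) C = pushforward g (pushforward f C) := by
  simp only [pushforward, image_image]
  refine image_congr fun p hp => ?_
  have hp' : p.1 ∈ curveCarrier C := mem_image_of_mem _ hp
  rw [fderiv_comp _ (hg _ hp') (hf _ hp')]
  rfl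

theorem pushforward_congr {g f : E → F} {C : Set (E × E)}
    (h : ∀ x ∈ curveCarrier C, g =ᶠ[𝓝 x] f) : pushforward g C = pushforward f C := by
  refine image_congr fun p hp => ?_
  have hp' : p.1 ∈ curveCarrier C := mem_image_of_mem _ hp
  rw [(h _ hp').fderiv_eq, (h _ hp').eq_of_nhds]

/-- The image of an oriented surface under a map. -/
def pushFrames (f : E → F) (S : Set (E × E × E)) : Set (F × F × F) :=
  (fun p : E × E × E => (f p.1, fderiv ℝ f p.1 p.2.1, fderiv ℝ f p.1 p.2.2)) '' S

theorem surfaceCarrier_pushFrames (f : E → F) (S : Set (E × E × E)) :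
    surfaceCarrier (pushFrames f S) = f '' surfaceCarrier S := by
  simp only [surfaceCarrier, pushFrames, image_image]

end Push

theorem KnotEquiv.comp_left {C C' : Set (E4 × E4)} {h : E4 → E4} (hh : IsOrientedConeDiffeo h)
    (hC : curveCarrier C ⊆ S3) (H : KnotEquiv C C') : KnotEquiv (pushforward h C) C' := by
  obtain ⟨f, hf, hfC⟩ := H
  obtain ⟨g, hg, hgl, hgr⟩ := hh.exists_inverse
  have hgo := hg.isOrientedDiffeo
  obtain ⟨⟨U, hU, hSU, hfU⟩, hf2, ⟨f', ⟨U', hU', hSU', hf'U'⟩, hf'2, hff'⟩, hf4⟩ := hf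
  have hfd : ∀ x ∈ S3, DifferentiableAt ℝ f x := fun x hx =>
    (hfU.contDiffAt (hU.mem_nhds (hSU hx))).differentiableAt (by simp)
  have hgd : ∀ x ∈ S3, DifferentiableAt ℝ g x := fun x hx =>
    (hg.emb.imm x (ne_zero_of_mem_S3 hx)).differentiableAt
  refine ⟨f ∘ g, ⟨?_, hf2.comp hg.mapsTo_S3, ⟨h ∘ f', ?_, hh.mapsTo_S3.comp hf'2, ?_⟩, ?_⟩, ?_⟩
  · refine ⟨{0}ᶜ ∩ g ⁻¹' U, hg.emb.continuousOn.isOpen_inter_preimage hg.emb.isOpen hU,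
      fun x hx => ⟨ne_zero_of_mem_S3 hx, hSU (hg.mapsTo_S3 hx)⟩,
      hfU.comp (hg.emb.contDiffOn.mono inter_subset_left) fun x hx => hx.2⟩
  · refine ⟨U' ∩ f' ⁻¹' {0}ᶜ, hf'U'.continuousOn.isOpen_inter_preimage hU' hh.emb.isOpen,
      fun x hx => ⟨hSU' hx, ne_zero_of_mem_S3 (hf'2 hx)⟩,
      hh.emb.contDiffOn.comp (hf'U'.mono inter_subset_left) fun x hx => hx.2⟩
  · intro x hx
    have h1 := (hff' (g x) (hg.mapsTo_S3 hx)).1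
    have h2 := (hff' x hx).2
    exact ⟨by simp only [comp_apply, h1, hgr], by simp only [comp_apply, hgl, h2]⟩
  · intro x hx u v w hu hv hw hp
    have hgx := hg.mapsTo_S3 hx
    have hin : ∀ u, inner ℝ x u = 0 → inner ℝ (g x) (fderiv ℝ g x u) = 0 := by
      intro u hu
      -- `g` preserves the norm
      have h1 : HasFDerivAt (fun y => inner ℝ (g y) (g y)) _ x :=
        (hgd x hx).hasFDerivAt.inner ℝ (hgd x hx).hasFDerivAt
      have h2 : (fun y => inner ℝ (g y) (g y)) = fun y : E4 => inner ℝ y y := by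
        funext y
        rw [real_inner_self_eq_norm_sq, real_inner_self_eq_norm_sq, hg.norm]
      rw [h2] at h1
      have h3 : HasFDerivAt (fun y : E4 => inner ℝ y y) _ x :=
        (hasFDerivAt_id x).inner ℝ (hasFDerivAt_id x)
      have h4 := congrArg (fun L : E4 →L[ℝ] ℝ => L u) (h1.unique h3)
      simp only [ContinuousLinearMap.comp_apply, ContinuousLinearMap.prod_apply,
        fderivInnerCLM_apply, ContinuousLinearMap.id_apply, id, real_inner_comm x u, hu,
        real_inner_comm (g x)] at h4
      have h5 := real_inner_comm (g x) (fderiv ℝ g x u)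
      linarith
    rw [fderiv_comp _ (hfd _ hgx) (hgd x hx)]
    exact hf4 (g x) hgx _ _ _ (hin u hu) (hin v hv) (hin w hw) (hgo.2.2.2 x hx u v w hu hv hw hp)
  · have hhd : ∀ x ∈ curveCarrier C, DifferentiableAt ℝ h x := fun x hx =>
      (hh.emb.imm x (ne_zero_of_mem_S3 (hC hx))).differentiableAt
    rw [← pushforward_comp hhd, show (f ∘ g) ∘ h = f from funext fun x => by simp [hgl], hfC]
    intro x hx
    rw [show f ∘ g = fun y => f (g y) from rfl]
    refine DifferentiableAt.comp (h x) ?_ (hgd _ (hh.mapsTo_S3 (hC hx)))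
    rw [hgl]
    exact hfd x (hC hx)

/-! ### The boundary of an oriented surface -/

section Boundary

variable {E F : Type*} [NormedAddCommGroup E] [NormedSpace ℝ E]
  [NormedAddCommGroup F] [NormedSpace ℝ F]

theorem uniqueDiffOn_halfPlane : UniqueDiffOn ℝ halfPlane := by
  have h : halfPlane = Iic (0 : ℝ) ×ˢ (univ : Set ℝ) := by ext q; simp [halfPlane]
  rw [h]
  exact (uniqueDiffOn_Iic 0).prod uniqueDiffOn_univ

namespace IsSurfaceChart

variable {S : Set (E × E × E)} {U U' : Set (ℝ × ℝ)} {O O' : Set E} {c c' : ℝ × ℝ → E}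
  {r r' : E → ℝ × ℝ}

theorem mem (h : IsSurfaceChart S U O c r) {q : ℝ × ℝ} (hq : q ∈ U) (hq' : q ∈ halfPlane) :
    c q ∈ surfaceCarrier S ∧ c q ∈ O := by
  obtain ⟨-, -, -, -, hi, -⟩ := h
  rw [← mem_inter_iff, ← hi]
  exact mem_image_of_mem c ⟨hq, hq'⟩

theorem exists_eq (h : IsSurfaceChart S U O c r) {x : E} (hx : x ∈ surfaceCarrier S)
    (hO : x ∈ O) : ∃ q ∈ U, q ∈ halfPlane ∧ c q = x ∧ r x = q := by
  obtain ⟨-, -, -, -, hi, hr, -⟩ := h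
  have : x ∈ c '' (U ∩ halfPlane) := hi ▸ ⟨hx, hO⟩
  obtain ⟨q, hq, rfl⟩ := this
  exact ⟨q, hq.1, hq.2, rfl, hr q hq⟩

theorem differentiableAt (h : IsSurfaceChart S U O c r) {q : ℝ × ℝ} (hq : q ∈ U) :
    DifferentiableAt ℝ c q :=
  (h.2.2.1.contDiffAt (h.1.mem_nhds hq)).differentiableAt (by simp)

theorem differentiableAt_inv (h : IsSurfaceChart S U O c r) {x : E} (hx : x ∈ O) :
    DifferentiableAt ℝ r x :=
  (h.2.2.2.1.contDiffAt (h.2.1.mem_nhds hx)).differentiableAt (by simp)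

theorem fderiv_inv (h : IsSurfaceChart S U O c r) {q : ℝ × ℝ} (hq : q ∈ U)
    (hq' : q ∈ halfPlane) (v : ℝ × ℝ) : fderiv ℝ r (c q) (fderiv ℝ c q v) = v := by
  have h1 := ((h.differentiableAt_inv (h.mem hq hq').2).hasFDerivAt.comp q
    (h.differentiableAt hq).hasFDerivAt).hasFDerivWithinAt (s := halfPlane)
  have h2 : HasFDerivWithinAt (r ∘ c) (ContinuousLinearMap.id ℝ (ℝ × ℝ)) halfPlane q := by
    refine (hasFDerivWithinAt_id q halfPlane).congr_of_eventuallyEq ?_ (h.2.2.2.2.2.1 q ⟨hq, hq'⟩)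
    filter_upwards [self_mem_nhdsWithin, mem_nhdsWithin_of_mem_nhds (h.1.mem_nhds hq)] with p hp hpU
    exact h.2.2.2.2.2.1 p ⟨hpU, hp⟩
  exact congrArg (fun L : ℝ × ℝ →L[ℝ] ℝ × ℝ => L v)
    ((uniqueDiffOn_halfPlane q hq').eq h1 h2)

/-- The coordinate frame of one chart in terms of another chart. -/
theorem exists_frame (h : IsSurfaceChart S U O c r) (h' : IsSurfaceChart S U' O' c' r')
    {q q' : ℝ × ℝ} (hq : q ∈ U) (hqh : q ∈ halfPlane) (hq' : q' ∈ U') (hqh' : q' ∈ halfPlane)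
    (he : c q = c' q') : ∃ a b : ℝ × ℝ, 0 < det2 a b ∧ fderiv ℝ c q (1, 0) = fderiv ℝ c' q' a ∧
      fderiv ℝ c q (0, 1) = fderiv ℝ c' q' b := by
  have h1 : (c q, fderiv ℝ c q (1, 0), fderiv ℝ c q (0, 1)) ∈ S :=
    (h.2.2.2.2.2.2 q ⟨hq, hqh⟩ _ _).2 ⟨(1, 0), (0, 1), by simp [det2], rfl, rfl⟩
  rw [he] at h1
  exact (h'.2.2.2.2.2.2 q' ⟨hq', hqh'⟩ _ _).1 h1

/-- Interior points of a surface are not boundary points: in any chart the first coordinate of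
nearby points of the surface would have a maximum there, although coordinate changes are
immersions. -/
theorem fst_ne_zero (h : IsSurfaceChart S U O c r) (h' : IsSurfaceChart S U' O' c' r')
    {q q' : ℝ × ℝ} (hq : q ∈ U) (hq0 : q.1 < 0) (hq' : q' ∈ U') (he : c q = c' q') :
    q'.1 ≠ 0 := by
  intro h0
  have hqh : q ∈ halfPlane := hq0.le
  have hqh' : q' ∈ halfPlane := h0.le
  have hO' : c q ∈ O' := he ▸ (h'.mem hq' hqh').2
  have hdτ : HasFDerivAt (fun p => (r' (c p)).1)
      ((ContinuousLinearMap.fst ℝ ℝ ℝ).comp ((fderiv ℝ r' (c q)).comp (fderiv ℝ c q))) q :=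
    hasFDerivAt_fst.comp q ((h'.differentiableAt_inv hO').hasFDerivAt.comp q
      (h.differentiableAt hq).hasFDerivAt)
  have hrq : r' (c q) = q' := by rw [he]; exact h'.2.2.2.2.2.1 q' ⟨hq', hqh'⟩
  have hmax : IsLocalMax (fun p => (r' (c p)).1) q := by
    have hn : ∀ᶠ p : ℝ × ℝ in 𝓝 q, p.1 < 0 := continuousAt_fst.eventually (gt_mem_nhds hq0)
    filter_upwards [h.1.mem_nhds hq, hn,
      (h.differentiableAt hq).continuousAt.preimage_mem_nhds (h'.2.1.mem_nhds hO')] with p hp hp0 hpO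
    obtain ⟨p', -, hp', -, hr⟩ := h'.exists_eq (h.mem hp hp0.le).1 hpO
    rw [hr, hrq, h0]
    exact hp'
  have hz := hmax.hasFDerivAt_eq_zero hdτ
  obtain ⟨a, b, hab, ha, hb⟩ := h.exists_frame h' hq hqh hq' hqh' he
  have key : ∀ v, (fderiv ℝ r' (c q) (fderiv ℝ c q v)).1 = 0 := fun v =>
    congrArg (fun L : ℝ × ℝ →L[ℝ] ℝ => L v) hz
  have ha0 := key (1, 0)
  have hb0 := key (0, 1)
  rw [ha, he, h'.fderiv_inv hq' hqh'] at ha0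
  rw [hb, he, h'.fderiv_inv hq' hqh'] at hb0
  simp [det2, ha0, hb0] at hab

theorem fst_eq_zero (h : IsSurfaceChart S U O c r) {q : ℝ × ℝ} (hq : q ∈ U)
    (hqh : q ∈ halfPlane) (hb : c q ∈ curveCarrier (boundary S)) : q.1 = 0 := by
  obtain ⟨p, ⟨U', O', c', r', h', q', hq', hq0', hp, -⟩, hpc⟩ := hb
  by_contra hne
  exact h.fst_ne_zero h' hq (lt_of_le_of_ne hqh hne) hq' (by rw [← hp, hpc]) hq0'

theorem mem_boundary (h : IsSurfaceChart S U O c r) {q : ℝ × ℝ} (hq : q ∈ U) (h0 : q.1 = 0)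
    {a : ℝ} (ha : 0 < a) : (c q, a • fderiv ℝ c q (0, 1)) ∈ boundary S :=
  ⟨U, O, c, r, h, q, hq, h0, rfl, a, ha, rfl⟩

theorem mem_curveCarrier_boundary (h : IsSurfaceChart S U O c r) {q : ℝ × ℝ} (hq : q ∈ U)
    (h0 : q.1 = 0) : c q ∈ curveCarrier (boundary S) :=
  mem_image_of_mem Prod.fst (h.mem_boundary hq h0 one_pos)

/-- Two charts induce the same orientation of the boundary. -/
theorem exists_pos_smul (h : IsSurfaceChart S U O c r) (h' : IsSurfaceChart S U' O' c' r')
    {q q' : ℝ × ℝ} (hq : q ∈ U) (h0 : q.1 = 0) (hq' : q' ∈ U') (h0' : q'.1 = 0)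
    (he : c q = c' q') : ∃ a : ℝ, 0 < a ∧ fderiv ℝ c q (0, 1) = a • fderiv ℝ c' q' (0, 1) := by
  have hqh : q ∈ halfPlane := h0.le
  have hqh' : q' ∈ halfPlane := h0'.le
  obtain ⟨a, b, hab, ha, hb⟩ := h.exists_frame h' hq hqh hq' hqh' he
  have hO' : c q ∈ O' := he ▸ (h'.mem hq' hqh').2
  have hrq : r' (c q) = q' := by rw [he]; exact h'.2.2.2.2.2.1 q' ⟨hq', hqh'⟩
  have hdτ : HasFDerivAt (fun p => (r' (c p)).1)
      ((ContinuousLinearMap.fst ℝ ℝ ℝ).comp ((fderiv ℝ r' (c q)).comp (fderiv ℝ c q))) q :=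
    hasFDerivAt_fst.comp q ((h'.differentiableAt_inv hO').hasFDerivAt.comp q
      (h.differentiableAt hq).hasFDerivAt)
  have hline : ∀ v : ℝ × ℝ, HasDerivAt (fun s : ℝ => (r' (c (q + s • v))).1)
      (fderiv ℝ r' (c q) (fderiv ℝ c q v)).1 0 := by
    intro v
    have h2 : HasDerivAt (fun s : ℝ => q + s • v) v 0 := by
      simpa using ((hasDerivAt_id (0 : ℝ)).smul_const v).const_add q
    exact hdτ.comp_hasDerivAt_of_eq 0 h2 (by simp)
  have hcont : ∀ v : ℝ × ℝ, ∀ᶠ s : ℝ in 𝓝 0, q + s • v ∈ U ∧ c (q + s • v) ∈ O' := by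
    intro v
    have h2 : ContinuousAt (fun s : ℝ => q + s • v) 0 := by fun_prop
    have h3 : ∀ᶠ p in 𝓝 (q + (0 : ℝ) • v), p ∈ U ∧ c p ∈ O' := by
      rw [zero_smul, add_zero]
      exact (h.1.mem_nhds hq |> eventually_of_mem <| fun _ h => h).and
        ((h.differentiableAt hq).continuousAt.preimage_mem_nhds (h'.2.1.mem_nhds hO'))
    exact h2.eventually h3
  -- the boundary line is mapped to the boundary line
  have hb1 : b.1 = 0 := by
    have h2 := hline (0, 1)
    rw [hb, he, h'.fderiv_inv hq' hqh'] at h2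
    refine h2.unique ((hasDerivAt_const 0 (0 : ℝ)).congr_of_eventuallyEq ?_)
    filter_upwards [hcont (0, 1)] with s hs
    have hs0 : (q + s • ((0 : ℝ), (1 : ℝ))).1 = 0 := by simp [h0]
    obtain ⟨p, hp, hph, hpc, hpr⟩ := h'.exists_eq (h.mem hs.1 hs0.le).1 hs.2
    rw [hpr]
    exact h'.fst_eq_zero hp hph (hpc ▸ h.mem_curveCarrier_boundary hs.1 hs0)
  -- the half-plane is mapped to the half-plane
  have ha1 : 0 ≤ a.1 := by
    have h2 := hline (1, 0)
    rw [ha, he, h'.fderiv_inv hq' hqh'] at h2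
    have h3 := (hasDerivAt_iff_tendsto_slope.1 h2).mono_left
      (nhdsWithin_mono 0 (fun s (hs : s < 0) => hs.ne) : 𝓝[Iio 0] (0 : ℝ) ≤ 𝓝[{0}ᶜ] 0)
    refine ge_of_tendsto h3 ?_
    filter_upwards [self_mem_nhdsWithin, mem_nhdsWithin_of_mem_nhds (hcont (1, 0))] with s hs hs'
    have hs0 : q + s • ((1 : ℝ), (0 : ℝ)) ∈ halfPlane := by
      simpa [halfPlane, h0] using (mem_Iio.1 hs).le
    obtain ⟨p, hp, hph, hpc, hpr⟩ := h'.exists_eq (h.mem hs'.1 hs0).1 hs'.2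
    have hph' : p.1 ≤ 0 := hph
    rw [slope_def_field, hpr, zero_smul, add_zero, hrq, h0', sub_zero, sub_zero]
    exact div_nonneg_of_nonpos hph' (mem_Iio.1 hs).le
  have hb2 : 0 < b.2 := by
    simp only [det2, hb1, mul_zero, sub_zero] at hab
    exact (pos_iff_pos_of_mul_pos hab).1 (lt_of_le_of_ne ha1 fun h => by simp [← h] at hab)
  refine ⟨b.2, hb2, ?_⟩
  rw [hb, ← map_smul]
  congr 1
  ext <;> simp [hb1]

end IsSurfaceChart

theorem curveCarrier_boundary_subset (S : Set (E × E × E)) :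
    curveCarrier (boundary S) ⊆ surfaceCarrier S := by
  rintro _ ⟨p, ⟨U, O, c, r, h, q, hq, hq0, hp, -⟩, rfl⟩
  rw [hp]
  exact (h.mem hq hq0.le).1

/-- The boundary of a compact smooth oriented surface is a link. -/
theorem isLink_boundary {M : Set E} {S : Set (E × E × E)} (hc : IsCompact (surfaceCarrier S))
    (hM : surfaceCarrier S ⊆ M)
    (hS : ∀ x ∈ surfaceCarrier S, ∃ U O c r, x ∈ O ∧ IsSurfaceChart S U O c r) :
    IsLink M (boundary S) := by
  have hsub := curveCarrier_boundary_subset S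
  refine ⟨?_, hsub.trans hM, ?_⟩
  · refine hc.of_isClosed_subset (isClosed_of_closure_subset fun x hx => ?_) hsub
    have hxS : x ∈ surfaceCarrier S := closure_minimal hsub hc.isClosed hx
    obtain ⟨U, O, c, r, hxO, h⟩ := hS x hxS
    obtain ⟨q, hq, hqh, rfl, hr⟩ := h.exists_eq hxS hxO
    rcases lt_or_eq_of_le (show q.1 ≤ 0 from hqh) with hlt | heq
    · have hn : ∀ᶠ y in 𝓝 (c q), (r y).1 < 0 :=
        ((h.differentiableAt_inv hxO).continuousAt.fst).eventually
          (gt_mem_nhds (by simpa only [hr] using hlt))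
      obtain ⟨y, ⟨hy1, hy2⟩, hy3⟩ := mem_closure_iff_nhds.1 hx _
        (inter_mem hn (h.2.1.mem_nhds hxO))
      obtain ⟨p, hp, hph, rfl, hpr⟩ := h.exists_eq (hsub hy3) hy2
      simp only [mem_ofPred_eq, hpr] at hy1
      exact absurd (h.fst_eq_zero hp hph hy3) hy1.ne
    · exact h.mem_curveCarrier_boundary hq heq
  · intro x hx
    obtain ⟨U, O, c, r, hxO, h⟩ := hS x (hsub hx)
    have hι : ContDiff ℝ ∞ fun t : ℝ => ((0 : ℝ), t) := contDiff_const.prodMk contDiff_id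
    have hder : ∀ t : ℝ, (0, t) ∈ U → deriv (fun t => c (0, t)) t = fderiv ℝ c (0, t) (0, 1) := by
      intro t ht
      have h2 : HasDerivAt (fun t : ℝ => ((0 : ℝ), t)) (0, 1) t :=
        (hasDerivAt_const _ _).prodMk (hasDerivAt_id t)
      exact ((h.differentiableAt ht).hasFDerivAt.comp_hasDerivAt t h2).deriv
    refine ⟨(fun t : ℝ => ((0 : ℝ), t)) ⁻¹' U, O, fun t => c (0, t), fun y => (r y).2,
      h.1.preimage hι.continuous, h.2.1, hxO, h.2.2.1.comp hι.contDiffOn fun t ht => ht,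
      contDiff_snd.comp_contDiffOn h.2.2.2.1, ?_, ?_, ?_⟩
    · ext y
      constructor
      · rintro ⟨t, ht, rfl⟩
        exact ⟨h.mem_curveCarrier_boundary ht rfl, (h.mem ht (le_refl (0 : ℝ))).2⟩
      · rintro ⟨hy, hyO⟩
        obtain ⟨q, hq, hqh, rfl, -⟩ := h.exists_eq (hsub hy) hyO
        have hq0 := h.fst_eq_zero hq hqh hy
        have hqe : ((0 : ℝ), q.2) = q := Prod.ext hq0.symm rfl
        exact ⟨q.2, show (0, q.2) ∈ U by rwa [hqe], by simp only [hqe]⟩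
    · intro t ht
      simp only [h.2.2.2.2.2.1 (0, t) ⟨ht, le_refl (0 : ℝ)⟩]
    · intro t ht v
      rw [hder t ht]
      constructor
      · rintro ⟨U', O', c', r', h', q', hq', hq0', hp, a, ha, hv⟩
        obtain ⟨b, hb, hbe⟩ := h'.exists_pos_smul h hq' hq0' ht rfl hp.symm
        refine ⟨a * b, mul_pos ha hb, ?_⟩
        simp only at hv
        rw [hv, hbe, mul_smul]
      · rintro ⟨a, ha, rfl⟩
        exact h.mem_boundary ht rfl ha

section Naturality

variable [FiniteDimensional ℝ E] [FiniteDimensional ℝ F]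

theorem SmoothEmb.fderiv_inv {T : E → F} {V : Set E} (hT : SmoothEmb T V)
    (hd : Module.finrank ℝ E = Module.finrank ℝ F) {x : E} (hx : x ∈ V) (v : E) :
    fderiv ℝ (invFunOn T V) (T x) (fderiv ℝ T x v) = v := by
  have h1 := fderiv_comp x ((hT.inv hd).imm _ (mem_image_of_mem T hx)).differentiableAt
    (hT.imm x hx).differentiableAt
  have h2 : invFunOn T V ∘ T =ᶠ[𝓝 x] fun y => y := by
    filter_upwards [hT.isOpen.mem_nhds hx] with y hy using hT.injOn.leftInvOn_invFunOn hy
  rw [h2.fderiv_eq, fderiv_fun_id] at h1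
  exact (congrArg (fun L : E →L[ℝ] E => L v) h1).symm

theorem pushforward_inv_pushforward {T : E → F} {V : Set E} (hT : SmoothEmb T V)
    (hd : Module.finrank ℝ E = Module.finrank ℝ F) {C : Set (E × E)} (hC : curveCarrier C ⊆ V) :
    pushforward (invFunOn T V) (pushforward T C) = C := by
  simp only [pushforward, image_image]
  convert image_id' C using 1
  refine image_congr fun p hp => ?_
  have hp' := hC (mem_image_of_mem _ hp)
  rw [hT.injOn.leftInvOn_invFunOn hp', hT.fderiv_inv hd hp']

theorem pushFrames_inv_pushFrames {T : E → F} {V : Set E} (hT : SmoothEmb T V)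
    (hd : Module.finrank ℝ E = Module.finrank ℝ F) {S : Set (E × E × E)}
    (hS : surfaceCarrier S ⊆ V) : pushFrames (invFunOn T V) (pushFrames T S) = S := by
  simp only [pushFrames, image_image]
  convert image_id' S using 1
  refine image_congr fun p hp => ?_
  have hp' := hS (mem_image_of_mem _ hp)
  rw [hT.injOn.leftInvOn_invFunOn hp', hT.fderiv_inv hd hp', hT.fderiv_inv hd hp']

theorem SmoothEmb.invFunOn_invFunOn {T : E → F} {V : Set E} (hT : SmoothEmb T V)
    (hd : Module.finrank ℝ E = Module.finrank ℝ F) :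
    EqOn (invFunOn (invFunOn T V) (T '' V)) T V := by
  intro x hx
  have h1 : invFunOn T V (T x) = x := hT.injOn.leftInvOn_invFunOn hx
  have h2 := (hT.inv hd).injOn.leftInvOn_invFunOn (mem_image_of_mem T hx)
  rwa [h1] at h2

theorem pushforward_pushforward_inv {T : E → F} {V : Set E} (hT : SmoothEmb T V)
    (hd : Module.finrank ℝ E = Module.finrank ℝ F) {C : Set (F × F)}
    (hC : curveCarrier C ⊆ T '' V) : pushforward T (pushforward (invFunOn T V) C) = C := by
  have h := pushforward_inv_pushforward (hT.inv hd) hd.symm hC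
  refine Eq.trans (pushforward_congr fun x hx => ?_) h
  have hxV : x ∈ V := by
    rw [curveCarrier_pushforward] at hx
    obtain ⟨y, hy, rfl⟩ := hx
    exact invFunOn_mem (hC hy)
  filter_upwards [hT.isOpen.mem_nhds hxV] with y hy
  exact (hT.invFunOn_invFunOn hd hy).symm

theorem IsSurfaceChart.map {T : E → F} {V : Set E} (hT : SmoothEmb T V)
    (hd : Module.finrank ℝ E = Module.finrank ℝ F) {S : Set (E × E × E)}
    (hS : surfaceCarrier S ⊆ V) {U : Set (ℝ × ℝ)} {O : Set E} {c : ℝ × ℝ → E} {r : E → ℝ × ℝ}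
    (h : IsSurfaceChart S U O c r) :
    IsSurfaceChart (pushFrames T S) (U ∩ c ⁻¹' V) (T '' (O ∩ V)) (T ∘ c)
      (r ∘ invFunOn T V) := by
  have hl : ∀ x ∈ V, invFunOn T V (T x) = x := fun x hx => hT.injOn.leftInvOn_invFunOn hx
  have hOV : IsOpen (O ∩ V) := h.2.1.inter hT.isOpen
  refine ⟨h.2.2.1.continuousOn.isOpen_inter_preimage h.1 hT.isOpen,
    hT.isOpen_image hd hOV inter_subset_right,
    hT.contDiffOn.comp (h.2.2.1.mono inter_subset_left) fun q hq => hq.2, ?_, ?_, ?_, ?_⟩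
  · refine h.2.2.2.1.comp ((hT.inv hd).contDiffOn.mono (image_mono inter_subset_right)) ?_
    rintro _ ⟨x, hx, rfl⟩
    rw [hl x hx.2]
    exact hx.1
  · rw [surfaceCarrier_pushFrames]
    ext y
    constructor
    · rintro ⟨q, ⟨⟨hq, hqV⟩, hqh⟩, rfl⟩
      have := h.mem hq hqh
      exact ⟨mem_image_of_mem T this.1, mem_image_of_mem T ⟨this.2, hqV⟩⟩
    · rintro ⟨⟨x, hx, rfl⟩, ⟨x', hx', he⟩⟩
      rw [hT.injOn hx'.2 (hS hx) he] at hx'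
      obtain ⟨q, hq, hqh, rfl, -⟩ := h.exists_eq hx hx'.1
      exact ⟨q, ⟨⟨hq, hx'.2⟩, hqh⟩, rfl⟩
  · rintro q ⟨⟨hq, hqV⟩, hqh⟩
    simp only [comp_apply, hl _ hqV]
    exact h.2.2.2.2.2.1 q ⟨hq, hqh⟩
  · rintro q ⟨⟨hq, hqV⟩, hqh⟩ v w
    have hcomp : ∀ a, fderiv ℝ (T ∘ c) q a = fderiv ℝ T (c q) (fderiv ℝ c q a) := fun a => by
      rw [fderiv_comp q (hT.imm _ hqV).differentiableAt (h.differentiableAt hq)]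
      rfl
    simp only [hcomp]
    constructor
    · rintro ⟨⟨x, v0, w0⟩, hx, he⟩
      simp only [Prod.mk.injEq, comp_apply] at he
      obtain ⟨h1, rfl, rfl⟩ := he
      have hxe : x = c q := hT.injOn (hS (mem_image_of_mem Prod.fst hx)) hqV h1
      subst hxe
      obtain ⟨a, b, hab, rfl, rfl⟩ := (h.2.2.2.2.2.2 q ⟨hq, hqh⟩ v0 w0).1 hx
      exact ⟨a, b, hab, rfl, rfl⟩
    · rintro ⟨a, b, hab, rfl, rfl⟩
      exact ⟨(c q, fderiv ℝ c q a, fderiv ℝ c q b),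
        (h.2.2.2.2.2.2 q ⟨hq, hqh⟩ _ _).2 ⟨a, b, hab, rfl, rfl⟩, rfl⟩

theorem pushforward_boundary_subset {T : E → F} {V : Set E} (hT : SmoothEmb T V)
    (hd : Module.finrank ℝ E = Module.finrank ℝ F) {S : Set (E × E × E)}
    (hS : surfaceCarrier S ⊆ V) : pushforward T (boundary S) ⊆ boundary (pushFrames T S) := by
  rintro _ ⟨⟨x, v⟩, ⟨U, O, c, r, h, q, hq, hq0, hx, a, ha, hv⟩, rfl⟩
  simp only at hx hv
  subst hx hv
  have hqV : c q ∈ V := hS (h.mem hq hq0.le).1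
  refine ⟨_, _, _, _, h.map hT hd hS, q, ⟨hq, hqV⟩, hq0, rfl, a, ha, ?_⟩
  rw [fderiv_comp q (hT.imm _ hqV).differentiableAt (h.differentiableAt hq)]
  simp

/-- Embeddings are compatible with taking the oriented boundary. -/
theorem boundary_pushFrames {T : E → F} {V : Set E} (hT : SmoothEmb T V)
    (hd : Module.finrank ℝ E = Module.finrank ℝ F) {S : Set (E × E × E)}
    (hS : surfaceCarrier S ⊆ V) : boundary (pushFrames T S) = pushforward T (boundary S) := by
  refine Subset.antisymm ?_ (pushforward_boundary_subset hT hd hS)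
  have hc : surfaceCarrier (pushFrames T S) ⊆ T '' V := by
    rw [surfaceCarrier_pushFrames]
    exact image_mono hS
  have h1 := pushforward_boundary_subset (hT.inv hd) hd.symm hc
  rw [pushFrames_inv_pushFrames hT hd hS] at h1
  rw [← pushforward_pushforward_inv hT hd ((curveCarrier_boundary_subset _).trans hc)]
  exact image_mono h1

theorem IsLink.map {T : E → F} {V : Set E} (hT : SmoothEmb T V)
    (hd : Module.finrank ℝ E = Module.finrank ℝ F) {C : Set (E × E)} {M : Set E} {M' : Set F}
    (hC : IsLink M C) (hV : curveCarrier C ⊆ V) (hM : MapsTo T (curveCarrier C) M') :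
    IsLink M' (pushforward T C) := by
  have hl : ∀ x ∈ V, invFunOn T V (T x) = x := fun x hx => hT.injOn.leftInvOn_invFunOn hx
  rw [show IsLink M' (pushforward T C) ↔ _ from ⟨id, id⟩]
  refine ⟨?_, ?_, ?_⟩
  · rw [curveCarrier_pushforward]
    exact hC.compact.image_of_continuousOn (hT.continuousOn.mono hV)
  · rw [curveCarrier_pushforward]
    exact hM.image_subset
  · rw [curveCarrier_pushforward]
    rintro _ ⟨x, hx, rfl⟩
    obtain ⟨U, O, c, r, hU, hO, hxO, hc, hr, hi, hrc, hv⟩ := hC.chart x hx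
    have hcU : ∀ t ∈ U, c t ∈ curveCarrier C ∧ c t ∈ O := fun t ht => by
      rw [← mem_inter_iff, ← hi]
      exact mem_image_of_mem c ht
    have hcV : ∀ t ∈ U, c t ∈ V := fun t ht => hV (hcU t ht).1
    refine ⟨U, T '' (O ∩ V), T ∘ c, r ∘ invFunOn T V, hU,
      hT.isOpen_image hd (hO.inter hT.isOpen) inter_subset_right,
      mem_image_of_mem T ⟨hxO, hV hx⟩, hT.contDiffOn.comp hc hcV, ?_, ?_, ?_, ?_⟩
    · refine hr.comp ((hT.inv hd).contDiffOn.mono (image_mono inter_subset_right)) ?_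
      rintro _ ⟨x, hx, rfl⟩
      rw [hl x hx.2]
      exact hx.1
    · ext y
      constructor
      · rintro ⟨t, ht, rfl⟩
        exact ⟨mem_image_of_mem T (hcU t ht).1, mem_image_of_mem T ⟨(hcU t ht).2, hcV t ht⟩⟩
      · rintro ⟨⟨x, hx, rfl⟩, ⟨x', hx', he⟩⟩
        rw [hT.injOn hx'.2 (hV hx) he] at hx'
        have : x ∈ c '' U := hi ▸ ⟨hx, hx'.1⟩
        obtain ⟨t, ht, rfl⟩ := this
        exact ⟨t, ht, rfl⟩
    · intro t ht
      simp only [comp_apply, hl _ (hcV t ht)]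
      exact hrc t ht
    · intro t ht v
      have hcd : DifferentiableAt ℝ c t :=
        (hc.contDiffAt (hU.mem_nhds ht)).differentiableAt (by simp)
      have hder : deriv (T ∘ c) t = fderiv ℝ T (c t) (deriv c t) :=
        ((hT.imm _ (hcV t ht)).differentiableAt.hasFDerivAt.comp_hasDerivAt t
          hcd.hasDerivAt).deriv
      rw [hder]
      constructor
      · rintro ⟨⟨x, v0⟩, hx, he⟩
        simp only [Prod.mk.injEq, comp_apply] at he
        obtain ⟨h1, rfl⟩ := he
        have hxe : x = c t := hT.injOn (hV (mem_image_of_mem Prod.fst hx)) (hcV t ht) h1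
        subst hxe
        obtain ⟨a, ha, rfl⟩ := (hv t ht v0).1 hx
        exact ⟨a, ha, map_smul _ _ _⟩
      · rintro ⟨a, ha, rfl⟩
        exact ⟨(c t, a • deriv c t), (hv t ht _).2 ⟨a, ha, rfl⟩, by simp⟩

end Naturality

end Boundary

/-! ### Cone charts of the three-sphere -/

/-- The image of `ℝ × (ℂ × ℝ)` in `ℝ⁴` under `(ρ, p) ↦ exp(ρ) G(p)`, where `G` parametrizes a part
of `S³`. -/
def coneChart (G : ℂ × ℝ → E4) (q : ℝ × (ℂ × ℝ)) : E4 := Real.exp q.1 • G q.2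

theorem finrank_cone : Module.finrank ℝ (ℝ × (ℂ × ℝ)) = Module.finrank ℝ E4 := by
  simp [Complex.finrank_real_complex]

/-- `G` restricts to an open embedding of `U` in `S³`. -/
structure IsConeChart (G : ℂ × ℝ → E4) (U : Set (ℂ × ℝ)) : Prop where
  isOpen : IsOpen U
  norm_eq : ∀ p ∈ U, ‖G p‖ = 1
  emb : SmoothEmb (coneChart G) (univ ×ˢ U)

theorem coneChart_zero (G : ℂ × ℝ → E4) (p : ℂ × ℝ) : coneChart G (0, p) = G p := by
  simp [coneChart]

theorem IsConeChart.contDiffAt {G : ℂ × ℝ → E4} {U : Set (ℂ × ℝ)} (h : IsConeChart G U)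
    {p : ℂ × ℝ} (hp : p ∈ U) : ContDiffAt ℝ ∞ G p := by
  have h1 := (h.emb.imm (0, p) ⟨trivial, hp⟩).smooth
  have h2 : ContDiffAt ℝ ∞ (fun p : ℂ × ℝ => ((0 : ℝ), p)) p :=
    contDiffAt_const.prodMk contDiffAt_id
  have h3 := h1.comp p h2
  exact h3.congr_of_eventuallyEq (Eventually.of_forall fun q => (coneChart_zero G q).symm)

/-- The derivative of the cone chart. -/
theorem hasFDerivAt_coneChart {G : ℂ × ℝ → E4} {q : ℝ × (ℂ × ℝ)} (h : DifferentiableAt ℝ G q.2) :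
    HasFDerivAt (coneChart G) (Real.exp q.1 • ((fderiv ℝ G q.2).comp
      (ContinuousLinearMap.snd ℝ ℝ (ℂ × ℝ)) +
      (ContinuousLinearMap.fst ℝ ℝ (ℂ × ℝ)).smulRight (G q.2))) q := by
  have h1 : HasFDerivAt (fun q : ℝ × (ℂ × ℝ) => Real.exp q.1)
      (Real.exp q.1 • ContinuousLinearMap.fst ℝ ℝ (ℂ × ℝ)) q := hasFDerivAt_fst.exp
  have h2 : HasFDerivAt (fun q : ℝ × (ℂ × ℝ) => G q.2)
      ((fderiv ℝ G q.2).comp (ContinuousLinearMap.snd ℝ ℝ (ℂ × ℝ))) q :=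
    h.hasFDerivAt.comp q hasFDerivAt_snd
  refine (h1.smul h2).congr_fderiv ?_
  ext v <;> simp

/-- The determinant of the coordinate frame of `G`, preceded by the position vector. -/
def chartDet (G : ℂ × ℝ → E4) (p : ℂ × ℝ) : ℝ :=
  frameDet (G p) (fderiv ℝ G p (1, 0)) (fderiv ℝ G p (Complex.I, 0)) (fderiv ℝ G p (0, 1))

theorem fderiv_apply_eq (L : ℂ × ℝ →L[ℝ] E4) (v : ℂ × ℝ) :
    L v = v.1.re • L (1, 0) + v.1.im • L (Complex.I, 0) + v.2 • L (0, 1) := by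
  rw [← map_smul, ← map_smul, ← map_smul, ← map_add, ← map_add]
  congr 1
  refine Prod.ext ?_ ?_
  · apply Complex.ext <;> simp
  · simp

theorem immersionAt_coneChart {G : ℂ × ℝ → E4} {q : ℝ × (ℂ × ℝ)} (hs : ContDiffAt ℝ ∞ G q.2)
    (h : chartDet G q.2 ≠ 0) : ImmersionAt (coneChart G) q := by
  refine ⟨(Real.contDiff_exp.contDiffAt.comp q contDiffAt_fst).smul (hs.comp q contDiffAt_snd), ?_⟩
  rw [(hasFDerivAt_coneChart (hs.differentiableAt (by simp))).fderiv, injective_iff_map_eq_zero]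
  rintro ⟨τ, v⟩ hv
  rw [_root_.smul_apply, smul_eq_zero, or_iff_right (Real.exp_ne_zero _)] at hv
  simp only [_root_.add_apply, ContinuousLinearMap.comp_apply, ContinuousLinearMap.coe_snd',
    ContinuousLinearMap.smulRight_apply, ContinuousLinearMap.coe_fst'] at hv
  rw [fderiv_apply_eq] at hv
  have hv' : τ • G q.2 + v.1.re • fderiv ℝ G q.2 (1, 0) + v.1.im • fderiv ℝ G q.2 (Complex.I, 0) +
      v.2 • fderiv ℝ G q.2 (0, 1) = 0 := by rw [← hv]; abel
  obtain ⟨h1, h2, h3, h4⟩ := eq_zero_of_frameDet_ne_zero h hv'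
  exact Prod.ext h1 (Prod.ext (Complex.ext h2 h3) h4)

theorem IsConeChart.of_chartDet {G : ℂ × ℝ → E4} {U : Set (ℂ × ℝ)} (hU : IsOpen U)
    (hn : ∀ p ∈ U, ‖G p‖ = 1) (hs : ∀ p ∈ U, ContDiffAt ℝ ∞ G p) (hd : ∀ p ∈ U, chartDet G p ≠ 0)
    (hi : InjOn G U) : IsConeChart G U := by
  refine ⟨hU, hn, isOpen_univ.prod hU, ?_, fun q hq => immersionAt_coneChart (hs _ hq.2) (hd _ hq.2)⟩
  rintro ⟨ρ, p⟩ ⟨-, hp⟩ ⟨σ, q⟩ ⟨-, hq⟩ h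
  have h1 := congrArg norm h
  simp only [coneChart, norm_smul, hn p hp, hn q hq, mul_one, Real.norm_eq_abs, Real.abs_exp,
    Real.exp_eq_exp] at h1
  subst h1
  simp only [coneChart] at h
  exact Prod.ext rfl (hi hp hq (smul_right_injective E4 (Real.exp_ne_zero ρ) h))

theorem ImmersionAt.exists_injOn {E F : Type*} [NormedAddCommGroup E] [NormedSpace ℝ E]
    [NormedAddCommGroup F] [NormedSpace ℝ F] [FiniteDimensional ℝ E] [FiniteDimensional ℝ F]
    {f : E → F} {x : E} (h : ImmersionAt f x) (hd : Module.finrank ℝ E = Module.finrank ℝ F) :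
    ∃ u ∈ 𝓝 x, InjOn f u := by
  have : CompleteSpace E := FiniteDimensional.complete ℝ E
  obtain ⟨L, hL⟩ := h.exists_equiv hd
  refine ⟨_, hL.eventually_left_inverse, fun y hy z hz hyz => ?_⟩
  have hy' : hL.localInverse f L x (f y) = y := hy
  have hz' : hL.localInverse f L x (f z) = z := hz
  rw [← hy', ← hz', hyz]

theorem continuousAt_chartDet {G : ℂ × ℝ → E4} {p : ℂ × ℝ} (h : ContDiffAt ℝ ∞ G p) :
    ContinuousAt (chartDet G) p := by
  have hf : ContinuousAt (fderiv ℝ G) p := (h.fderiv_right (m := 0) (by simp)).continuousAt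
  have hv : ∀ v, ContinuousAt (fun p => fderiv ℝ G p v) p := fun v =>
    hf.clm_apply continuousAt_const
  exact ContinuousAt.comp (f := fun p => (G p, fderiv ℝ G p (1, 0), fderiv ℝ G p (Complex.I, 0),
    fderiv ℝ G p (0, 1))) continuous_frameDet.continuousAt
    (h.continuousAt.prodMk ((hv _).prodMk ((hv _).prodMk (hv _))))

/-! ### Boxes around the cylinder -/

/-- The cylinder `D² × [0,1]` enlarged by `d` in all directions. -/
def box (d : ℝ) : Set (ℂ × ℝ) := {p | ‖p.1‖ ≤ 1 + d ∧ |p.2 - 1 / 2| ≤ 1 / 2 + d}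

theorem box_zero : box 0 = cylinder := by
  ext p
  simp only [box, cylinder, mem_ofPred_eq, mem_Icc, abs_le, add_zero]
  constructor
  · rintro ⟨h1, h2, h3⟩
    exact ⟨h1, by linarith, by linarith⟩
  · rintro ⟨h1, h2, h3⟩
    exact ⟨h1, by linarith, by linarith⟩

theorem box_eq_prod (d : ℝ) :
    box d = Metric.closedBall (0 : ℂ) (1 + d) ×ˢ Metric.closedBall (1 / 2 : ℝ) (1 / 2 + d) := by
  ext p
  simp [box, Real.dist_eq]

theorem isCompact_box (d : ℝ) : IsCompact (box d) := by
  rw [box_eq_prod]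
  exact (isCompact_closedBall _ _).prod (isCompact_closedBall _ _)

theorem isCompact_cylinder : IsCompact cylinder := box_zero ▸ isCompact_box 0

theorem box_mono {d d' : ℝ} (h : d ≤ d') : box d ⊆ box d' := fun _ hp =>
  ⟨hp.1.trans (by linarith), hp.2.trans (by linarith)⟩

theorem convex_cylinder : Convex ℝ cylinder := by
  rw [← box_zero, box_eq_prod]
  exact (convex_closedBall _ _).prod (convex_closedBall _ _)

theorem nonempty_interior_cylinder : (interior cylinder).Nonempty := by
  rw [← box_zero, box_eq_prod, interior_prod_eq]
  refine ⟨(0, 1 / 2), ?_, ?_⟩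
  · exact Metric.ball_subset_interior_closedBall (by simp)
  · exact Metric.ball_subset_interior_closedBall (by simp)

theorem exists_box_subset {U : Set (ℂ × ℝ)} (hU : IsOpen U) (h : cylinder ⊆ U) {d₀ : ℝ}
    (hd₀ : 0 < d₀) : ∃ d, 0 < d ∧ d ≤ d₀ ∧ box (2 * d) ⊆ U := by
  obtain ⟨δ, hδ, hδU⟩ := isCompact_cylinder.exists_cthickening_subset_open hU h
  refine ⟨min d₀ (δ / 2), by positivity, min_le_left _ _, fun p hp => hδU ?_⟩
  set d := min d₀ (δ / 2)
  have hd : 0 < d := by positivity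
  have hdδ : 2 * d ≤ δ := by linarith [min_le_right d₀ (δ / 2)]
  obtain ⟨h1, h2⟩ := hp
  -- rescaling moves the point into the cylinder
  refine Metric.mem_cthickening_of_dist_le p ((1 + 2 * d)⁻¹ • p.1,
    1 / 2 + (1 + 4 * d)⁻¹ * (p.2 - 1 / 2)) δ _ ?_ ?_
  · rw [← box_zero]
    constructor
    · simp only [norm_smul, norm_inv, Real.norm_eq_abs, abs_of_pos (show 0 < 1 + 2 * d by positivity)]
      rw [inv_mul_le_iff₀ (by positivity)]
      linarith
    · simp only [add_sub_cancel_left, abs_mul, abs_inv, abs_of_pos (show 0 < 1 + 4 * d by positivity)]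
      rw [inv_mul_le_iff₀ (by positivity)]
      linarith
  · rw [Prod.dist_eq, max_le_iff]
    constructor
    · have : p.1 - (1 + 2 * d)⁻¹ • p.1 = (2 * d / (1 + 2 * d)) • p.1 := by
        have h3 : 2 * d / (1 + 2 * d) = 1 - (1 + 2 * d)⁻¹ := by field_simp; ring
        rw [h3, sub_smul, one_smul]
      rw [dist_eq_norm, this, norm_smul, Real.norm_eq_abs, abs_of_pos (by positivity)]
      calc 2 * d / (1 + 2 * d) * ‖p.1‖ ≤ 2 * d / (1 + 2 * d) * (1 + 2 * d) := by gcongr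
        _ = 2 * d := by field_simp
        _ ≤ δ := hdδ
    · have : p.2 - (1 / 2 + (1 + 4 * d)⁻¹ * (p.2 - 1 / 2)) = 4 * d / (1 + 4 * d) * (p.2 - 1 / 2) := by
        field_simp
        ring
      rw [Real.dist_eq, this, abs_mul, abs_of_pos (by positivity)]
      calc 4 * d / (1 + 4 * d) * |p.2 - 1 / 2| ≤ 4 * d / (1 + 4 * d) * (1 / 2 + 2 * d) := by gcongr
        _ = 2 * d := by field_simp; ring
        _ ≤ δ := hdδ

/-- A smooth antitone function, equal to `1` up to `a` and to `0` from `b` on. -/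
def stepDown (a b x : ℝ) : ℝ := Real.smoothTransition ((b - x) / (b - a))

theorem stepDown_eq_one {a b x : ℝ} (hab : a < b) (h : x ≤ a) : stepDown a b x = 1 :=
  Real.smoothTransition.one_of_one_le ((one_le_div (sub_pos.2 hab)).2 (by linarith))

theorem stepDown_eq_zero {a b x : ℝ} (hab : a < b) (h : b ≤ x) : stepDown a b x = 0 :=
  Real.smoothTransition.zero_of_nonpos (div_nonpos_of_nonpos_of_nonneg (by linarith) (by linarith))

theorem stepDown_nonneg (a b x : ℝ) : 0 ≤ stepDown a b x := Real.smoothTransition.nonneg _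

theorem stepDown_le_one (a b x : ℝ) : stepDown a b x ≤ 1 := Real.smoothTransition.le_one _

theorem antitone_stepDown {a b : ℝ} (hab : a < b) : Antitone (stepDown a b) := fun x y h =>
  Real.smoothTransition.monotone (div_le_div_of_nonneg_right (by linarith) (by linarith))

theorem contDiff_stepDown (a b : ℝ) : ContDiff ℝ ∞ (stepDown a b) :=
  Real.smoothTransition.contDiff.comp ((contDiff_const.sub contDiff_id).div_const _)

/-- A smooth cutoff function, equal to `1` on `box d` and to `0` outside of `box (2 * d)`. -/
def boxCut (d : ℝ) (p : ℂ × ℝ) : ℝ :=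
  stepDown ((1 + d) ^ 2) ((1 + 2 * d) ^ 2) (‖p.1‖ ^ 2) *
    stepDown ((1 / 2 + d) ^ 2) ((1 / 2 + 2 * d) ^ 2) ((p.2 - 1 / 2) ^ 2)

theorem boxCut_eq_one {d : ℝ} (hd : 0 < d) {p : ℂ × ℝ} (hp : p ∈ box d) : boxCut d p = 1 := by
  rw [boxCut, stepDown_eq_one (by gcongr; linarith) (by gcongr; exact hp.1),
    stepDown_eq_one (by gcongr; linarith) (sq_le_sq' (abs_le.1 hp.2).1 (abs_le.1 hp.2).2), one_mul]

theorem boxCut_eq_zero {d : ℝ} (hd : 0 < d) {p : ℂ × ℝ} (hp : p ∉ box (2 * d)) :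
    boxCut d p = 0 := by
  rw [box, mem_ofPred_eq, not_and_or, not_le, not_le] at hp
  rw [boxCut]
  rcases hp with h | h
  · rw [stepDown_eq_zero (by gcongr; linarith) (by gcongr), zero_mul]
  · rw [stepDown_eq_zero (x := (p.2 - 1 / 2) ^ 2) (by gcongr; linarith)
      (by rw [← sq_abs (p.2 - 1 / 2)]; gcongr), mul_zero]

theorem boxCut_nonneg (d : ℝ) (p : ℂ × ℝ) : 0 ≤ boxCut d p :=
  mul_nonneg (stepDown_nonneg _ _ _) (stepDown_nonneg _ _ _)

theorem boxCut_le_one (d : ℝ) (p : ℂ × ℝ) : boxCut d p ≤ 1 :=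
  mul_le_one₀ (stepDown_le_one _ _ _) (stepDown_nonneg _ _ _) (stepDown_le_one _ _ _)

theorem contDiff_boxCut (d : ℝ) : ContDiff ℝ ∞ (boxCut d) := by
  refine ((contDiff_stepDown _ _).comp ?_).mul ((contDiff_stepDown _ _).comp ?_)
  · exact contDiff_fst.norm_sq ℝ
  · exact (contDiff_snd.sub contDiff_const).pow 2

/-! ### Extending maps of a cone chart by the identity -/

/-- The map of `S³` (extended to `ℝ⁴` by homogeneity) that is `κ` in the coordinates `G` and the
identity elsewhere. -/
def coneTransfer (G : ℂ × ℝ → E4) (U : Set (ℂ × ℝ)) (κ : ℂ × ℝ → ℂ × ℝ) : E4 → E4 :=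
  transfer (coneChart G) (univ ×ˢ U) fun q => (q.1, κ q.2)

section ConeTransfer

variable {G : ℂ × ℝ → E4} {U W K : Set (ℂ × ℝ)} {κ : ℂ × ℝ → ℂ × ℝ}

theorem coneTransfer_smul_apply (hG : IsConeChart G U) (κ : ℂ × ℝ → ℂ × ℝ) {r : ℝ} (hr : 0 < r)
    {p : ℂ × ℝ} (hp : p ∈ U) : coneTransfer G U κ (r • G p) = r • G (κ p) := by
  have := transfer_apply hG.emb.injOn (fun q => (q.1, κ q.2)) (p := (Real.log r, p)) ⟨trivial, hp⟩
  simpa [coneTransfer, coneChart, Real.exp_log hr] using this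

theorem coneTransfer_apply (hG : IsConeChart G U) (κ : ℂ × ℝ → ℂ × ℝ) {p : ℂ × ℝ} (hp : p ∈ U) :
    coneTransfer G U κ (G p) = G (κ p) := by
  simpa using coneTransfer_smul_apply hG κ one_pos hp

theorem exists_of_mem_image_coneChart {s : Set (ℂ × ℝ)} {x : E4}
    (hx : x ∈ coneChart G '' (univ ×ˢ s)) : ∃ r : ℝ, 0 < r ∧ ∃ p ∈ s, x = r • G p := by
  obtain ⟨⟨ρ, p⟩, ⟨-, hp⟩, rfl⟩ := hx
  exact ⟨Real.exp ρ, Real.exp_pos ρ, p, hp, rfl⟩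

theorem smul_mem_image_coneChart {s : Set (ℂ × ℝ)} {r : ℝ} (hr : 0 < r) {p : ℂ × ℝ} (hp : p ∈ s) :
    r • G p ∈ coneChart G '' (univ ×ˢ s) :=
  ⟨(Real.log r, p), ⟨trivial, hp⟩, by simp [coneChart, Real.exp_log hr]⟩

theorem mem_image_coneChart {s : Set (ℂ × ℝ)} {p : ℂ × ℝ} (hp : p ∈ s) :
    G p ∈ coneChart G '' (univ ×ˢ s) := by
  simpa using smul_mem_image_coneChart (G := G) one_pos hp

theorem isClosed_cone (hG : IsConeChart G U) (hK : IsCompact K) (hKU : K ⊆ U) :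
    IsClosed (insert 0 (coneChart G '' (univ ×ˢ K))) := by
  have hc : IsCompact (G '' K) := hK.image_of_continuousOn fun p hp =>
    (hG.contDiffAt (hKU hp)).continuousAt.continuousWithinAt
  refine isClosed_insert_zero_cone hc ?_ ?_ ?_
  · rintro ⟨p, hp, h⟩
    have := hG.norm_eq p (hKU hp)
    simp [h] at this
  · intro x hx
    obtain ⟨r, hr, p, hp, rfl⟩ := exists_of_mem_image_coneChart hx
    exact ⟨r, hr, G p, mem_image_of_mem G hp, rfl⟩
  · rintro r hr _ ⟨p, hp, rfl⟩
    exact smul_mem_image_coneChart hr hp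

theorem coneTransfer_eq_self (hG : IsConeChart G U) (hid : ∀ p ∈ U, p ∉ K → κ p = p)
    {x : E4} (hx : x ∉ coneChart G '' (univ ×ˢ K)) : coneTransfer G U κ x = x :=
  transfer_eq_self hG.emb.injOn (Kc := univ ×ˢ K)
    (κ := fun q => (q.1, κ q.2))
    (fun q hq h => Prod.ext rfl (hid q.2 hq.2 fun h' => h ⟨trivial, h'⟩)) hx

theorem posHom_coneTransfer (hG : IsConeChart G U) : PosHom (coneTransfer G U κ) := by
  intro r hr x
  refine transfer_smul hG.emb.injOn ?_ hr x
  rintro ⟨ρ, p⟩ hp r hr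
  refine ⟨(Real.log r + ρ, p), hp, ?_, ?_⟩ <;>
  simp [coneChart, Real.exp_add, Real.exp_log hr, smul_smul]

theorem norm_coneTransfer (hG : IsConeChart G U) (hκ : MapsTo κ U U) (x : E4) :
    ‖coneTransfer G U κ x‖ = ‖x‖ := by
  by_cases hx : x ∈ coneChart G '' (univ ×ˢ U)
  · obtain ⟨r, hr, p, hp, rfl⟩ := exists_of_mem_image_coneChart hx
    rw [coneTransfer_smul_apply hG κ hr hp, norm_smul, norm_smul, hG.norm_eq _ hp,
      hG.norm_eq _ (hκ hp)]
  · rw [coneTransfer_eq_self hG (fun p hp h => absurd hp h) hx]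

theorem smoothEmb_coneTransfer (hG : IsConeChart G U) (hWU : W ⊆ U) (hK : IsCompact K)
    (hKU : K ⊆ U) (hKW : IsCompact (K \ W))
    (hκ : SmoothEmb (fun q : ℝ × (ℂ × ℝ) => (q.1, κ q.2)) (univ ×ˢ W))
    (hκU : MapsTo κ U U) (hid : ∀ p ∈ U, p ∉ K → p ∈ W ∧ κ p = p) (hκK : MapsTo κ (W ∩ K) K) :
    SmoothEmb (coneTransfer G U κ) (insert 0 (coneChart G '' (univ ×ˢ (K \ W))))ᶜ := by
  have h1 : (univ ×ˢ K : Set (ℝ × (ℂ × ℝ))) \ (univ ×ˢ W) = univ ×ˢ (K \ W) := by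
    ext q; simp
  have h := smoothEmb_transfer finrank_cone hG.emb (W := univ ×ˢ W) (Kc := univ ×ˢ K)
    (prod_mono_right hKU) hκ (fun q hq => ⟨trivial, hκU (hWU hq.2)⟩)
    (fun q hq hqK => ⟨⟨trivial, (hid q.2 hq.2 fun h' => hqK ⟨trivial, h'⟩).1⟩,
      Prod.ext rfl (hid q.2 hq.2 fun h' => hqK ⟨trivial, h'⟩).2⟩)
    (fun q hq => ⟨trivial, hκK ⟨hq.1.2, hq.2.2⟩⟩) (isClosed_cone hG hK hKU)
    (by rw [h1]; exact isClosed_cone hG hKW (sdiff_subset.trans hKU))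
  rwa [h1] at h

theorem isConeDiffeo_coneTransfer (hG : IsConeChart G U) (hK : IsCompact K) (hKU : K ⊆ U)
    (hκ : SmoothEmb (fun q : ℝ × (ℂ × ℝ) => (q.1, κ q.2)) (univ ×ˢ U))
    (hid : ∀ p ∈ U, p ∉ K → κ p = p) (hκK : MapsTo κ K K) :
    IsConeDiffeo (coneTransfer G U κ) := by
  have hκU : MapsTo κ U U := fun p hp => by
    by_cases hpK : p ∈ K
    · exact hKU (hκK hpK)
    · rwa [hid p hp hpK]
  have h := smoothEmb_coneTransfer hG Subset.rfl hK hKU (by simp [sdiff_eq_empty.2 hKU]) hκ hκU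
    (fun p hp hpK => ⟨hp, hid p hp hpK⟩) (hκK.mono_left inter_subset_right)
  rw [sdiff_eq_empty.2 hKU, prod_empty, image_empty] at h
  exact ⟨by simpa using h, posHom_coneTransfer hG, norm_coneTransfer hG hκU⟩

theorem smoothEmb_prodMk (hκ : SmoothEmb κ W) :
    SmoothEmb (fun q : ℝ × (ℂ × ℝ) => (q.1, κ q.2)) (univ ×ˢ W) := by
  refine ⟨isOpen_univ.prod hκ.isOpen, ?_, ?_⟩
  · rintro ⟨ρ, p⟩ ⟨-, hp⟩ ⟨σ, q⟩ ⟨-, hq⟩ h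
    simp only [Prod.mk.injEq] at h
    exact Prod.ext h.1 (hκ.injOn hp hq h.2)
  · rintro ⟨ρ, p⟩ ⟨-, hp⟩
    refine ⟨contDiffAt_fst.prodMk ((hκ.imm p hp).smooth.comp (ρ, p) contDiffAt_snd), ?_⟩
    have h1 : HasFDerivAt (fun q : ℝ × (ℂ × ℝ) => (q.1, κ q.2))
        ((ContinuousLinearMap.fst ℝ ℝ (ℂ × ℝ)).prod
          ((fderiv ℝ κ p).comp (ContinuousLinearMap.snd ℝ ℝ (ℂ × ℝ)))) (ρ, p) :=
      hasFDerivAt_fst.prodMk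
        (HasFDerivAt.comp (ρ, p) (hκ.imm p hp).differentiableAt.hasFDerivAt hasFDerivAt_snd)
    rw [h1.fderiv]
    rintro ⟨a, v⟩ ⟨b, w⟩ h
    simp only [ContinuousLinearMap.prod_apply, ContinuousLinearMap.coe_fst',
      ContinuousLinearMap.comp_apply, ContinuousLinearMap.coe_snd', Prod.mk.injEq] at h
    rw [h.1, (hκ.imm p hp).inj h.2]

end ConeTransfer

/-! ### The standard chart -/

/-- The identification `ℂ² = ℝ⁴` as a linear equivalence. -/
def toE4L : (ℂ × ℂ) ≃L[ℝ] E4 :=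
  LinearEquiv.toContinuousLinearEquiv
    { toFun := toE4
      map_add' := fun p q => by ext i; fin_cases i <;> simp [toE4]
      map_smul' := fun r p => by ext i; fin_cases i <;> simp [toE4]
      invFun := fun x => (⟨x 0, x 1⟩, ⟨x 2, x 3⟩)
      left_inv := fun p => by simp [toE4]
      right_inv := fun x => by ext i; fin_cases i <;> simp [toE4] }

theorem toE4L_apply (p : ℂ × ℂ) : toE4L p = toE4 p := rfl

theorem norm_toE4_sq (p : ℂ × ℂ) : ‖toE4 p‖ ^ 2 = ‖p.1‖ ^ 2 + ‖p.2‖ ^ 2 := by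
  rw [EuclideanSpace.norm_sq_eq, Fin.sum_univ_four, Complex.sq_norm, Complex.sq_norm,
    Complex.normSq_apply, Complex.normSq_apply]
  simp [toE4]
  ring

theorem contDiff_toE4 : ContDiff ℝ ∞ toE4 := toE4L.contDiff

theorem toE4_injective : Injective toE4 := toE4L.injective

theorem toE4_smul (r : ℝ) (p : ℂ × ℂ) : toE4 (r • p) = r • toE4 p := toE4L.map_smul r p

theorem exists_toE4 (x : E4) : ∃ p, toE4 p = x := toE4L.surjective x

theorem sqrt_one_add_pos (z : ℂ) : 0 < √(1 + ‖z‖ ^ 2) := Real.sqrt_pos.2 (by positivity)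

theorem contDiff_invSqrt : ContDiff ℝ ∞ fun z : ℂ => (√(1 + ‖z‖ ^ 2))⁻¹ := by
  refine contDiff_iff_contDiffAt.2 fun z => ?_
  refine ContDiffAt.inv (ContDiffAt.sqrt ?_ (by positivity)) (sqrt_one_add_pos z).ne'
  exact (contDiff_const.add (contDiff_id.norm_sq ℝ)).contDiffAt

theorem contDiff_stdTorus : ContDiff ℝ ∞ stdTorus :=
  (contDiff_invSqrt.comp contDiff_fst).smul contDiff_toE4

theorem norm_stdTorus_sq (p : ℂ × ℂ) :
    ‖stdTorus p‖ ^ 2 = (‖p.1‖ ^ 2 + ‖p.2‖ ^ 2) / (1 + ‖p.1‖ ^ 2) := by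
  rw [stdTorus, norm_smul, mul_pow, norm_toE4_sq, norm_inv, Real.norm_eq_abs,
    abs_of_pos (sqrt_one_add_pos _), inv_pow, Real.sq_sqrt (by positivity)]
  field_simp

theorem norm_stdTorus {p : ℂ × ℂ} (hp : ‖p.2‖ = 1) : ‖stdTorus p‖ = 1 := by
  have h := norm_stdTorus_sq p
  rw [hp, one_pow, add_comm, div_self (by positivity)] at h
  exact (pow_eq_one_iff_of_nonneg (norm_nonneg _) two_ne_zero).1 h

theorem norm_exp_pi (t : ℝ) : ‖Complex.exp ((Real.pi * t : ℝ) * Complex.I)‖ = 1 :=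
  Complex.norm_exp_ofReal_mul_I _

theorem norm_closeUp (p : ℂ × ℝ) : ‖closeUp p‖ = 1 := norm_stdTorus (norm_exp_pi p.2)

theorem contDiff_closeUp : ContDiff ℝ ∞ closeUp := by
  refine contDiff_stdTorus.comp (contDiff_fst.prodMk ?_)
  refine ContDiff.cexp (ContDiff.mul ?_ contDiff_const)
  exact Complex.ofRealCLM.contDiff.comp (contDiff_const.mul contDiff_snd)

/-- The domain of the standard cone chart `closeUp`. -/
def slab : Set (ℂ × ℝ) := {p | p.2 ∈ Ioo (-1 / 2 : ℝ) (3 / 2)}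

theorem isOpen_slab : IsOpen slab := isOpen_Ioo.preimage continuous_snd

theorem closeUp_eq_iff {p q : ℂ × ℝ} : closeUp p = closeUp q ↔
    p.1 = q.1 ∧ ∃ n : ℤ, p.2 = q.2 + 2 * n := by
  have hpi : (Real.pi : ℂ) ≠ 0 := by exact_mod_cast Real.pi_ne_zero
  have hexp : Complex.exp ((Real.pi * p.2 : ℝ) * Complex.I) =
      Complex.exp ((Real.pi * q.2 : ℝ) * Complex.I) ↔ ∃ n : ℤ, p.2 = q.2 + 2 * n := by
    rw [Complex.exp_eq_exp_iff_exists_int]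
    refine exists_congr fun n => ?_
    rw [show ((Real.pi * q.2 : ℝ) : ℂ) * Complex.I + n * (2 * Real.pi * Complex.I) =
      ((Real.pi * (q.2 + 2 * n) : ℝ) : ℂ) * Complex.I by push_cast; ring]
    rw [mul_left_inj' Complex.I_ne_zero, Complex.ofReal_inj,
      mul_right_inj' Real.pi_ne_zero]
  constructor
  · intro h
    -- the norms of the two components determine the scaling factor
    have hp := sqrt_one_add_pos p.1
    have hq := sqrt_one_add_pos q.1
    simp only [closeUp, stdTorus] at h
    rw [← toE4_smul, ← toE4_smul] at h
    have h2 := toE4_injective h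
    simp only [Prod.smul_mk, Prod.mk.injEq] at h2
    obtain ⟨h3, h4⟩ := h2
    have h5 := congrArg norm h4
    rw [norm_smul, norm_smul, norm_exp_pi, norm_exp_pi, mul_one, mul_one, norm_inv, norm_inv,
      Real.norm_eq_abs, Real.norm_eq_abs, abs_of_pos hp, abs_of_pos hq] at h5
    rw [h5] at h3 h4
    have hne : (√(1 + ‖q.1‖ ^ 2))⁻¹ ≠ 0 := inv_ne_zero hq.ne'
    exact ⟨smul_right_injective ℂ hne h3, hexp.1 (smul_right_injective ℂ hne h4)⟩
  · rintro ⟨h1, h2⟩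
    simp only [closeUp, h1, hexp.2 h2]

theorem injOn_closeUp : InjOn closeUp slab := by
  intro p hp q hq h
  obtain ⟨h1, n, hn⟩ := closeUp_eq_iff.1 h
  have hp' : p.2 ∈ Ioo (-1 / 2 : ℝ) (3 / 2) := hp
  have hq' : q.2 ∈ Ioo (-1 / 2 : ℝ) (3 / 2) := hq
  have h3 : (n : ℝ) < 1 := by linarith [hp'.2, hq'.1]
  have h4 : (-1 : ℝ) < n := by linarith [hp'.1, hq'.2]
  have h5 : n = 0 := by
    have : n < 1 := by exact_mod_cast h3
    have : -1 < n := by exact_mod_cast h4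
    omega
  exact Prod.ext h1 (by simpa [h5] using hn)

theorem frameDet_smul_add (x u v w : E4) (l a b c : ℝ) :
    frameDet (l • x) (l • u + a • x) (l • v + b • x) (l • w + c • x) = l ^ 4 * frameDet x u v w := by
  simp [frameDet, Matrix.det_succ_row_zero, Fin.sum_univ_succ, Fin.succAbove]
  ring

theorem frameDet_toE4 (z w : ℂ) (a : ℝ) :
    frameDet (toE4 (z, w)) (toE4 (1, 0)) (toE4 (Complex.I, 0)) (toE4 (0, a • (Complex.I * w))) =
      a * ‖w‖ ^ 2 := by
  rw [Complex.sq_norm, Complex.normSq_apply]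
  simp [frameDet, Matrix.det_succ_row_zero, Fin.sum_univ_succ, Fin.succAbove, toE4]
  ring

theorem fderiv_stdTorus (p v : ℂ × ℂ) : ∃ a : ℝ,
    fderiv ℝ stdTorus p v = (√(1 + ‖p.1‖ ^ 2))⁻¹ • toE4 v + a • toE4 p := by
  have h1 : HasFDerivAt (fun p : ℂ × ℂ => (√(1 + ‖p.1‖ ^ 2))⁻¹)
      (fderiv ℝ (fun p : ℂ × ℂ => (√(1 + ‖p.1‖ ^ 2))⁻¹) p) p :=
    ((contDiff_invSqrt.comp contDiff_fst).differentiable (by simp) p).hasFDerivAt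
  have h2 : HasFDerivAt toE4 (toE4L : ℂ × ℂ →L[ℝ] E4) p := toE4L.hasFDerivAt
  have h3 := h1.smul h2
  refine ⟨fderiv ℝ (fun p : ℂ × ℂ => (√(1 + ‖p.1‖ ^ 2))⁻¹) p v, ?_⟩
  rw [show stdTorus = (fun p : ℂ × ℂ => (√(1 + ‖p.1‖ ^ 2))⁻¹) • toE4 from rfl, h3.fderiv]
  simp [toE4L_apply]

theorem frameDet_stdTorus_pos {p : ℂ × ℂ} (hp : p.2 ≠ 0) :
    0 < frameDet (stdTorus p) (fderiv ℝ stdTorus p (1, 0)) (fderiv ℝ stdTorus p (Complex.I, 0))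
      (fderiv ℝ stdTorus p (0, Complex.I * p.2)) := by
  obtain ⟨a, ha⟩ := fderiv_stdTorus p (1, 0)
  obtain ⟨b, hb⟩ := fderiv_stdTorus p (Complex.I, 0)
  obtain ⟨c, hc⟩ := fderiv_stdTorus p (0, Complex.I * p.2)
  rw [ha, hb, hc, stdTorus, frameDet_smul_add]
  have := frameDet_toE4 p.1 p.2 1
  rw [one_smul, one_mul] at this
  rw [this]
  have := sqrt_one_add_pos p.1
  have := norm_pos_iff.2 hp
  positivity

theorem hasFDerivAt_prod_exp (p : ℂ × ℝ) :
    HasFDerivAt (fun p : ℂ × ℝ => (p.1, Complex.exp ((Real.pi * p.2 : ℝ) * Complex.I)))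
      ((ContinuousLinearMap.fst ℝ ℂ ℝ).prod ((ContinuousLinearMap.snd ℝ ℂ ℝ).smulRight
        (Real.pi • (Complex.I * Complex.exp ((Real.pi * p.2 : ℝ) * Complex.I))))) p := by
  refine hasFDerivAt_fst.prodMk ?_
  have h1 : HasDerivAt (fun t : ℝ => Complex.exp ((Real.pi * t : ℝ) * Complex.I))
      (Real.pi • (Complex.I * Complex.exp ((Real.pi * p.2 : ℝ) * Complex.I))) p.2 := by
    have h2 : HasDerivAt (fun t : ℝ => ((Real.pi * t : ℝ) : ℂ)) (Real.pi : ℂ) p.2 := by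
      have := (((hasDerivAt_id p.2).const_mul Real.pi)).ofReal_comp
      simpa using this
    have h3 := (h2.mul_const Complex.I).cexp
    refine h3.congr_deriv ?_
    rw [Complex.real_smul]
    ring
  have h4 := h1.hasFDerivAt.comp p (hasFDerivAt_snd (𝕜 := ℝ) (E := ℂ) (F := ℝ))
  refine h4.congr_fderiv ?_
  ext v <;> simp

theorem chartDet_closeUp_pos (p : ℂ × ℝ) : 0 < chartDet closeUp p := by
  set w := Complex.exp ((Real.pi * p.2 : ℝ) * Complex.I) with hw
  have hd : ∀ v : ℂ × ℝ, fderiv ℝ closeUp p v =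
      fderiv ℝ stdTorus (p.1, w) (v.1, v.2 • (Real.pi • (Complex.I * w))) := by
    intro v
    have h1 := ((contDiff_stdTorus.differentiable (by simp)
      (p.1, w)).hasFDerivAt.comp p (hasFDerivAt_prod_exp p)).fderiv
    rw [show closeUp = stdTorus ∘ fun p : ℂ × ℝ =>
      (p.1, Complex.exp ((Real.pi * p.2 : ℝ) * Complex.I)) from rfl, h1]
    simp [hw]
  have hw1 : ‖w‖ = 1 := norm_exp_pi p.2
  obtain ⟨a, ha⟩ := fderiv_stdTorus (p.1, w) (1, 0)
  obtain ⟨b, hb⟩ := fderiv_stdTorus (p.1, w) (Complex.I, 0)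
  obtain ⟨c, hc⟩ := fderiv_stdTorus (p.1, w) (0, Real.pi • (Complex.I * w))
  rw [chartDet, hd, hd, hd, show closeUp p = stdTorus (p.1, w) from rfl]
  simp only [zero_smul, one_smul]
  rw [ha, hb, hc, stdTorus, frameDet_smul_add, frameDet_toE4, hw1]
  have := sqrt_one_add_pos p.1
  have := Real.pi_pos
  positivity

theorem isConeChart_closeUp : IsConeChart closeUp slab :=
  .of_chartDet isOpen_slab (fun p _ => norm_closeUp p) (fun _ _ => contDiff_closeUp.contDiffAt)
    (fun p _ => (chartDet_closeUp_pos p).ne') injOn_closeUp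

theorem box_subset_slab {d : ℝ} (hd : d < 1 / 2) : box d ⊆ slab := by
  intro p hp
  have := abs_le.1 hp.2
  constructor <;> linarith [this.1, this.2]

theorem cylinder_subset_slab : cylinder ⊆ slab := box_zero ▸ box_subset_slab (by norm_num)

/-! ### Charts given by closed bands -/

/-- The part of the definition of a closed band that concerns the parametrization of the
cylinder only. -/
structure IsCylinder (G : ℂ × ℝ → E4) : Prop where
  smooth : SmoothNear G cylinder
  mapsTo : MapsTo G cylinder S3
  injOn : InjOn G cylinder
  det_pos : ∀ p ∈ cylinder, 0 < chartDet G p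

theorem IsClosedBand.isCylinder {S : Set (E4 × E4 × E4)} {G : ℂ × ℝ → E4}
    (h : IsClosedBand S G) : IsCylinder G := ⟨h.smooth, h.mapsTo, h.injOn, h.orientation⟩

/-- A parametrized cylinder in `S³` extends to a cone chart. -/
theorem IsCylinder.exists_coneChart {G : ℂ × ℝ → E4} (h : IsCylinder G) :
    ∃ (G' : ℂ × ℝ → E4) (U : Set (ℂ × ℝ)), IsConeChart G' U ∧ cylinder ⊆ U ∧
      EqOn G' G cylinder ∧ ∀ p ∈ cylinder, fderiv ℝ G' p = fderiv ℝ G p := by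
  obtain ⟨U0, hU0, hcU0, hs⟩ := h.smooth
  let G' : ℂ × ℝ → E4 := fun p => ‖G p‖⁻¹ • G p
  have hn : ∀ p ∈ cylinder, ‖G p‖ = 1 := fun p hp => mem_sphere_zero_iff_norm.1 (h.mapsTo hp)
  have heq : EqOn G' G cylinder := fun p hp => by simp [G', hn p hp]
  set U1 := U0 ∩ G ⁻¹' {0}ᶜ with hU1def
  have hU1 : IsOpen U1 := hs.continuousOn.isOpen_inter_preimage hU0 isOpen_compl_singleton
  have hcU1 : cylinder ⊆ U1 := fun p hp => ⟨hcU0 hp, ne_zero_of_mem_S3 (h.mapsTo hp)⟩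
  have hGs : ∀ p ∈ U1, ContDiffAt ℝ ∞ G p := fun p hp => hs.contDiffAt (hU0.mem_nhds hp.1)
  have hG's : ∀ p ∈ U1, ContDiffAt ℝ ∞ G' p := fun p hp =>
    (((hGs p hp).norm ℝ hp.2).inv (norm_ne_zero_iff.2 hp.2)).smul (hGs p hp)
  have hder : ∀ p ∈ cylinder, fderiv ℝ G' p = fderiv ℝ G p := fun p hp =>
    fderiv_eq_of_eqOn_convex convex_cylinder nonempty_interior_cylinder hp
      ((hG's p (hcU1 hp)).differentiableAt (by simp))
      ((hGs p (hcU1 hp)).differentiableAt (by simp)) heq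
  set U2 := U1 ∩ chartDet G' ⁻¹' {0}ᶜ
  have hU2 : IsOpen U2 := by
    refine ContinuousOn.isOpen_inter_preimage (fun p hp => ?_) hU1 isOpen_compl_singleton
    exact (continuousAt_chartDet (hG's p hp)).continuousWithinAt
  have hcU2 : cylinder ⊆ U2 := fun p hp => by
    refine ⟨hcU1 hp, ?_⟩
    have : chartDet G' p = chartDet G p := by simp only [chartDet, hder p hp, heq hp]
    rw [mem_preimage, this]
    exact (h.det_pos p hp).ne'
  have hinj : InjOn G' cylinder := fun p hp q hq hpq =>
    h.injOn hp hq (by rwa [heq hp, heq hq] at hpq)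
  obtain ⟨V, hV, hVi⟩ := hinj.exists_mem_nhdsSet isCompact_cylinder
    (fun p hp => (hG's p (hcU1 hp)).continuousAt) (fun p hp => by
      have himm := immersionAt_coneChart (q := (0, p)) (hG's p (hcU1 hp)) (hcU2 hp).2
      obtain ⟨u, hu, hui⟩ := himm.exists_injOn finrank_cone
      refine ⟨(fun p => ((0 : ℝ), p)) ⁻¹' u,
        (by fun_prop : Continuous fun p : ℂ × ℝ => ((0 : ℝ), p)).continuousAt.preimage_mem_nhds hu,
        fun a ha b hb hab => ?_⟩
      have := hui ha hb (by simpa [coneChart] using hab)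
      exact (Prod.mk.inj this).2)
  obtain ⟨V', hV'o, hcV', hV'V⟩ := mem_nhdsSet_iff_exists.1 hV
  refine ⟨G', V' ∩ U2, .of_chartDet (hV'o.inter hU2) ?_ (fun p hp => hG's p hp.2.1)
    (fun p hp => hp.2.2) (hVi.mono fun p hp => hV'V hp.1), fun p hp => ⟨hcV' hp, hcU2 hp⟩, heq, hder⟩
  intro p hp
  have : G p ≠ 0 := hp.2.1.2
  simp [G', norm_smul, this]

/-! ### Small perturbations of the identity -/

section Perturbation

variable {V : Type*} [NormedAddCommGroup V] [NormedSpace ℝ V]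

/-- An embedding of an open set that is the identity off a set `K` maps `K` to itself. -/
theorem mapsTo_of_injOn_of_eq_off {X : Type*} {κ : X → X} {U K : Set X} (hi : InjOn κ U)
    (hKU : K ⊆ U) (hκU : MapsTo κ K U) (hid : ∀ p ∈ U, p ∉ K → κ p = p) : MapsTo κ K K := by
  intro p hp
  by_contra hn
  have h1 := hid (κ p) (hκU hp) hn
  rw [hi (hκU hp) (hKU hp) h1] at hn
  exact hn hp

/-- A perturbation of the identity whose derivative has norm at most `1/2` is an embedding. -/
theorem smoothEmb_add_of_fderiv_le {ψ : V → V} (hψ : ContDiff ℝ ∞ ψ)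
    (hb : ∀ v, ‖fderiv ℝ ψ v‖ ≤ 1 / 2) : SmoothEmb (fun v => v + ψ v) univ := by
  have hd : Differentiable ℝ ψ := hψ.differentiable (by simp)
  have hlip : ∀ x y, ‖ψ y - ψ x‖ ≤ 1 / 2 * ‖y - x‖ := fun x y =>
    convex_univ.norm_image_sub_le_of_norm_fderiv_le (fun z _ => hd z) (fun z _ => hb z)
      (mem_univ x) (mem_univ y)
  refine ⟨isOpen_univ, fun x _ y _ hxy => ?_, fun x _ =>
    ⟨contDiffAt_id.add hψ.contDiffAt, ?_⟩⟩
  · have h1 := hlip x y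
    have h2 : y - x = -(ψ y - ψ x) := by
      rw [neg_sub, sub_eq_sub_iff_add_eq_add, add_comm (ψ x)]
      exact hxy.symm
    rw [← norm_neg, ← h2] at h1
    have h3 : ‖y - x‖ = 0 := by linarith [norm_nonneg (y - x)]
    exact (sub_eq_zero.1 (norm_eq_zero.1 h3)).symm
  · have h1 : HasFDerivAt (fun v => v + ψ v) (ContinuousLinearMap.id ℝ V + fderiv ℝ ψ x) x :=
      (hasFDerivAt_id x).add (hd x).hasFDerivAt
    rw [h1.fderiv, injective_iff_map_eq_zero]
    intro v hv
    have h2 : v = -(fderiv ℝ ψ x v) := by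
      rw [← add_eq_zero_iff_eq_neg]
      simpa using hv
    have h3 : ‖v‖ ≤ 1 / 2 * ‖v‖ := by
      conv_lhs => rw [h2, norm_neg]
      exact (ContinuousLinearMap.le_opNorm _ _).trans (by gcongr; exact hb x)
    exact norm_eq_zero.1 (by linarith [norm_nonneg v])

variable [FiniteDimensional ℝ V]

/-- A smooth germ at `c` with `f c = c` and derivative the identity agrees near `c` with an
embedding supported in a small ball. -/
theorem exists_smoothEmb_of_germ {f : V → V} {c : V} {N : Set V} (hN : IsOpen N) (hc : c ∈ N)
    (hf : ContDiffOn ℝ ∞ f N) (hfc : f c = c) (hf' : fderiv ℝ f c = ContinuousLinearMap.id ℝ V) :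
    ∃ (s : ℝ) (κ : V → V), 0 < s ∧ s ≤ 1 ∧ Metric.closedBall c (2 * s) ⊆ N ∧ SmoothEmb κ univ ∧
      (∀ p ∈ Metric.closedBall c s, κ p = f p) ∧ ∀ p, p ∉ Metric.closedBall c (2 * s) → κ p = p := by
  let b : ContDiffBump (0 : V) := ⟨1, 2, one_pos, by norm_num⟩
  have hbs : ContDiff ℝ ∞ b := b.contDiff
  obtain ⟨B, hB⟩ := (b.hasCompactSupport.fderiv (𝕜 := ℝ)).exists_bound_of_continuous
    (hbs.continuous_fderiv (by simp))
  have hB0 : 0 ≤ B := (norm_nonneg _).trans (hB 0)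
  let g : V → V := fun v => f (c + v) - (c + v)
  have hgs : ∀ v, c + v ∈ N → ContDiffAt ℝ ∞ g v := fun v hv => by
    have h1 : ContDiffAt ℝ ∞ (fun v => c + v) v := contDiffAt_const.add contDiffAt_id
    exact ((hf.contDiffAt (hN.mem_nhds hv)).comp v h1).sub h1
  have hg0 : g 0 = 0 := by simp [g, hfc]
  have hc0 : c + 0 ∈ N := by rwa [add_zero]
  have hg' : fderiv ℝ g 0 = 0 := by
    have h1 : HasFDerivAt (fun v => c + v) (ContinuousLinearMap.id ℝ V) 0 :=
      (hasFDerivAt_id 0).const_add c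
    have h2 : HasFDerivAt f (ContinuousLinearMap.id ℝ V) (c + 0) := by
      rw [add_zero, ← hf']
      exact ((hf.contDiffAt (hN.mem_nhds hc)).differentiableAt (by simp)).hasFDerivAt
    have h3 := ((h2.comp 0 h1).sub h1).fderiv
    rw [show g = (f ∘ fun v => c + v) - fun v => c + v from rfl, h3]
    simp
  set ε : ℝ := 1 / (4 * B + 2) with hε
  have hε0 : 0 < ε := by positivity
  have hcont : ContinuousAt (fderiv ℝ g) 0 :=
    ((hgs 0 hc0).fderiv_right (m := 0) (by simp)).continuousAt
  obtain ⟨δ₁, hδ₁, hδε⟩ := Metric.continuousAt_iff.1 hcont ε hε0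
  obtain ⟨δ₂, hδ₂, hδN⟩ := Metric.isOpen_iff.1 hN c hc
  set δ := min δ₁ δ₂
  have hδ : 0 < δ := lt_min hδ₁ hδ₂
  set s := min 1 (δ / 3)
  have hs : 0 < s := by positivity
  have hsδ : 2 * s < δ := by linarith [min_le_right 1 (δ / 3)]
  have hball : ∀ v ∈ Metric.ball (0 : V) δ, c + v ∈ N := fun v hv => by
    refine hδN ?_
    rw [mem_ball_zero_iff] at hv
    simpa using hv.trans_le (min_le_right _ _)
  have hder : ∀ v ∈ Metric.ball (0 : V) δ, ‖fderiv ℝ g v‖ ≤ ε := fun v hv => by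
    rw [mem_ball_zero_iff] at hv
    have := hδε (x := v) (by simpa using hv.trans_le (min_le_left _ _))
    rw [hg', dist_zero_right] at this
    exact this.le
  have hgle : ∀ v ∈ Metric.ball (0 : V) δ, ‖g v‖ ≤ ε * ‖v‖ := fun v hv => by
    have := (convex_ball (0 : V) δ).norm_image_sub_le_of_norm_fderiv_le
      (fun w hw => (hgs w (hball w hw)).differentiableAt (by simp)) hder
      (Metric.mem_ball_self hδ) hv
    simpa [hg0] using this
  let ψ : V → V := fun v => b (s⁻¹ • v) • g v
  have hzero : ∀ v : V, 2 * s ≤ ‖v‖ → b (s⁻¹ • v) = 0 := fun v hv => by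
    refine b.zero_of_le_dist ?_
    rw [dist_zero_right, norm_smul, norm_inv, Real.norm_eq_abs, abs_of_pos hs, inv_mul_eq_div,
      le_div_iff₀ hs]
    exact hv
  have hzero' : ∀ v : V, 2 * s < ‖v‖ → ψ =ᶠ[𝓝 v] fun _ => 0 := fun v hv => by
    filter_upwards [continuous_norm.continuousAt.eventually (lt_mem_nhds hv)] with w hw
    simp only [ψ, hzero w hw.le, zero_smul]
  have hβs : ContDiff ℝ ∞ fun v => b (s⁻¹ • v) := hbs.comp (contDiff_const_smul _)
  have hψs : ContDiff ℝ ∞ ψ := contDiff_iff_contDiffAt.2 fun v => by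
    rcases lt_or_ge (2 * s) ‖v‖ with h | h
    · exact contDiffAt_const.congr_of_eventuallyEq (hzero' v h)
    · exact hβs.contDiffAt.smul (hgs v (hball v (mem_ball_zero_iff.2 (h.trans_lt hsδ))))
  have hψb : ∀ v, ‖fderiv ℝ ψ v‖ ≤ 1 / 2 := fun v => by
    rcases lt_or_ge (2 * s) ‖v‖ with h | h
    · rw [(hzero' v h).fderiv_eq, fderiv_fun_const]
      simp
    · have hv : v ∈ Metric.ball (0 : V) δ := mem_ball_zero_iff.2 (h.trans_lt hsδ)
      have h1 : HasFDerivAt (fun v => b (s⁻¹ • v)) (s⁻¹ • fderiv ℝ b (s⁻¹ • v)) v := by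
        have h3 : HasFDerivAt (fun v : V => s⁻¹ • v) (s⁻¹ • ContinuousLinearMap.id ℝ V) v :=
          (hasFDerivAt_id v).const_smul _
        refine ((hbs.differentiable (by simp) _).hasFDerivAt.comp v h3).congr_fderiv ?_
        ext w
        simp
      have h2 := h1.smul ((hgs v (hball v hv)).differentiableAt (by simp)).hasFDerivAt
      rw [show ψ = (fun v => b (s⁻¹ • v)) • g from rfl, h2.fderiv]
      have hb1 : ‖b (s⁻¹ • v)‖ ≤ 1 := by
        rw [Real.norm_eq_abs, abs_of_nonneg b.nonneg]
        exact b.le_one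
      calc _ ≤ ‖b (s⁻¹ • v) • fderiv ℝ g v‖ +
            ‖(s⁻¹ • fderiv ℝ b (s⁻¹ • v)).smulRight (g v)‖ := norm_add_le _ _
        _ ≤ 1 * ε + s⁻¹ * B * (ε * (2 * s)) := by
          gcongr
          · rw [norm_smul]
            gcongr
            exact hder v hv
          · rw [ContinuousLinearMap.norm_smulRight_apply, norm_smul, norm_inv, Real.norm_eq_abs,
              abs_of_pos hs]
            gcongr
            · exact hB _
            · exact (hgle v hv).trans (by gcongr)
        _ = 1 / 2 := by
          rw [hε]
          field_simp
          ring
  have hsub : SmoothEmb (fun p : V => p - c) univ :=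
    .of_leftInverse isOpen_univ (g := fun p => p + c)
      (fun x _ => contDiffAt_id.sub contDiffAt_const) (fun x _ => by fun_prop) (fun x _ => by simp)
  have hadd : SmoothEmb (fun p : V => p + c) univ :=
    .of_leftInverse isOpen_univ (g := fun p => p - c)
      (fun x _ => contDiffAt_id.add contDiffAt_const) (fun x _ => by fun_prop) (fun x _ => by simp)
  refine ⟨s, fun p => (p - c) + ψ (p - c) + c, hs, min_le_left _ _, ?_, ?_, ?_, ?_⟩
  · intro p hp
    have := hball (p - c) (mem_ball_zero_iff.2 (by
      rw [Metric.mem_closedBall, dist_eq_norm] at hp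
      linarith))
    simpa using this
  · exact hadd.comp ((smoothEmb_add_of_fderiv_le hψs hψb).comp hsub (mapsTo_univ _ _))
      (mapsTo_univ _ _)
  · intro p hp
    have h1 : b (s⁻¹ • (p - c)) = 1 := by
      refine b.one_of_mem_closedBall ?_
      rw [mem_closedBall_zero_iff, norm_smul, norm_inv, Real.norm_eq_abs, abs_of_pos hs,
        inv_mul_eq_div, div_le_iff₀ hs]
      rw [Metric.mem_closedBall, dist_eq_norm] at hp
      simpa [b] using hp
    simp [ψ, h1, g]
  · intro p hp
    have h1 : b (s⁻¹ • (p - c)) = 0 := hzero _ (by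
      rw [Metric.mem_closedBall, dist_eq_norm, not_le] at hp
      exact hp.le)
    simp [ψ, h1]

end Perturbation

/-! ### The disc theorem -/

/-- The center of the cylinder. -/
def center : ℂ × ℝ := (0, 1 / 2)

theorem center_mem_cylinder : center ∈ cylinder := by
  simp [center, cylinder]
  norm_num

theorem norm_sub_center_le {p : ℂ × ℝ} (hp : p ∈ cylinder) : ‖p - center‖ ≤ 1 := by
  rw [← box_zero] at hp
  rw [Prod.norm_def, max_le_iff]
  have h1 := hp.1
  have h2 := hp.2
  simp only [center, Prod.fst_sub, Prod.snd_sub, sub_zero, Real.norm_eq_abs]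
  constructor <;> linarith

theorem boxCut_antitoneOn {d : ℝ} (hd : 0 < d) (v : ℂ × ℝ) :
    AntitoneOn (fun μ : ℝ => boxCut d (center + μ • v)) (Ici 0) := by
  intro μ hμ ν _ h
  have hμ0 : (0 : ℝ) ≤ μ := hμ
  simp only [boxCut, center, Prod.fst_add, Prod.snd_add, Prod.smul_fst, Prod.smul_snd, zero_add,
    add_sub_cancel_left, norm_smul, Real.norm_eq_abs, mul_pow, sq_abs, smul_eq_mul]
  have hsq : μ ^ 2 ≤ ν ^ 2 := by gcongr
  refine mul_le_mul (antitone_stepDown (by gcongr; linarith) ?_)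
    (antitone_stepDown (by gcongr; linarith) ?_) (stepDown_nonneg _ _ _) (stepDown_nonneg _ _ _)
  · gcongr
  · gcongr

theorem IsConeChart.exists_shrink {G : ℂ × ℝ → E4} {U : Set (ℂ × ℝ)} (hG : IsConeChart G U)
    (hU : cylinder ⊆ U) {s : ℝ} (hs : 0 < s) (hs1 : s ≤ 1) :
    ∃ k, IsConeDiffeo k ∧ ∀ p ∈ cylinder, k (G p) = G (center + s • (p - center)) := by
  obtain ⟨d, hd, -, hdU⟩ := exists_box_subset hG.isOpen hU one_pos
  let κ : ℂ × ℝ → ℂ × ℝ := fun p => center + (1 - (1 - s) * boxCut d p) • (p - center)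
  have hκ : SmoothEmb (fun q : ℝ × (ℂ × ℝ) => (q.1, κ q.2)) (univ ×ˢ univ) :=
    smoothEmb_shrink (c := center) hs hs1 (χ := fun q : ℝ × (ℂ × ℝ) => boxCut d q.2)
      (fun q => boxCut_le_one d q.2) isOpen_univ
      (fun q _ => ((contDiff_boxCut d).comp contDiff_snd).contDiffAt)
      (fun _ _ v => boxCut_antitoneOn hd v)
  have hid : ∀ p ∈ U, p ∉ box (2 * d) → κ p = p := fun p _ hp => by
    simp [κ, boxCut_eq_zero hd hp]
  have hmaps : MapsTo κ (box (2 * d)) (box (2 * d)) := by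
    refine mapsTo_of_injOn_of_eq_off (U := univ) (fun p _ q _ hpq => ?_) (subset_univ _)
      (mapsTo_univ _ _) (fun p _ hp => by simp [κ, boxCut_eq_zero hd hp])
    have := hκ.injOn (mk_mem_prod (mem_univ (0 : ℝ)) (mem_univ p))
      (mk_mem_prod (mem_univ (0 : ℝ)) (mem_univ q)) (Prod.ext rfl hpq)
    exact (Prod.mk.inj this).2
  refine ⟨coneTransfer G U κ, isConeDiffeo_coneTransfer hG (isCompact_box _) hdU
    (hκ.mono (isOpen_univ.prod hG.isOpen) (prod_mono_right (subset_univ _))) hid hmaps,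
    fun p hp => ?_⟩
  rw [coneTransfer_apply hG κ (hU hp)]
  have : boxCut d p = 1 := boxCut_eq_one hd (box_mono hd.le (box_zero.symm ▸ hp))
  simp [κ, this]

theorem isConeDiffeo_normalize_linear (M : E4 ≃L[ℝ] E4) : IsConeDiffeo (normalize M) := by
  refine isConeDiffeo_normalize ?_ (fun r _ x => M.map_smul r x) (fun x hx => by simpa using hx)
  exact .of_leftInverse isOpen_compl_singleton (g := M.symm) (fun x _ => M.contDiff.contDiffAt)
    (fun x _ => M.symm.differentiableAt) (fun x _ => M.symm_apply_apply x)

/-- Two parametrized cylinders in `S³` with the same `1`-jet at the center, up to a linear map,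
differ near the center by a diffeomorphism of `S³`. -/
theorem exists_diffeo_near_center {G G' : ℂ × ℝ → E4} {U U' : Set (ℂ × ℝ)} (hG : IsConeChart G U)
    (hG' : IsConeChart G' U') (hU : center ∈ U) (hU' : center ∈ U') :
    ∃ (s : ℝ) (m k : E4 → E4), 0 < s ∧ s ≤ 1 ∧ IsConeDiffeo m ∧ IsConeDiffeo k ∧
      ∀ p ∈ Metric.closedBall center s, m (G' p) = k (G p) := by
  have h0 : ((0 : ℝ), center) ∈ (univ ×ˢ U : Set (ℝ × (ℂ × ℝ))) := ⟨trivial, hU⟩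
  have h0' : ((0 : ℝ), center) ∈ (univ ×ˢ U' : Set (ℝ × (ℂ × ℝ))) := ⟨trivial, hU'⟩
  obtain ⟨L, hL⟩ := (hG.emb.imm _ h0).exists_equiv finrank_cone
  obtain ⟨L', hL'⟩ := (hG'.emb.imm _ h0').exists_equiv finrank_cone
  have hradial : ∀ {H : ℂ × ℝ → E4} (T : ℝ × (ℂ × ℝ) →L[ℝ] E4), DifferentiableAt ℝ H center →
      HasFDerivAt (coneChart H) T (0, center) → T (1, 0) = H center := by
    intro H T hH hT
    rw [hT.unique (hasFDerivAt_coneChart (q := (0, center)) hH)]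
    simp
  have hGd := (hG.contDiffAt hU).differentiableAt (by simp)
  have hGd' := (hG'.contDiffAt hU').differentiableAt (by simp)
  let M : E4 ≃L[ℝ] E4 := L'.symm.trans L
  have hMc : M (G' center) = G center := by
    have h1 := hradial (L : _ →L[ℝ] E4) hGd hL.hasFDerivAt
    have h2 := hradial (L' : _ →L[ℝ] E4) hGd' hL'.hasFDerivAt
    rw [← h1, ← h2]
    simp [M]
  have hinv := hG.emb.inv finrank_cone
  set V := coneChart G '' (univ ×ˢ U)
  set J := invFunOn (coneChart G) (univ ×ˢ U)
  have hVo : IsOpen V := hinv.isOpen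
  set N := U' ∩ (fun p => M (G' p)) ⁻¹' V
  have hcontM : ContinuousOn (fun p => M (G' p)) U' := fun p hp =>
    (M.continuous.continuousAt.comp (hG'.contDiffAt hp).continuousAt).continuousWithinAt
  have hN : IsOpen N := hcontM.isOpen_inter_preimage hG'.isOpen hVo
  have hcN : center ∈ N := ⟨hU', by
    rw [mem_preimage, hMc]
    exact mem_image_coneChart hU⟩
  let f : ℂ × ℝ → ℂ × ℝ := fun p => (J (M (G' p))).2
  have hJG : J (G center) = (0, center) := by
    rw [← coneChart_zero G]
    exact hG.emb.injOn.leftInvOn_invFunOn h0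
  have hfc : f center = center := by simp only [f, hMc, hJG]
  have hfs : ContDiffOn ℝ ∞ f N := fun p hp => by
    have h1 : ContDiffAt ℝ ∞ (fun p => M (G' p)) p :=
      M.contDiff.contDiffAt.comp p (hG'.contDiffAt hp.1)
    exact ((hinv.imm _ hp.2).smooth.comp p h1).snd.contDiffWithinAt
  have hfd : fderiv ℝ f center = ContinuousLinearMap.id ℝ (ℂ × ℝ) := by
    have e0 : HasFDerivAt (fun p : ℂ × ℝ => ((0 : ℝ), p))
        ((0 : ℂ × ℝ →L[ℝ] ℝ).prod (ContinuousLinearMap.id ℝ (ℂ × ℝ))) center :=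
      (hasFDerivAt_const _ _).prodMk (hasFDerivAt_id _)
    have e1 := hL'.hasFDerivAt.comp center e0
    have e2 := M.hasFDerivAt.comp center e1
    have hJd : HasFDerivAt J (fderiv ℝ J (G center)) (M (coneChart G' (0, center))) := by
      rw [coneChart_zero, hMc]
      exact (hinv.imm _ (mem_image_coneChart hU)).differentiableAt.hasFDerivAt
    have e3 := (hasFDerivAt_snd (𝕜 := ℝ) (E := ℝ) (F := ℂ × ℝ)).comp center (hJd.comp center e2)
    have e4 : f = Prod.snd ∘ J ∘ M ∘ coneChart G' ∘ fun p : ℂ × ℝ => ((0 : ℝ), p) := by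
      funext p
      simp [f, coneChart_zero]
    rw [e4, e3.fderiv]
    refine ContinuousLinearMap.ext fun v => ?_
    have h5 := hG.emb.fderiv_inv finrank_cone h0 (0, v)
    rw [hL.hasFDerivAt.fderiv, coneChart_zero] at h5
    simp only [ContinuousLinearMap.comp_apply, ContinuousLinearMap.prod_apply, _root_.zero_apply,
      ContinuousLinearMap.id_apply, ContinuousLinearMap.coe_snd']
    have h6 : (M : E4 →L[ℝ] E4) ((L' : ℝ × (ℂ × ℝ) →L[ℝ] E4) (0, v)) =
        (L : ℝ × (ℂ × ℝ) →L[ℝ] E4) (0, v) := by simp [M]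
    rw [h6]
    exact congrArg Prod.snd h5
  obtain ⟨s, κ, hs, hs1, hball, hκ, hκf, hκid⟩ := exists_smoothEmb_of_germ (hN.inter hG.isOpen)
    ⟨hcN, hU⟩ (hfs.mono inter_subset_left) hfc hfd
  have hmaps : MapsTo κ (Metric.closedBall center (2 * s)) (Metric.closedBall center (2 * s)) :=
    mapsTo_of_injOn_of_eq_off hκ.injOn (subset_univ _) (mapsTo_univ _ _) (fun p _ hp => hκid p hp)
  have hk := isConeDiffeo_coneTransfer hG (isCompact_closedBall center (2 * s))
    (fun p hp => (hball hp).2) ((smoothEmb_prodMk hκ).mono (isOpen_univ.prod hG.isOpen)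
      (prod_mono_right (subset_univ _))) (fun p _ hp => hκid p hp) hmaps
  refine ⟨s, normalize M, coneTransfer G U κ, hs, hs1, isConeDiffeo_normalize_linear M, hk,
    fun p hp => ?_⟩
  have hpN := hball (Metric.closedBall_subset_closedBall (by linarith) hp)
  rw [coneTransfer_apply hG κ hpN.2, hκf p hp]
  obtain ⟨r, hr, q, hq, he⟩ := exists_of_mem_image_coneChart hpN.1.2
  simp only at he
  have hfp : f p = q := by
    have h1 : J (coneChart G (Real.log r, q)) = (Real.log r, q) :=
      hG.emb.injOn.leftInvOn_invFunOn (mk_mem_prod trivial hq)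
    rw [coneChart, Real.exp_log hr] at h1
    simp only [f, he]
    exact congrArg Prod.snd h1
  rw [normalize, he, norm_smul, hG.norm_eq q hq, hG'.norm_eq p hpN.1.1, Real.norm_eq_abs,
    abs_of_pos hr, mul_one, smul_smul, one_div, inv_mul_cancel₀ hr.ne', one_smul, hfp]

/-- Any two cone charts differ on the cylinder by a diffeomorphism of `S³`: shrinking the cylinders
reduces this to a neighbourhood of the center. -/
theorem IsConeChart.exists_diffeo {G G' : ℂ × ℝ → E4} {U U' : Set (ℂ × ℝ)} (hG : IsConeChart G U)
    (hG' : IsConeChart G' U') (hU : cylinder ⊆ U) (hU' : cylinder ⊆ U') :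
    ∃ k, IsConeDiffeo k ∧ ∀ p ∈ cylinder, k (G' p) = G p := by
  obtain ⟨s, m, k₁, hs, hs1, hm, hk₁, h1⟩ := exists_diffeo_near_center hG hG'
    (hU center_mem_cylinder) (hU' center_mem_cylinder)
  obtain ⟨k₂, hk₂, h2⟩ := hG.exists_shrink hU hs hs1
  obtain ⟨k₃, hk₃, h3⟩ := hG'.exists_shrink hU' hs hs1
  obtain ⟨l₁, hl₁, hl₁k, -⟩ := hk₁.exists_inverse
  obtain ⟨l₂, hl₂, hl₂k, -⟩ := hk₂.exists_inverse
  refine ⟨_, hl₂.comp (hl₁.comp (hm.comp hk₃)), fun p hp => ?_⟩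
  have hball : center + s • (p - center) ∈ Metric.closedBall center s := by
    rw [Metric.mem_closedBall, dist_eq_norm, add_sub_cancel_left, norm_smul, Real.norm_eq_abs,
      abs_of_pos hs]
    exact mul_le_of_le_one_right hs.le (norm_sub_center_le hp)
  simp only [h3 p hp, h1 _ hball, hl₁k]
  rw [← h2 p hp, hl₂k]

/-- A parametrized cylinder in `S³` is the image of the standard one under an orientation preserving
diffeomorphism of `S³`. -/
theorem IsCylinder.exists_diffeo {G : ℂ × ℝ → E4} (h : IsCylinder G) :
    ∃ k, IsOrientedConeDiffeo k ∧ ∀ p ∈ cylinder, k (closeUp p) = G p := by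
  obtain ⟨G', U, hG', hU, heq, hder⟩ := h.exists_coneChart
  obtain ⟨k, hk, hkG⟩ := hG'.exists_diffeo isConeChart_closeUp hU cylinder_subset_slab
  refine ⟨k, ⟨hk, fun x hx => ?_⟩, fun p hp => by rw [hkG p hp, heq hp]⟩
  have hc := center_mem_cylinder
  have hne : closeUp center ≠ 0 := by
    rw [← norm_pos_iff, norm_closeUp]
    exact one_pos
  have hkd : DifferentiableAt ℝ k (closeUp center) := (hk.emb.imm _ hne).differentiableAt
  have hcd : DifferentiableAt ℝ closeUp center := contDiff_closeUp.differentiable (by simp) _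
  have hd : fderiv ℝ G' center = (fderiv ℝ k (closeUp center)).comp (fderiv ℝ closeUp center) := by
    rw [← fderiv_comp center hkd hcd]
    exact fderiv_eq_of_eqOn_convex convex_cylinder nonempty_interior_cylinder hc
      ((hG'.contDiffAt (hU hc)).differentiableAt (by simp)) (hkd.comp center hcd)
      (fun p hp => (hkG p hp).symm)
  have h1 := h.det_pos center hc
  rw [chartDet, ← hder center hc, ← heq hc, ← hkG center hc, hd] at h1
  simp only [ContinuousLinearMap.comp_apply] at h1
  rw [← hk.hom.fderiv_self hkd, frameDet_map] at h1
  exact hk.det_pos hne (pos_of_mul_pos_left h1 (chartDet_closeUp_pos center).le) hx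

/-! ### Thickening a band in the cylinder -/

/-- A smooth function on the plane that vanishes exactly on the segment `[-1/2, 1/2]` and increases
along rays from `0`. -/
def offStrip (z : ℂ) : ℝ :=
  z.im ^ 2 + expNegInvGlue (z.re - 1 / 2) + expNegInvGlue (-z.re - 1 / 2)

theorem offStrip_nonneg (z : ℂ) : 0 ≤ offStrip z :=
  add_nonneg (add_nonneg (sq_nonneg _) (expNegInvGlue.nonneg _)) (expNegInvGlue.nonneg _)

theorem contDiff_offStrip : ContDiff ℝ ∞ offStrip := by
  have h1 : ContDiff ℝ ∞ fun z : ℂ => z.re := Complex.reCLM.contDiff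
  have h2 : ContDiff ℝ ∞ fun z : ℂ => z.im := Complex.imCLM.contDiff
  exact ((h2.pow 2).add (expNegInvGlue.contDiff.comp (h1.sub contDiff_const))).add
    (expNegInvGlue.contDiff.comp (h1.neg.sub contDiff_const))

theorem offStrip_eq_zero_iff {z : ℂ} :
    offStrip z = 0 ↔ ∃ x ∈ Icc (-1 / 2 : ℝ) (1 / 2), z = x := by
  constructor
  · intro h
    have h1 := sq_nonneg z.im
    have h2 := expNegInvGlue.nonneg (z.re - 1 / 2)
    have h3 := expNegInvGlue.nonneg (-z.re - 1 / 2)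
    unfold offStrip at h
    have h4 : z.im ^ 2 = 0 := by linarith
    have h5 : expNegInvGlue (z.re - 1 / 2) = 0 := by linarith
    have h6 : expNegInvGlue (-z.re - 1 / 2) = 0 := by linarith
    rw [expNegInvGlue.zero_iff_nonpos] at h5 h6
    exact ⟨z.re, ⟨by linarith, by linarith⟩, Complex.ext (by simp) (by simpa using h4)⟩
  · rintro ⟨x, hx, rfl⟩
    have h5 : expNegInvGlue (x - 1 / 2) = 0 := expNegInvGlue.zero_of_nonpos (by linarith [hx.2])
    have h6 : expNegInvGlue (-x - 1 / 2) = 0 := expNegInvGlue.zero_of_nonpos (by linarith [hx.1])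
    simp only [offStrip, Complex.ofReal_re, Complex.ofReal_im, h5, h6]
    norm_num

theorem offStrip_smul_le (z : ℂ) {r r' : ℝ} (hr : 0 ≤ r) (h : r ≤ r') :
    offStrip (r • z) ≤ offStrip (r' • z) := by
  have hg : ∀ x : ℝ, expNegInvGlue (r * x - 1 / 2) ≤ expNegInvGlue (r' * x - 1 / 2) := by
    intro x
    rcases le_total 0 x with hx | hx
    · exact expNegInvGlue.monotone (by nlinarith)
    · rw [expNegInvGlue.zero_of_nonpos (by nlinarith : r * x - 1 / 2 ≤ 0)]
      exact expNegInvGlue.nonneg _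
  simp only [offStrip, Complex.real_smul, Complex.mul_re, Complex.mul_im, Complex.ofReal_re,
    Complex.ofReal_im, zero_mul, sub_zero, add_zero]
  have h1 := hg z.re
  have h2 := hg (-z.re)
  have h3 : (r * z.im) ^ 2 ≤ (r' * z.im) ^ 2 := by
    rw [mul_pow, mul_pow]
    exact mul_le_mul_of_nonneg_right (pow_le_pow_left₀ hr h 2) (sq_nonneg _)
  rw [mul_neg, mul_neg] at h2
  linarith

theorem exists_lt_of_isCompact {X : Type*} [TopologicalSpace X] {K : Set X} (hK : IsCompact K)
    {f : X → ℝ} (hf : ContinuousOn f K) (h : ∀ x ∈ K, 0 < f x) : ∃ m > 0, ∀ x ∈ K, m < f x := by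
  rcases K.eq_empty_or_nonempty with rfl | hne
  · exact ⟨1, one_pos, by simp⟩
  · obtain ⟨x, hx, hm⟩ := hK.exists_isMinOn hne hf
    exact ⟨f x / 2, half_pos (h x hx), fun y hy => by
      have := hm hy
      have h2 := h x hx
      simp only [mem_ofPred_eq] at this
      linarith⟩

theorem exists_norm_lt_one_of_offStrip_le : ∃ σ > 0, ∀ z, offStrip z ≤ σ → ‖z‖ < 1 := by
  obtain ⟨m, hm, h⟩ := exists_lt_of_isCompact (isCompact_sphere (0 : ℂ) 1)
    contDiff_offStrip.continuous.continuousOn (fun z hz => by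
      refine (offStrip_nonneg z).lt_of_ne' fun h0 => ?_
      obtain ⟨x, hx, rfl⟩ := offStrip_eq_zero_iff.1 h0
      have h1 : ‖(x : ℂ)‖ = 1 := by simpa using hz
      rw [Complex.norm_real, Real.norm_eq_abs] at h1
      have := abs_le.2 ⟨by linarith [hx.1], hx.2⟩
      linarith)
  refine ⟨m, hm, fun z hz => ?_⟩
  by_contra! h1
  have hz0 : ‖z‖ ≠ 0 := by linarith
  have h2 := h (‖z‖⁻¹ • z) (by simp [hz0])
  have h3 := offStrip_smul_le z (inv_nonneg.2 (norm_nonneg z)) (inv_le_one_of_one_le₀ h1)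
  rw [one_smul] at h3
  linarith

/-- A closed set that misses `[-1/2, 1/2] × [a, b]` misses a uniform neighbourhood of it. -/
theorem exists_lt_offStrip {Z : Set (ℂ × ℝ)} (hZ : IsClosed Z) {a b : ℝ}
    (h : ∀ p ∈ Z, p.2 ∈ Icc a b → offStrip p.1 ≠ 0) :
    ∃ σ > 0, ∀ p ∈ Z, p.2 ∈ Icc a b → σ < offStrip p.1 := by
  obtain ⟨σ, hσ, h1⟩ := exists_norm_lt_one_of_offStrip_le
  have hK : IsCompact (Z ∩ Metric.closedBall (0 : ℂ) 1 ×ˢ Icc a b) :=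
    ((isCompact_closedBall _ _).prod isCompact_Icc).inter_left hZ
  obtain ⟨m, hm, h2⟩ := exists_lt_of_isCompact hK (f := fun p => offStrip p.1)
    (contDiff_offStrip.continuous.comp continuous_fst).continuousOn
    (fun p hp => (offStrip_nonneg _).lt_of_ne' (h p hp.1 hp.2.2))
  refine ⟨min σ m, lt_min hσ hm, fun p hp ht => ?_⟩
  by_contra! h3
  have h4 := h1 _ (h3.trans (min_le_left _ _))
  have h5 := h2 p ⟨hp, by simpa using h4.le, ht⟩
  exact absurd (h3.trans (min_le_right _ _)) (not_le.2 h5)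

/-- The cross product in `ℂ × ℝ = ℝ³`. -/
def cross (v w : ℂ × ℝ) : ℂ × ℝ :=
  (⟨v.1.im * w.2 - v.2 * w.1.im, v.2 * w.1.re - v.1.re * w.2⟩,
    v.1.re * w.1.im - v.1.im * w.1.re)

theorem contDiff_cross : ContDiff ℝ ∞ fun p : (ℂ × ℝ) × (ℂ × ℝ) => cross p.1 p.2 := by
  have e : (fun p : (ℂ × ℝ) × (ℂ × ℝ) => cross p.1 p.2) = fun p =>
      (Complex.equivRealProdCLM.symm (p.1.1.im * p.2.2 - p.1.2 * p.2.1.im,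
        p.1.2 * p.2.1.re - p.1.1.re * p.2.2), p.1.1.re * p.2.1.im - p.1.1.im * p.2.1.re) := by
    funext p
    refine Prod.ext (Complex.ext ?_ ?_) rfl <;> simp [cross]
  rw [e]
  have hr : ContDiff ℝ ∞ fun z : ℂ => z.re := Complex.reCLM.contDiff
  have hi : ContDiff ℝ ∞ fun z : ℂ => z.im := Complex.imCLM.contDiff
  have a1 : ContDiff ℝ ∞ fun p : (ℂ × ℝ) × (ℂ × ℝ) => p.1.1.re :=
    hr.comp (contDiff_fst.comp contDiff_fst)
  have a2 : ContDiff ℝ ∞ fun p : (ℂ × ℝ) × (ℂ × ℝ) => p.1.1.im :=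
    hi.comp (contDiff_fst.comp contDiff_fst)
  have a3 : ContDiff ℝ ∞ fun p : (ℂ × ℝ) × (ℂ × ℝ) => p.1.2 := contDiff_snd.comp contDiff_fst
  have b1 : ContDiff ℝ ∞ fun p : (ℂ × ℝ) × (ℂ × ℝ) => p.2.1.re :=
    hr.comp (contDiff_fst.comp contDiff_snd)
  have b2 : ContDiff ℝ ∞ fun p : (ℂ × ℝ) × (ℂ × ℝ) => p.2.1.im :=
    hi.comp (contDiff_fst.comp contDiff_snd)
  have b3 : ContDiff ℝ ∞ fun p : (ℂ × ℝ) × (ℂ × ℝ) => p.2.2 := contDiff_snd.comp contDiff_snd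
  exact (Complex.equivRealProdCLM.symm.contDiff.comp
    (((a2.mul b3).sub (a3.mul b2)).prodMk ((a3.mul b1).sub (a1.mul b3)))).prodMk
    ((a1.mul b2).sub (a2.mul b1))

/-- An injective linear map from the plane to `ℝ³`, completed by the normal vector, is
injective. -/
theorem eq_zero_of_add_cross {L : ℝ × ℝ →L[ℝ] ℂ × ℝ} (hL : Injective L) {a : ℝ × ℝ} {b : ℝ}
    (h : L a + b • cross (L (0, 1)) (L (1, 0)) = 0) : a = 0 ∧ b = 0 := by
  have h0 : ∀ a, L a = 0 → a = 0 := fun a ha => hL (by rw [ha, map_zero])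
  have e : L a = a.1 • L (1, 0) + a.2 • L (0, 1) := by
    rw [← map_smul, ← map_smul, ← map_add]
    congr 1
    ext <;> simp
  have hT : L (0, 1) ≠ 0 := fun hT => by simpa using h0 _ hT
  have hdep : ∀ u v : ℝ, u • L (1, 0) + v • L (0, 1) = 0 → u = 0 ∧ v = 0 := by
    intro u v huv
    rw [← map_smul, ← map_smul, ← map_add] at huv
    have := h0 _ huv
    simpa [Prod.ext_iff] using this
  rw [e] at h
  obtain ⟨⟨⟨x1, x2⟩, x3⟩, hX⟩ : ∃ v, L (1, 0) = v := ⟨_, rfl⟩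
  obtain ⟨⟨⟨t1, t2⟩, t3⟩, hT'⟩ : ∃ v, L (0, 1) = v := ⟨_, rfl⟩
  rw [hX, hT'] at h hdep
  rw [hT'] at hT
  simp only [cross, Prod.ext_iff, Complex.ext_iff, Prod.fst_add, Prod.snd_add, Prod.smul_fst,
    Prod.smul_snd, Complex.add_re, Complex.add_im, Complex.real_smul, Complex.mul_re,
    Complex.mul_im, Complex.ofReal_re, Complex.ofReal_im, zero_mul, sub_zero, add_zero,
    smul_eq_mul, Prod.fst_zero, Prod.snd_zero, Complex.zero_re, Complex.zero_im] at h hdep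
  obtain ⟨⟨h1, h2⟩, h3⟩ := h
  set n1 := t2 * x3 - t3 * x2 with hn1
  set n2 := t3 * x1 - t1 * x3 with hn2
  set n3 := t1 * x2 - t2 * x1 with hn3
  have hb : b * (n1 ^ 2 + n2 ^ 2 + n3 ^ 2) = 0 := by
    linear_combination n1 * h1 + n2 * h2 + n3 * h3 - a.1 * (by rw [hn1, hn2, hn3]; ring :
      n1 * x1 + n2 * x2 + n3 * x3 = 0) - a.2 * (by rw [hn1, hn2, hn3]; ring :
      n1 * t1 + n2 * t2 + n3 * t3 = 0)
  have hn : n1 ^ 2 + n2 ^ 2 + n3 ^ 2 ≠ 0 := by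
    intro hn
    have z1 : n1 = 0 := by nlinarith [sq_nonneg n1, sq_nonneg n2, sq_nonneg n3]
    have z2 : n2 = 0 := by nlinarith [sq_nonneg n1, sq_nonneg n2, sq_nonneg n3]
    have z3 : n3 = 0 := by nlinarith [sq_nonneg n1, sq_nonneg n2, sq_nonneg n3]
    have := (hdep (t1 ^ 2 + t2 ^ 2 + t3 ^ 2) (-(t1 * x1 + t2 * x2 + t3 * x3))
      ⟨⟨by linear_combination t3 * (hn2.symm.trans z2) - t2 * (hn3.symm.trans z3),
        by linear_combination t1 * (hn3.symm.trans z3) - t3 * (hn1.symm.trans z1)⟩,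
        by linear_combination t2 * (hn1.symm.trans z1) - t1 * (hn2.symm.trans z2)⟩).1
    exact hT (Prod.ext (Complex.ext (by nlinarith [sq_nonneg t1, sq_nonneg t2, sq_nonneg t3] : t1 = 0)
      (by nlinarith [sq_nonneg t1, sq_nonneg t2, sq_nonneg t3] : t2 = 0))
      (by nlinarith [sq_nonneg t1, sq_nonneg t2, sq_nonneg t3] : t3 = 0))
  have hb0 : b = 0 := (mul_eq_zero.1 hb).resolve_right hn
  subst hb0
  have := hdep a.1 a.2 ⟨⟨by linarith, by linarith⟩, by linarith⟩
  exact ⟨Prod.ext this.1 this.2, rfl⟩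

/-- The thickening of the band `f` in the direction of its normal vector. -/
def thicken (f : ℝ × ℝ → ℂ × ℝ) (p : ℂ × ℝ) : ℂ × ℝ :=
  f (p.1.re, p.2) + p.1.im • cross (fderiv ℝ f (p.1.re, p.2) (0, 1))
    (fderiv ℝ f (p.1.re, p.2) (1, 0))

/-- The projection of `ℂ × ℝ` to the plane. -/
def planeProj : ℂ × ℝ →L[ℝ] ℝ × ℝ :=
  (Complex.reCLM.comp (ContinuousLinearMap.fst ℝ ℂ ℝ)).prod (ContinuousLinearMap.snd ℝ ℂ ℝ)

theorem planeProj_apply (p : ℂ × ℝ) : planeProj p = (p.1.re, p.2) := rfl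

theorem thicken_incl (f : ℝ × ℝ → ℂ × ℝ) (q : ℝ × ℝ) : thicken f (incl q) = f q := by
  simp [thicken, incl]

theorem contDiffAt_thicken_normal {f : ℝ × ℝ → ℂ × ℝ} {p : ℂ × ℝ}
    (hf : ContDiffAt ℝ ∞ f (planeProj p)) :
    ContDiffAt ℝ ∞ (fun p : ℂ × ℝ => cross (fderiv ℝ f (planeProj p) (0, 1))
      (fderiv ℝ f (planeProj p) (1, 0))) p := by
  have h1 : ContDiffAt ℝ ∞ (fun p => fderiv ℝ f (planeProj p)) p :=
    ContDiffAt.comp p (hf.fderiv_right (m := ∞) (by simp)) planeProj.contDiff.contDiffAt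
  exact contDiff_cross.contDiffAt.comp p
    ((h1.clm_apply contDiffAt_const).prodMk (h1.clm_apply contDiffAt_const))

theorem contDiffAt_thicken {f : ℝ × ℝ → ℂ × ℝ} {p : ℂ × ℝ}
    (hf : ContDiffAt ℝ ∞ f (planeProj p)) : ContDiffAt ℝ ∞ (thicken f) p := by
  have h2 : ContDiffAt ℝ ∞ (fun p : ℂ × ℝ => f (planeProj p)) p :=
    hf.comp p planeProj.contDiff.contDiffAt
  have h3 : ContDiff ℝ ∞ fun p : ℂ × ℝ => p.1.im :=
    Complex.imCLM.contDiff.comp contDiff_fst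
  exact h2.add (h3.contDiffAt.smul (contDiffAt_thicken_normal hf))

theorem immersionAt_thicken {f : ℝ × ℝ → ℂ × ℝ} {q : ℝ × ℝ}
    (hf : ContDiffAt ℝ ∞ f q) (hi : Injective (fderiv ℝ f q)) :
    ImmersionAt (thicken f) (incl q) := by
  have hq : planeProj (incl q) = q := by simp [planeProj_apply, incl]
  have hf' : ContDiffAt ℝ ∞ f (planeProj (incl q)) := by rwa [hq]
  refine ⟨contDiffAt_thicken hf', ?_⟩
  have h2 : HasFDerivAt (fun p : ℂ × ℝ => f (planeProj p))
      ((fderiv ℝ f q).comp planeProj) (incl q) := by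
    have : HasFDerivAt f (fderiv ℝ f q) (planeProj (incl q)) := by
      rw [hq]; exact (hf.differentiableAt (by simp)).hasFDerivAt
    exact this.comp _ planeProj.hasFDerivAt
  have h3 : HasFDerivAt (fun p : ℂ × ℝ => p.1.im)
      (Complex.imCLM.comp (ContinuousLinearMap.fst ℝ ℂ ℝ)) (incl q) :=
    (Complex.imCLM.comp (ContinuousLinearMap.fst ℝ ℂ ℝ)).hasFDerivAt
  have h4 := h2.add (h3.smul
    ((contDiffAt_thicken_normal hf').differentiableAt (by simp)).hasFDerivAt)
  have h5 : fderiv ℝ (thicken f) (incl q) = _ := h4.fderiv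
  rw [injective_iff_map_eq_zero, h5]
  intro v hv
  have him : (incl q).1.im = 0 := by simp [incl]
  simp only [_root_.add_apply, ContinuousLinearMap.comp_apply, him, hq,
    zero_smul, ContinuousLinearMap.smulRight_apply, zero_add,
    ContinuousLinearMap.coe_fst', Complex.imCLM_apply] at hv
  obtain ⟨ha, hb⟩ := eq_zero_of_add_cross hi hv
  rw [planeProj_apply, Prod.ext_iff] at ha
  exact Prod.ext (Complex.ext ha.1 hb) ha.2

theorem ImmersionAt.eventually_injective {E F : Type*} [NormedAddCommGroup E] [NormedSpace ℝ E]
    [NormedAddCommGroup F] [NormedSpace ℝ F] [FiniteDimensional ℝ E] [FiniteDimensional ℝ F]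
    {f : E → F} {x : E} (h : ImmersionAt f x) (hd : Module.finrank ℝ E = Module.finrank ℝ F) :
    ∀ᶠ y in 𝓝 x, Injective (fderiv ℝ f y) := by
  obtain ⟨L, hL⟩ := h.exists_equiv hd
  have : CompleteSpace E := FiniteDimensional.complete ℝ E
  have h1 : range ((↑) : (E ≃L[ℝ] F) → E →L[ℝ] F) ∈ 𝓝 (fderiv ℝ f x) := by
    rw [hL.hasFDerivAt.fderiv]
    exact ContinuousLinearEquiv.nhds L
  filter_upwards [h.continuousAt_fderiv h1] with y ⟨M, hM⟩
  have hM' : fderiv ℝ f y = (M : E →L[ℝ] F) := hM.symm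
  rw [hM']
  exact M.injective

/-- The inclusion of the plane as a continuous linear map. -/
def inclL : ℝ × ℝ →L[ℝ] ℂ × ℝ :=
  (Complex.ofRealCLM.comp (ContinuousLinearMap.fst ℝ ℝ ℝ)).prod (ContinuousLinearMap.snd ℝ ℝ ℝ)

theorem inclL_apply (q : ℝ × ℝ) : inclL q = incl q := rfl

theorem contDiff_incl : ContDiff ℝ ∞ incl := inclL.contDiff

theorem fderiv_incl (q : ℝ × ℝ) : fderiv ℝ incl q = inclL := inclL.fderiv

theorem incl_mem_cylinder {q : ℝ × ℝ} (hq : q ∈ rectangle) : incl q ∈ cylinder := by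
  refine ⟨?_, hq.2⟩
  have h1 : ‖(incl q).1‖ = |q.1| := by simp [incl]
  rw [h1]
  exact abs_le.2 ⟨by linarith [hq.1.1], by linarith [hq.1.2]⟩

theorem convex_rectangle : Convex ℝ rectangle := (convex_Icc _ _).prod (convex_Icc _ _)

theorem nonempty_interior_rectangle : (interior rectangle).Nonempty := by
  rw [rectangle, interior_prod_eq, interior_Icc, interior_Icc]
  exact ⟨(0, 1 / 2), by norm_num [mem_prod, mem_Ioo]⟩

theorem thicken_eq_self {f : ℝ × ℝ → ℂ × ℝ} {p : ℂ × ℝ} (h : f =ᶠ[𝓝 (planeProj p)] incl) :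
    thicken f p = p := by
  have h1 := h.eq_of_nhds
  have h2 := h.fderiv_eq (𝕜 := ℝ)
  rw [planeProj_apply] at h1 h2
  rw [thicken, h1, h2, fderiv_incl, inclL_apply, inclL_apply]
  refine Prod.ext (Complex.ext ?_ ?_) ?_ <;> simp [incl, cross]

/-- A band in the cylinder that is standard near its ends extends, away from the ends, to an
embedding of a neighbourhood of the standard band, which is the identity near the ends. -/
theorem IsZeroFramedTangle.exists_thickening {φ : ℝ × ℝ → ℂ × ℝ} {K : Set (E4 × E4)}
    (hφ : IsZeroFramedTangle φ K) :
    ∃ (δ : ℝ) (Θ : ℂ × ℝ → ℂ × ℝ) (O : Set (ℂ × ℝ)), 0 < δ ∧ δ ≤ 1 / 8 ∧ SmoothEmb Θ O ∧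
      (∀ q ∈ rectangle, q.2 ∈ Icc δ (1 - δ) → incl q ∈ O ∧ Θ (incl q) = φ q) ∧
      (∀ p ∈ O, p.2 < 2 * δ ∨ 1 - 2 * δ < p.2 → Θ p = p) ∧
      ∀ q ∈ rectangle, q.2 ≤ 2 * δ ∨ 1 - 2 * δ ≤ q.2 → φ q = incl q := by
  obtain ⟨ε, hε, hends⟩ := hφ.eq_near_ends
  obtain ⟨U, hUo, hU, hφU⟩ := hφ.smooth
  set δ := min ε 1 / 8 with hδ
  have hδ0 : 0 < δ := by have := lt_min hε one_pos; positivity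
  have hδε : 8 * δ ≤ ε := by have := min_le_left ε 1; linarith
  have hδ1 : 8 * δ ≤ 1 := by have := min_le_right ε 1; linarith
  set l : ℝ → ℝ := fun t => stepDown ((1 / 2 - 3 * δ) ^ 2) ((1 / 2 - 2 * δ) ^ 2) ((t - 1 / 2) ^ 2)
    with hl
  have hlt : (1 / 2 - 3 * δ) ^ 2 < (1 / 2 - 2 * δ) ^ 2 := by nlinarith
  have hl1 : ∀ t, 3 * δ ≤ t → t ≤ 1 - 3 * δ → l t = 1 := fun t h1 h2 =>
    stepDown_eq_one hlt (sq_le_sq' (by linarith) (by linarith))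
  have hl0 : ∀ t, t < 2 * δ ∨ 1 - 2 * δ < t → l t = 0 := fun t h =>
    stepDown_eq_zero hlt (by rcases h with h | h <;> nlinarith)
  have hls : ContDiff ℝ ∞ l :=
    (contDiff_stepDown _ _).comp ((contDiff_id.sub contDiff_const).pow 2)
  set f : ℝ × ℝ → ℂ × ℝ := fun q => incl q + l q.2 • (φ q - incl q) with hf
  have hfs : ∀ q ∈ U, ContDiffAt ℝ ∞ f q := fun q hq =>
    contDiff_incl.contDiffAt.add ((hls.comp contDiff_snd).contDiffAt.smul
      ((hφU.contDiffAt (hUo.mem_nhds hq)).sub contDiff_incl.contDiffAt))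
  have hfφ : EqOn f φ rectangle := by
    intro q hq
    by_cases h : q.2 < ε ∨ 1 - ε < q.2
    · simp [hf, hends q hq h]
    · push Not at h
      simp [hf, hl1 q.2 (by linarith [h.1]) (by linarith [h.2])]
  have hfd : ∀ q ∈ rectangle, fderiv ℝ f q = fderiv ℝ φ q := fun q hq =>
    fderiv_eq_of_eqOn_convex convex_rectangle nonempty_interior_rectangle hq
      ((hfs q (hU hq)).differentiableAt (by simp))
      ((hφU.contDiffAt (hUo.mem_nhds (hU hq))).differentiableAt (by simp)) hfφ
  have himm : ∀ q ∈ rectangle, ImmersionAt (thicken f) (incl q) := fun q hq =>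
    immersionAt_thicken (hfs q (hU hq)) (by rw [hfd q hq]; exact hφ.immersion q hq)
  have hΘ : ∀ q ∈ rectangle, thicken f (incl q) = φ q := fun q hq => by
    rw [thicken_incl, hfφ hq]
  have hRc : IsCompact (incl '' rectangle) :=
    (isCompact_Icc.prod isCompact_Icc).image contDiff_incl.continuous
  obtain ⟨N, hN, hNi⟩ := InjOn.exists_mem_nhdsSet (f := thicken f) (s := incl '' rectangle)
    (by
      rintro _ ⟨q, hq, rfl⟩ _ ⟨q', hq', rfl⟩ h
      rw [hΘ q hq, hΘ q' hq'] at h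
      rw [hφ.injOn hq hq' h]) hRc
    (by rintro _ ⟨q, hq, rfl⟩; exact (himm q hq).differentiableAt.continuousAt)
    (by rintro _ ⟨q, hq, rfl⟩; exact (himm q hq).exists_injOn rfl)
  rw [mem_nhdsSet_iff_forall] at hN
  refine ⟨δ, thicken f, interior N ∩ planeProj ⁻¹' U ∩
    interior {p | Injective (fderiv ℝ (thicken f) p)}, hδ0, by linarith, ⟨?_, ?_, ?_⟩, ?_, ?_, ?_⟩
  · exact (isOpen_interior.inter (hUo.preimage planeProj.continuous)).inter isOpen_interior
  · exact hNi.mono fun p hp => interior_subset hp.1.1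
  · exact fun p hp => ⟨contDiffAt_thicken (hfs _ hp.1.2), interior_subset hp.2⟩
  · intro q hq _
    refine ⟨⟨⟨mem_interior_iff_mem_nhds.2 (hN _ ⟨q, hq, rfl⟩), ?_⟩,
      mem_interior_iff_mem_nhds.2 ((himm q hq).eventually_injective rfl)⟩, hΘ q hq⟩
    have : planeProj (incl q) = q := by simp [planeProj_apply, incl]
    rw [mem_preimage, this]
    exact hU hq
  · intro p _ hp
    apply thicken_eq_self
    have ho : IsOpen {q : ℝ × ℝ | q.2 < 2 * δ ∨ 1 - 2 * δ < q.2} :=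
      (isOpen_lt continuous_snd continuous_const).union (isOpen_lt continuous_const continuous_snd)
    filter_upwards [ho.mem_nhds (show planeProj p ∈ {q : ℝ × ℝ | _} from hp)] with q hq
    simp [hf, hl0 q.2 hq]
  · exact fun q hq h => hends q hq (h.imp (fun h => by linarith) (fun h => by linarith))

/-! ### The ring around a band -/

/-- The width, depending on the height `t`, of the neighbourhood of the standard band in which it
is moved: it is `σ₂` for `t ∈ [δ, 1 - δ]` and `σ₁` outside `[0, 1]`. -/
def width (σ₁ σ₂ δ t : ℝ) : ℝ :=
  σ₁ + (σ₂ - σ₁) * stepDown ((1 / 2 - δ) ^ 2) ((1 / 2) ^ 2) ((t - 1 / 2) ^ 2)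

/-- The part of the cylinder `box d` at some distance from the standard band. -/
def ring (σ₁ σ₂ δ d : ℝ) : Set (ℂ × ℝ) := {p ∈ box d | width σ₁ σ₂ δ p.2 ≤ offStrip p.1}

/-- The constants entering the definition of `ring` are admissible. -/
structure IsRingData (σ₁ σ₂ δ d : ℝ) : Prop where
  pos₂ : 0 < σ₂
  le : σ₂ ≤ σ₁
  norm_lt : ∀ z, offStrip z ≤ σ₁ → ‖z‖ < 1
  posδ : 0 < δ
  leδ : δ ≤ 1 / 8
  posd : 0 < d
  led : d ≤ 1 / 8

section Ring

variable {σ₁ σ₂ δ d : ℝ} (h : IsRingData σ₁ σ₂ δ d)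
include h

theorem IsRingData.lt_sq : (1 / 2 - δ) ^ 2 < (1 / 2 : ℝ) ^ 2 := by
  have := h.posδ; have := h.leδ; nlinarith

theorem IsRingData.width_eq_inner {t : ℝ} (h1 : δ ≤ t) (h2 : t ≤ 1 - δ) :
    width σ₁ σ₂ δ t = σ₂ := by
  rw [width, stepDown_eq_one h.lt_sq (sq_le_sq' (by linarith) (by linarith))]
  ring

theorem IsRingData.width_eq_outer {t : ℝ} (ht : t ∉ Icc (0 : ℝ) 1) : width σ₁ σ₂ δ t = σ₁ := by
  rw [width, stepDown_eq_zero h.lt_sq, mul_zero, add_zero]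
  by_contra! h1
  exact ht ⟨by nlinarith, by nlinarith⟩

theorem IsRingData.le_width (t : ℝ) : σ₂ ≤ width σ₁ σ₂ δ t := by
  have := stepDown_le_one ((1 / 2 - δ) ^ 2) ((1 / 2) ^ 2) ((t - 1 / 2) ^ 2)
  have := h.le
  unfold width
  nlinarith

theorem IsRingData.width_le (t : ℝ) : width σ₁ σ₂ δ t ≤ σ₁ := by
  have := stepDown_nonneg ((1 / 2 - δ) ^ 2) ((1 / 2) ^ 2) ((t - 1 / 2) ^ 2)
  have := h.le
  unfold width
  nlinarith

theorem IsRingData.width_pos (t : ℝ) : 0 < width σ₁ σ₂ δ t := h.pos₂.trans_le (h.le_width t)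

end Ring

theorem contDiff_width (σ₁ σ₂ δ : ℝ) : ContDiff ℝ ∞ (width σ₁ σ₂ δ) :=
  contDiff_const.add (contDiff_const.mul
    ((contDiff_stepDown _ _).comp ((contDiff_id.sub contDiff_const).pow 2)))

theorem isCompact_ring (σ₁ σ₂ δ d : ℝ) : IsCompact (ring σ₁ σ₂ δ d) :=
  (isCompact_box d).inter_right (isClosed_le
    ((contDiff_width _ _ _).continuous.comp continuous_snd)
    (contDiff_offStrip.continuous.comp continuous_fst))

/-! ### The tying map of the standard band -/

/-- The neighbourhood of the standard band, away from its ends, in which it is moved. -/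
def strip (σ δ : ℝ) : Set (ℂ × ℝ) :=
  {p ∈ cylinder | offStrip p.1 ≤ σ ∧ p.2 ∈ Icc δ (1 - δ)}

theorem isCompact_strip (σ δ : ℝ) : IsCompact (strip σ δ) :=
  isCompact_cylinder.inter_right ((isClosed_le
    (contDiff_offStrip.continuous.comp continuous_fst) continuous_const).inter
    (isClosed_Icc.preimage continuous_snd))

/-- The constants in the construction: for a thin enough neighbourhood of the standard band, a
thickening of a tangle is an embedding whose image avoids the ends of a wider neighbourhood. -/
theorem exists_constants {φ : ℝ × ℝ → ℂ × ℝ} (hmap : MapsTo φ rectangle cylinder)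
    (hinj : InjOn φ rectangle) {C : Set E4} (hC : IsClosed C)
    (hCr : ∀ p ∈ cylinder, closeUp p ∈ C → p ∈ incl '' rectangle) {δ : ℝ}
    {Θ : ℂ × ℝ → ℂ × ℝ} {O : Set (ℂ × ℝ)} (hδ : 0 < δ) (hδ1 : δ ≤ 1 / 8) (hΘ : SmoothEmb Θ O)
    (hφΘ : ∀ q ∈ rectangle, q.2 ∈ Icc δ (1 - δ) → incl q ∈ O ∧ Θ (incl q) = φ q)
    (hφ : ∀ q ∈ rectangle, q.2 ≤ 2 * δ ∨ 1 - 2 * δ ≤ q.2 → φ q = incl q) :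
    ∃ σ₁ σ₂ d : ℝ, IsRingData σ₁ σ₂ δ d ∧
      (∀ p ∈ box (2 * d), width σ₁ σ₂ δ p.2 / 2 ≤ offStrip p.1 → closeUp p ∉ C) ∧
      (∀ p, offStrip p.1 ≤ σ₂ → p.2 ∈ Icc δ (1 - δ) → p ∈ O) ∧
      ∀ p, offStrip p.1 ≤ σ₂ → p.2 ∈ Icc (2 * δ) (1 - 2 * δ) →
        Θ p ∈ box d ∧ (offStrip (Θ p).1 ≤ σ₁ → (Θ p).2 ∈ Ioo δ (1 - δ)) := by
  obtain ⟨σ₀, hσ₀, hσ₀n⟩ := exists_norm_lt_one_of_offStrip_le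
  have hQc : Continuous fun p : ℂ × ℝ => offStrip p.1 :=
    contDiff_offStrip.continuous.comp continuous_fst
  have hφc : ∀ q ∈ rectangle, q.2 ∈ Icc (2 * δ) (1 - 2 * δ) → q.2 ∈ Icc δ (1 - δ) :=
    fun q _ h => ⟨by linarith [h.1], by linarith [h.2]⟩
  -- the middle part of the tangle
  set M : Set (ℂ × ℝ) := (fun q => Θ (incl q)) ''
    (Icc (-1 / 2 : ℝ) (1 / 2) ×ˢ Icc (2 * δ) (1 - 2 * δ)) with hM
  have hsub : Icc (-1 / 2 : ℝ) (1 / 2) ×ˢ Icc (2 * δ) (1 - 2 * δ) ⊆ rectangle := fun q hq =>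
    ⟨hq.1, by linarith [hq.2.1], by linarith [hq.2.2]⟩
  have hMc : IsClosed M := by
    refine ((isCompact_Icc.prod isCompact_Icc).image_of_continuousOn ?_).isClosed
    exact hΘ.continuousOn.comp contDiff_incl.continuous.continuousOn
      fun q hq => (hφΘ q (hsub hq) (hφc q (hsub hq) hq.2)).1
  have hZ : IsClosed (M ∩ {p | p.2 ∈ Ioo δ (1 - δ)}ᶜ) :=
    hMc.inter (isOpen_Ioo.preimage continuous_snd).isClosed_compl
  obtain ⟨σ', hσ', h1⟩ := exists_lt_offStrip hZ (a := 0) (b := 1) (by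
    rintro p ⟨⟨q, hq, rfl⟩, hp⟩ ht h0
    obtain ⟨x, hx, hx'⟩ := offStrip_eq_zero_iff.1 h0
    have hq' := hsub hq
    have e1 := (hφΘ q hq' (hφc q hq' hq.2)).2
    simp only [e1] at hx' ht hp
    have hr : (x, (φ q).2) ∈ rectangle := ⟨hx, ht⟩
    have e2 : φ q = incl (x, (φ q).2) := Prod.ext hx' rfl
    have hp' : (φ q).2 ≤ δ ∨ 1 - δ ≤ (φ q).2 := by
      by_contra! h
      exact hp ⟨h.1, h.2⟩
    rw [← hφ _ hr (hp'.imp (fun h => by simp only; linarith) (fun h => by simp only; linarith))]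
      at e2
    have e3 := congrArg Prod.snd (hinj hq' hr e2)
    simp only at e3
    rw [← e3] at hp'
    rcases hp' with h | h <;> linarith [hq.2.1, hq.2.2])
  set σ₁ := min σ₀ σ' with hσ₁
  have hσ₁0 : 0 < σ₁ := lt_min hσ₀ hσ'
  have hn : ∀ z, offStrip z ≤ σ₁ → ‖z‖ < 1 := fun z hz => hσ₀n z (hz.trans (min_le_left _ _))
  obtain ⟨d, hd, hd1, hdU⟩ := exists_box_subset
    (U := ({p | σ₁ / 2 ≤ offStrip p.1} ∩ closeUp ⁻¹' C)ᶜ)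
    ((isClosed_le continuous_const hQc).inter
      (hC.preimage contDiff_closeUp.continuous)).isOpen_compl
    (by
      rintro p hp ⟨h2, h3⟩
      obtain ⟨q, hq, rfl⟩ := hCr p hp h3
      have h4 : offStrip (incl q).1 = 0 := offStrip_eq_zero_iff.2 ⟨q.1, hq.1, rfl⟩
      rw [mem_ofPred, h4] at h2
      linarith) (by norm_num : (0 : ℝ) < 1 / 8)
  -- the open set in which the thickening has to stay
  set N : Set (ℂ × ℝ) := {p | ‖p.1‖ < 1 + d ∧ |p.2 - 1 / 2| < 1 / 2 + d} ∩
    ({p | σ₁ < offStrip p.1} ∪ {p | p.2 ∈ Ioo δ (1 - δ)}) with hN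
  have hNo : IsOpen N := by
    refine IsOpen.inter ((isOpen_lt (continuous_norm.comp continuous_fst) continuous_const).inter
      (isOpen_lt (g := fun _ => 1 / 2 + d) ?_ continuous_const)) ((isOpen_lt continuous_const hQc).union
      (isOpen_Ioo.preimage continuous_snd))
    exact continuous_abs.comp (continuous_snd.sub continuous_const)
  have hO' : IsOpen (O ∩ ({p | p.2 ∈ Icc (2 * δ) (1 - 2 * δ)}ᶜ ∪ Θ ⁻¹' N)) := by
    rw [inter_union_distrib_left]
    exact (hΘ.isOpen.inter (isClosed_Icc.preimage continuous_snd).isOpen_compl).union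
      (hΘ.continuousOn.isOpen_inter_preimage hΘ.isOpen hNo)
  obtain ⟨σ₃, hσ₃, h3⟩ := exists_lt_offStrip hO'.isClosed_compl (a := δ) (b := 1 - δ) (by
    rintro p hp ht h0
    obtain ⟨x, hx, hx'⟩ := offStrip_eq_zero_iff.1 h0
    have hr : (x, p.2) ∈ rectangle := ⟨hx, by linarith [ht.1], by linarith [ht.2]⟩
    have e2 : p = incl (x, p.2) := Prod.ext hx' rfl
    have e3 := hφΘ _ hr ht
    rw [← e2] at e3
    refine hp ⟨e3.1, ?_⟩
    by_cases ht' : p.2 ∈ Icc (2 * δ) (1 - 2 * δ)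
    · right
      have hcyl := hmap hr
      rw [← e3.2] at hcyl
      refine ⟨⟨by linarith [hcyl.1], ?_⟩, ?_⟩
      · rw [abs_lt]
        constructor <;> linarith [hcyl.2.1, hcyl.2.2]
      · by_contra hcon
        rw [mem_union, not_or] at hcon
        have hMp : Θ p ∈ M := ⟨(x, p.2), ⟨hx, ht'⟩, congrArg Θ e2.symm⟩
        have := h1 _ ⟨hMp, hcon.2⟩ hcyl.2
        exact hcon.1 ((min_le_right _ _).trans_lt this)
    · exact Or.inl ht')
  refine ⟨σ₁, min σ₁ σ₃, d, ⟨lt_min hσ₁0 hσ₃, min_le_left _ _, hn, hδ, hδ1, hd, hd1⟩, ?_, ?_, ?_⟩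
  · intro p hp hw hpC
    have hdata : IsRingData σ₁ (min σ₁ σ₃) δ d :=
      ⟨lt_min hσ₁0 hσ₃, min_le_left _ _, hn, hδ, hδ1, hd, hd1⟩
    have hlt : offStrip p.1 < σ₁ / 2 := by
      by_contra! h
      exact hdU hp ⟨h, hpC⟩
    by_cases ht : p.2 ∈ Icc (0 : ℝ) 1
    · obtain ⟨q, hq, rfl⟩ := hCr p ⟨(hn _ (by linarith)).le, ht⟩ hpC
      have h4 : offStrip (incl q).1 = 0 := offStrip_eq_zero_iff.2 ⟨q.1, hq.1, rfl⟩
      have := hdata.width_pos (incl q).2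
      linarith
    · rw [hdata.width_eq_outer ht] at hw
      linarith
  · intro p hp ht
    by_contra hcon
    have := h3 p (fun h => hcon h.1) ht
    exact absurd (hp.trans (min_le_right _ _)) (not_le.2 this)
  · intro p hp ht
    have hmem : p ∈ O ∩ ({p | p.2 ∈ Icc (2 * δ) (1 - 2 * δ)}ᶜ ∪ Θ ⁻¹' N) := by
      by_contra hcon
      have := h3 p hcon ⟨by linarith [ht.1], by linarith [ht.2]⟩
      exact absurd (hp.trans (min_le_right _ _)) (not_le.2 this)
    have hpN : Θ p ∈ N := hmem.2.resolve_left (fun h => h ht)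
    exact ⟨⟨hpN.1.1.le, hpN.1.2.le⟩, fun h => hpN.2.resolve_left (not_lt.2 h)⟩

/-- The embedding that ties a knot into the standard band: it is defined on the complement of a
ring around the band, carries the band to its image under the tangle, and is the identity near all
points outside a small neighbourhood of the interior of the band. -/
theorem IsZeroFramedTangle.exists_tying_map {φ : ℝ × ℝ → ℂ × ℝ} {K : Set (E4 × E4)}
    (hφ : IsZeroFramedTangle φ K) {C : Set E4} (hC : IsClosed C)
    (hCr : ∀ p ∈ cylinder, closeUp p ∈ C → p ∈ incl '' rectangle) :
    ∃ (σ₁ σ₂ δ d : ℝ) (T : E4 → E4), IsRingData σ₁ σ₂ δ d ∧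
      (∀ p ∈ box (2 * d), width σ₁ σ₂ δ p.2 / 2 ≤ offStrip p.1 → closeUp p ∉ C) ∧
      SmoothEmb T (insert 0 (coneChart closeUp '' (univ ×ˢ ring σ₁ σ₂ δ d)))ᶜ ∧
      PosHom T ∧ (∀ x, ‖T x‖ = ‖x‖) ∧
      (∀ q ∈ rectangle, T (closeUp (incl q)) = closeUp (φ q)) ∧
      ∀ x, x ≠ 0 → x ∉ coneChart closeUp '' (univ ×ˢ strip σ₂ δ) → T =ᶠ[𝓝 x] fun y => y := by
  obtain ⟨δ, Θ, O, hδ, hδ1, hΘ, hφΘ, hΘid, hφid⟩ := hφ.exists_thickening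
  obtain ⟨σ₁, σ₂, d, hR, hCbox, hO, hmid⟩ :=
    exists_constants hφ.mapsTo hφ.injOn hC hCr hδ hδ1 hΘ hφΘ hφid
  classical
  set A : Set (ℂ × ℝ) := {p | offStrip p.1 < σ₂ ∧ p.2 ∈ Ioo δ (1 - δ)} with hA
  set κ : ℂ × ℝ → ℂ × ℝ := fun p => if p ∈ A then Θ p else p with hκ
  have hQc : Continuous fun p : ℂ × ℝ => offStrip p.1 :=
    contDiff_offStrip.continuous.comp continuous_fst
  have hAo : IsOpen A := (isOpen_lt hQc continuous_const).inter (isOpen_Ioo.preimage continuous_snd)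
  have hAO : A ⊆ O := fun p hp => hO p hp.1.le (Ioo_subset_Icc_self hp.2)
  have hAcyl : A ⊆ cylinder := fun p hp => ⟨(hR.norm_lt _ (hp.1.le.trans hR.le)).le,
    by linarith [hp.2.1, hR.posδ], by linarith [hp.2.2, hR.posδ]⟩
  have hcylbox : cylinder ⊆ box d := by
    rw [← box_zero]; exact box_mono hR.posd.le
  have hboxs : box d ⊆ slab := box_subset_slab (by linarith [hR.led])
  have hκA : ∀ p ∈ A, κ p = Θ p := fun p hp => if_pos hp
  have hκnA : ∀ p, p ∉ A → κ p = p := fun p hp => if_neg hp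
  have hκid : ∀ p, p ∉ A ∨ p.2 ∉ Icc (2 * δ) (1 - 2 * δ) → κ p = p := by
    intro p hp
    by_cases hpA : p ∈ A
    · rw [hκA p hpA]
      refine hΘid p (hAO hpA) ?_
      by_contra! h
      exact hp.elim (fun h => h hpA) fun h' => h' ⟨h.1, h.2⟩
    · exact hκnA p hpA
  have hκbox : ∀ p, p ∈ box d → κ p ∈ box d := by
    intro p hp
    by_cases h : p ∉ A ∨ p.2 ∉ Icc (2 * δ) (1 - 2 * δ)
    · rwa [hκid p h]
    · push Not at h
      rw [hκA p h.1]
      exact (hmid p h.1.1.le h.2).1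
  set W : Set (ℂ × ℝ) := slab \ ring σ₁ σ₂ δ d with hW
  have hring : ring σ₁ σ₂ δ d ⊆ box d := fun p hp => hp.1
  have hWo : IsOpen W := isOpen_slab.sdiff (isCompact_ring _ _ _ _).isClosed
  -- points of `W` in the middle part of the box belong to `A`
  have hWA : ∀ p ∈ W, p ∈ box d → p.2 ∈ Ioo δ (1 - δ) → p ∈ A := by
    intro p hp hb ht
    refine ⟨?_, ht⟩
    by_contra! h
    refine hp.2 ⟨hb, ?_⟩
    rwa [hR.width_eq_inner ht.1.le ht.2.le]
  have hκW : SmoothEmb κ W := by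
    refine ⟨hWo, ?_, ?_⟩
    · -- a moved point and a fixed point have different images
      have key : ∀ a ∈ A, ∀ b ∈ W, b ∉ A → κ a ≠ κ b := by
        intro a ha b hb hbA he
        rw [hκnA b hbA] at he
        by_cases h : a ∉ A ∨ a.2 ∉ Icc (2 * δ) (1 - 2 * δ)
        · rw [hκid a h] at he
          exact hbA (he ▸ ha)
        · push Not at h
          rw [hκA a ha] at he
          obtain ⟨h1, h2⟩ := hmid a ha.1.le h.2
          rw [he] at h1 h2
          refine hbA (hWA b hb h1 (h2 ?_))
          by_contra! h3
          exact hb.2 ⟨h1, (hR.width_le _).trans h3.le⟩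
      intro a ha b hb he
      by_cases haA : a ∈ A <;> by_cases hbA : b ∈ A
      · rw [hκA a haA, hκA b hbA] at he
        exact hΘ.injOn (hAO haA) (hAO hbA) he
      · exact absurd he (key a haA b hb hbA)
      · exact absurd he.symm (key b hbA a ha haA)
      · rwa [hκnA a haA, hκnA b hbA] at he
    · intro p hp
      by_cases hpA : p ∈ A
      · refine (hΘ.imm p (hAO hpA)).congr ?_
        filter_upwards [hAo.mem_nhds hpA] with q hq using hκA q hq
      · refine (immersionAt_id p).congr ?_
        by_cases hb : p ∈ box d
        · have ht : p.2 ∉ Icc (2 * δ) (1 - 2 * δ) := fun ht =>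
            hpA (hWA p hp hb ⟨by linarith [ht.1], by linarith [ht.2]⟩)
          filter_upwards [(isClosed_Icc.preimage continuous_snd).isOpen_compl.mem_nhds ht]
            with q hq using hκid q (Or.inr hq)
        · filter_upwards [(isCompact_box d).isClosed.isOpen_compl.mem_nhds hb] with q hq
          exact hκid q (Or.inl fun h => hq (hcylbox (hAcyl h)))
  have hid : ∀ p ∈ slab, p ∉ box d → p ∈ W ∧ κ p = p := fun p hp hb =>
    ⟨⟨hp, fun h => hb (hring h)⟩, hκnA p fun h => hb (hcylbox (hAcyl h))⟩
  have hκs : MapsTo κ slab slab := by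
    intro p hp
    by_cases hb : p ∈ box d
    · exact hboxs (hκbox p hb)
    · rwa [(hid p hp hb).2]
  have hKW : box d \ W = ring σ₁ σ₂ δ d := by
    ext p
    constructor
    · rintro ⟨h1, h2⟩
      by_contra h3
      exact h2 ⟨hboxs h1, h3⟩
    · exact fun h => ⟨hring h, fun h' => h'.2 h⟩
  have hemb := smoothEmb_coneTransfer isConeChart_closeUp (W := W) sdiff_subset (isCompact_box d) hboxs
    (hKW ▸ isCompact_ring _ _ _ _) (smoothEmb_prodMk hκW) hκs hid
    (fun p hp => hκbox p hp.2)
  rw [hKW] at hemb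
  refine ⟨σ₁, σ₂, δ, d, coneTransfer closeUp slab κ, hR, hCbox, hemb,
    posHom_coneTransfer isConeChart_closeUp, norm_coneTransfer isConeChart_closeUp hκs, ?_, ?_⟩
  · intro q hq
    rw [coneTransfer_apply isConeChart_closeUp κ (cylinder_subset_slab (incl_mem_cylinder hq))]
    congr 1
    have h0 : offStrip (incl q).1 = 0 := offStrip_eq_zero_iff.2 ⟨q.1, hq.1, rfl⟩
    by_cases h : q.2 ∈ Ioo δ (1 - δ)
    · rw [hκA _ ⟨by rw [h0]; exact hR.pos₂, h⟩]
      exact (hφΘ q hq (Ioo_subset_Icc_self h)).2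
    · rw [hκnA _ fun h' => h h'.2]
      refine (hφid q hq ?_).symm
      by_contra! h'
      exact h ⟨by linarith [h'.1], by linarith [h'.2]⟩
  · intro x hx hxs
    have hss : strip σ₂ δ ⊆ slab := fun p hp => cylinder_subset_slab hp.1
    have hcl := isClosed_cone isConeChart_closeUp (isCompact_strip σ₂ δ) hss
    have hx' : x ∉ insert 0 (coneChart closeUp '' (univ ×ˢ strip σ₂ δ)) := fun h =>
      h.elim hx hxs
    filter_upwards [hcl.isOpen_compl.mem_nhds hx'] with y hy
    refine coneTransfer_eq_self isConeChart_closeUp (K := strip σ₂ δ) (fun p _ hp => hκnA p fun h => hp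
      ⟨hAcyl h, h.1.le, Ioo_subset_Icc_self h.2⟩) fun h => hy (Or.inr h)

/-! ### Diffeomorphisms adapted to the tube around the dual circle -/

/-- The polar chart `(z, v) ↦ (z, |z| b(v))` of the complement of the circle `z = 0`. -/
def tubeChart (b : ℂ → ℂ) (p : ℂ × ℂ) : E4 := toE4 (p.1, ‖p.1‖ • b p.2)

theorem finrank_tube : Module.finrank ℝ (ℂ × ℂ) = Module.finrank ℝ E4 :=
  toE4L.toLinearEquiv.finrank_eq

theorem contDiffAt_norm {z : ℂ} (hz : z ≠ 0) : ContDiffAt ℝ ∞ (fun z : ℂ => ‖z‖) z :=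
  contDiffAt_id.norm ℝ hz

theorem isOpen_ne_zero_prod {V : Set ℂ} (hV : IsOpen V) : IsOpen (({0}ᶜ : Set ℂ) ×ˢ V) :=
  isOpen_compl_singleton.prod hV

theorem smoothEmb_tubeChart_id :
    SmoothEmb (tubeChart fun v => v) (({0}ᶜ : Set ℂ) ×ˢ (univ : Set ℂ)) := by
  refine SmoothEmb.of_leftInverse (isOpen_ne_zero_prod isOpen_univ)
    (g := fun x => ((toE4L.symm x).1, ‖(toE4L.symm x).1‖⁻¹ • (toE4L.symm x).2)) ?_ ?_ ?_
  · intro p hp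
    exact contDiff_toE4.contDiffAt.comp p (contDiffAt_fst.prodMk
      (((contDiffAt_norm hp.1).comp p contDiffAt_fst).smul contDiffAt_snd))
  · intro p hp
    have e : toE4L.symm (tubeChart (fun v => v) p) = (p.1, ‖p.1‖ • p.2) :=
      toE4L.symm_apply_apply _
    have h1 : DifferentiableAt ℝ (fun x => (toE4L.symm x).1) (tubeChart (fun v => v) p) :=
      toE4L.symm.differentiableAt.fst
    have h2 : DifferentiableAt ℝ (fun x => (toE4L.symm x).2) (tubeChart (fun v => v) p) :=
      toE4L.symm.differentiableAt.snd
    have h3 : (toE4L.symm (tubeChart (fun v => v) p)).1 ≠ 0 := by rw [e]; exact hp.1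
    have h4 : DifferentiableAt ℝ (fun x => ‖(toE4L.symm x).1‖) (tubeChart (fun v => v) p) :=
      DifferentiableAt.norm ℝ h1 h3
    exact h1.prodMk ((h4.inv (norm_ne_zero_iff.2 h3)).smul h2)
  · intro p hp
    have e : toE4L.symm (tubeChart (fun v => v) p) = (p.1, ‖p.1‖ • p.2) :=
      toE4L.symm_apply_apply _
    simp only [e]
    rw [smul_smul, inv_mul_cancel₀ (norm_ne_zero_iff.2 hp.1), one_smul]

theorem SmoothEmb.prodMk_left {b : ℂ → ℂ} {V : Set ℂ} (hb : SmoothEmb b V) {A : Set ℂ}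
    (hA : IsOpen A) : SmoothEmb (fun p : ℂ × ℂ => (p.1, b p.2)) (A ×ˢ V) := by
  refine ⟨hA.prod hb.isOpen, ?_, ?_⟩
  · intro p hp q hq h
    rw [Prod.mk.injEq] at h
    exact Prod.ext h.1 (hb.injOn hp.2 hq.2 h.2)
  · intro p hp
    have h1 := hb.imm p.2 hp.2
    refine ⟨contDiffAt_fst.prodMk (h1.smooth.comp p contDiffAt_snd), ?_⟩
    have h2 : HasFDerivAt (fun p : ℂ × ℂ => (p.1, b p.2)) _ p :=
      hasFDerivAt_fst.prodMk (h1.differentiableAt.hasFDerivAt.comp p hasFDerivAt_snd)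
    rw [h2.fderiv]
    intro v w h
    simp only [ContinuousLinearMap.prod_apply, ContinuousLinearMap.comp_apply,
      ContinuousLinearMap.coe_fst', ContinuousLinearMap.coe_snd', Prod.mk.injEq] at h
    exact Prod.ext h.1 (h1.inj h.2)

theorem smoothEmb_tubeChart {b : ℂ → ℂ} {V : Set ℂ} (hb : SmoothEmb b V) :
    SmoothEmb (tubeChart b) (({0}ᶜ : Set ℂ) ×ˢ V) :=
  smoothEmb_tubeChart_id.comp (hb.prodMk_left isOpen_compl_singleton) fun _ hp => ⟨hp.1, mem_univ _⟩

theorem tubeChart_smul (b : ℂ → ℂ) {r : ℝ} (hr : 0 < r) (z v : ℂ) :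
    tubeChart b (r • z, v) = r • tubeChart b (z, v) := by
  rw [tubeChart, tubeChart, ← toE4_smul]
  simp only [norm_smul, Real.norm_eq_abs, abs_of_pos hr, Prod.smul_mk, smul_smul]

theorem toE4_zero_ne_tubeChart (b : ℂ → ℂ) {p : ℂ × ℂ} (hp : p.1 ≠ 0) (w : ℂ) :
    toE4 (0, w) ≠ tubeChart b p := fun h =>
  hp (congrArg Prod.fst (toE4_injective h)).symm

/-- Shrinking the fibre coordinate of a polar chart towards `c` gives a diffeomorphism of the
sphere. -/
theorem exists_tube_shrink {b : ℂ → ℂ} {V K : Set ℂ} (hb : SmoothEmb b V) (hV : Convex ℝ V)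
    (hK : IsCompact K) (hKc : Convex ℝ K) (hKV : K ⊆ V) {c : ℂ} (hc : c ∈ K) {s : ℝ} (hs : 0 < s)
    (hs1 : s ≤ 1) {χ : ℂ × ℂ → ℝ} (h0 : ∀ p, 0 ≤ χ p) (h1 : ∀ p, χ p ≤ 1)
    (hχ : ∀ p : ℂ × ℂ, p.1 ≠ 0 → ContDiffAt ℝ ∞ χ p)
    (hanti : ∀ z : ℂ, z ≠ 0 → ∀ v, AntitoneOn (fun μ : ℝ => χ (z, c + μ • v)) (Ici 0))
    (hhom : ∀ r : ℝ, 0 < r → ∀ z v, χ (r • z, v) = χ (z, v))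
    (hsupp : ∀ z v, z ≠ 0 → v ∈ V → v ∉ K → χ (z, v) = 0) :
    ∃ h, IsOrientedConeDiffeo h ∧
      (∀ z v, z ≠ 0 → v ∈ V → ∃ r : ℝ, 0 < r ∧
        h (tubeChart b (z, v)) = r • tubeChart b (shrink c s χ (z, v))) ∧
      ∀ x, (∀ z v, z ≠ 0 → v ∈ V → x = tubeChart b (z, v) → χ (z, v) = 0) → h x = x := by
  set D : Set (ℂ × ℂ) := ({0}ᶜ : Set ℂ) ×ˢ V with hD
  set κ := shrink c s χ with hκ
  set T := transfer (tubeChart b) D κ with hT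
  have hg := smoothEmb_tubeChart hb
  have hseg : ∀ S : Set ℂ, Convex ℝ S → c ∈ S → ∀ p : ℂ × ℂ, p.2 ∈ S → (κ p).2 ∈ S := by
    intro S hS hcS p hp
    have e : (κ p).2 = c + (1 - (1 - s) * χ p) • (p.2 - c) := rfl
    rw [e]
    refine hS.add_smul_sub_mem hcS hp ⟨?_, ?_⟩
    · nlinarith [h0 p, h1 p]
    · nlinarith [h0 p, h1 p]
  have hκD : MapsTo κ D D := fun p hp => ⟨hp.1, hseg V hV (hKV hc) p hp.2⟩
  have hκK : MapsTo κ (({0}ᶜ : Set ℂ) ×ˢ K) (({0}ᶜ : Set ℂ) ×ˢ K) := fun p hp =>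
    ⟨hp.1, hseg K hKc hc p hp.2⟩
  have hKD : ({0}ᶜ : Set ℂ) ×ˢ K ⊆ D := prod_mono_right hKV
  have hid : ∀ p ∈ D, p ∉ ({0}ᶜ : Set ℂ) ×ˢ K → κ p = p := fun p hp hpK =>
    shrink_of_eq_zero (hsupp p.1 p.2 hp.1 hp.2 fun h => hpK ⟨hp.1, h⟩)
  have hemb : SmoothEmb κ D :=
    (smoothEmb_shrink hs hs1 h1 isOpen_compl_singleton (fun p hp => hχ p hp) hanti).mono
      hg.isOpen (prod_mono_right (subset_univ _))
  have hcl : IsClosed (insert 0 (tubeChart b '' (({0}ᶜ : Set ℂ) ×ˢ K))) := by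
    refine isClosed_insert_zero_cone (K := tubeChart b '' (Metric.sphere (0 : ℂ) 1 ×ˢ K)) ?_ ?_ ?_ ?_
    · refine ((isCompact_sphere _ _).prod hK).image_of_continuousOn (hg.continuousOn.mono ?_)
      rintro p ⟨hp1, hp2⟩
      exact ⟨ne_zero_of_mem_unit_sphere ⟨p.1, hp1⟩, hKV hp2⟩
    · rintro ⟨p, hp, h⟩
      refine toE4_zero_ne_tubeChart b (ne_zero_of_mem_unit_sphere ⟨p.1, hp.1⟩) 0 ?_
      rw [h]
      exact toE4L.map_zero
    · rintro _ ⟨p, hp, rfl⟩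
      refine ⟨‖p.1‖, norm_pos_iff.2 hp.1, _, ⟨(‖p.1‖⁻¹ • p.1, p.2), ⟨?_, hp.2⟩, rfl⟩, ?_⟩
      · have : ‖p.1‖ ≠ 0 := norm_ne_zero_iff.2 hp.1
        simp [this]
      · rw [tubeChart_smul b (inv_pos.2 (norm_pos_iff.2 hp.1)), smul_smul,
          mul_inv_cancel₀ (norm_ne_zero_iff.2 hp.1), one_smul]
    · rintro r hr _ ⟨p, hp, rfl⟩
      refine ⟨(r • p.1, p.2), ⟨?_, hp.2⟩, tubeChart_smul b hr _ _⟩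
      exact smul_ne_zero hr.ne' (ne_zero_of_mem_unit_sphere ⟨p.1, hp.1⟩)
  have hTemb : SmoothEmb T {0}ᶜ := by
    have hempty : ({0}ᶜ : Set ℂ) ×ˢ K \ D = ∅ := sdiff_eq_empty.2 hKD
    have := smoothEmb_transfer finrank_tube hg hKD hemb hκD (fun p hp h => ⟨hp, hid p hp h⟩)
      (fun p hp => hκK hp.2) hcl (by rw [hempty]; simp)
    rwa [hempty, image_empty, insert_empty_eq] at this
  have hκhom : ∀ r : ℝ, 0 < r → ∀ z v, κ (r • z, v) = (r • z, (κ (z, v)).2) := by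
    intro r hr z v
    simp only [hκ, shrink, hhom r hr]
  have hThom : PosHom T := fun r hr x => by
    refine transfer_smul hg.injOn (fun p hp r hr => ⟨(r • p.1, p.2), ⟨?_, hp.2⟩, ?_, ?_⟩) hr x
    · exact smul_ne_zero hr.ne' hp.1
    · exact tubeChart_smul b hr _ _
    · rw [hκhom r hr]
      exact tubeChart_smul b hr _ _
  have hTz : ∀ z v, z ≠ 0 → v ∈ V → T (tubeChart b (z, v)) = tubeChart b (κ (z, v)) :=
    fun z v hz hv => transfer_apply hg.injOn κ ⟨hz, hv⟩
  have hTid : ∀ x, x ∉ tubeChart b '' (({0}ᶜ : Set ℂ) ×ˢ K) → T x = x := fun x hx =>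
    transfer_eq_self hg.injOn hid hx
  have hT0 : ∀ x, x ≠ 0 → T x ≠ 0 := by
    intro x hx
    by_cases h : x ∈ tubeChart b '' (({0}ᶜ : Set ℂ) ×ˢ K)
    · obtain ⟨p, hp, rfl⟩ := h
      rw [hTz p.1 p.2 hp.1 (hKV hp.2)]
      intro h
      refine toE4_zero_ne_tubeChart b (p := κ p) (hκK hp).1 0 ?_
      rw [h]
      exact toE4L.map_zero
    · rwa [hTid x h]
  have hN := isConeDiffeo_normalize hTemb hThom hT0
  refine ⟨normalize T, ⟨hN, fun x hx => ?_⟩, ?_, ?_⟩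
  · have ha : toE4 (0, 1) ≠ 0 := by
      rw [← toE4L.map_zero, toE4L_apply]
      exact fun h => by simpa using toE4_injective h
    have hmem : toE4 (0, 1) ∈ (insert 0 (tubeChart b '' (({0}ᶜ : Set ℂ) ×ˢ K)))ᶜ := by
      rintro (h | ⟨p, hp, h⟩)
      · exact ha h
      · exact toE4_zero_ne_tubeChart b hp.1 1 h.symm
    have hev : normalize T =ᶠ[𝓝 (toE4 (0, 1))] fun y => y := by
      filter_upwards [hcl.isOpen_compl.mem_nhds hmem] with y hy
      have := hTid y fun h => hy (Or.inr h)
      rw [normalize_of_norm_eq (by rw [this]), this]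
    refine hN.det_pos ha ?_ hx
    rw [hev.fderiv_eq, fderiv_fun_id]
    simp [ContinuousLinearMap.det]
  · intro z v hz hv
    have hne : tubeChart b (z, v) ≠ 0 := fun h =>
      toE4_zero_ne_tubeChart b (p := (z, v)) hz 0 (by rw [h]; exact toE4L.map_zero)
    exact ⟨_, div_pos (norm_pos_iff.2 hne) (norm_pos_iff.2 (hT0 _ hne)), by
      rw [normalize, hTz z v hz hv]⟩
  · intro x hx
    have : T x = x := by
      by_cases h : x ∈ tubeChart b '' (({0}ᶜ : Set ℂ) ×ˢ K)
      · obtain ⟨p, hp, rfl⟩ := h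
        rw [hTz p.1 p.2 hp.1 (hKV hp.2)]
        congr 1
        exact shrink_of_eq_zero (hx _ _ hp.1 (hKV hp.2) rfl)
      · exact hTid x h
    rw [normalize_of_norm_eq (by rw [this]), this]

/-- A diffeomorphism that carries the tube `|w| ≤ |z|` around the dual circle to a thin tube
around the parallel circle `w = i|z|`. -/
theorem exists_tube_contraction {s : ℝ} (hs : 0 < s) (hs1 : s ≤ 1 / 4) :
    ∃ h, IsOrientedConeDiffeo h ∧
      (∀ z u : ℂ, z ≠ 0 → ‖u‖ ≤ 1 → ∃ r : ℝ, 0 < r ∧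
        h (toE4 (z, ‖z‖ • u)) = r • toE4 (z, ‖z‖ • (Complex.I + s • u))) ∧
      ∀ z w : ℂ, 2 * ‖z‖ ≤ ‖w‖ → h (toE4 (z, w)) = toE4 (z, w) := by
  have hab : ((3 / 2) ^ 2 : ℝ) < 2 ^ 2 := by norm_num
  have hs' : (1 - s) ≠ 0 := by linarith
  obtain ⟨c, hc⟩ : ∃ c : ℂ, c = (1 - s)⁻¹ • Complex.I := ⟨_, rfl⟩
  have hcn : ‖c‖ ≤ 4 / 3 := by
    rw [hc, norm_smul, Complex.norm_I, mul_one, Real.norm_eq_abs,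
      abs_of_pos (inv_pos.2 (by linarith)), inv_le_comm₀ (by linarith) (by norm_num)]
    linarith
  set χ : ℂ × ℂ → ℝ := fun p => stepDown ((3 / 2) ^ 2) (2 ^ 2) (‖p.2‖ ^ 2) with hχ
  have hid : SmoothEmb (fun v : ℂ => v) univ :=
    ⟨isOpen_univ, fun _ _ _ _ h => h, fun x _ => immersionAt_id x⟩
  obtain ⟨h, h1, h2, h3⟩ := exists_tube_shrink (K := Metric.closedBall (0 : ℂ) 2) hid convex_univ
    (isCompact_closedBall _ _) (convex_closedBall _ _) (subset_univ _) (c := c)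
    (by rw [mem_closedBall_zero_iff]; linarith) hs (by linarith) (χ := χ)
    (fun p => stepDown_nonneg _ _ _) (fun p => stepDown_le_one _ _ _)
    (fun p _ => ((contDiff_stepDown _ _).comp ((contDiff_norm_sq ℝ).comp contDiff_snd)).contDiffAt)
    (by
      intro z _ v μ hμ ν hν hle
      simp only [hχ]
      -- the norm is convex along the ray, and the cutoff is constant near its origin
      by_cases h : ‖c + μ • v‖ ≤ 3 / 2
      · rw [stepDown_eq_one (x := ‖c + μ • v‖ ^ 2) hab (pow_le_pow_left₀ (norm_nonneg _) h 2)]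
        exact stepDown_le_one _ _ _
      · push Not at h
        refine antitone_stepDown hab (pow_le_pow_left₀ (norm_nonneg _) ?_ 2)
        by_contra! hlt
        have hν0 : 0 < ν := by
          rcases (mem_Ici.1 hν).lt_or_eq with h | h
          · exact h
          · have : μ = ν := le_antisymm hle (h ▸ mem_Ici.1 hμ)
            rw [this] at hlt
            exact absurd hlt (lt_irrefl _)
        have e : c + μ • v = (1 - μ / ν) • c + (μ / ν) • (c + ν • v) := by
          rw [smul_add, smul_smul, div_mul_cancel₀ _ hν0.ne', ← add_assoc, ← add_smul]
          simp
        have hq0 : 0 ≤ μ / ν := div_nonneg hμ hν0.le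
        have hq1 : μ / ν ≤ 1 := (div_le_one hν0).2 hle
        have h4 : ‖c + μ • v‖ ≤ (1 - μ / ν) * ‖c‖ + μ / ν * ‖c + ν • v‖ := by
          calc _ = ‖(1 - μ / ν) • c + (μ / ν) • (c + ν • v)‖ := by rw [← e]
            _ ≤ _ := norm_add_le _ _
            _ = _ := by
              rw [norm_smul, norm_smul, Real.norm_of_nonneg hq0,
                Real.norm_of_nonneg (by linarith : 0 ≤ 1 - μ / ν)]
        rcases hq0.eq_or_lt with hq | hq
        · rw [← hq] at h4
          linarith
        · have h5 := mul_lt_mul_of_pos_left hlt hq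
          have h6 := mul_le_mul_of_nonneg_left (hcn.trans (by linarith : 4 / 3 ≤ ‖c + μ • v‖))
            (sub_nonneg.2 hq1)
          linarith)
    (fun r _ z v => rfl)
    (fun z v _ _ hv => stepDown_eq_zero hab (by
      rw [mem_closedBall_zero_iff, not_le] at hv
      exact pow_le_pow_left₀ (by norm_num) hv.le 2))
  refine ⟨h, h1, fun z u hz hu => ?_, fun z w hzw => ?_⟩
  · obtain ⟨r, hr, e⟩ := h2 z u hz (mem_univ _)
    refine ⟨r, hr, e.trans ?_⟩
    rw [shrink_of_eq_one (stepDown_eq_one hab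
      (pow_le_pow_left₀ (norm_nonneg _) (by linarith : ‖u‖ ≤ 3 / 2) 2))]
    have e2 : c + s • (u - c) = Complex.I + s • u := by
      have : c = s • c + Complex.I := by
        have h5 : (1 - s) • c = Complex.I := by rw [hc, smul_smul, mul_inv_cancel₀ hs', one_smul]
        rw [← h5, sub_smul, one_smul]
        abel
      rw [smul_sub]
      nth_rewrite 1 [this]
      abel
    simp only [tubeChart, e2]
  · refine h3 _ fun z' v hz' _ he => ?_
    have he' := toE4_injective he
    rw [Prod.mk.injEq] at he'
    obtain ⟨rfl, rfl⟩ := he'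
    refine stepDown_eq_zero hab (pow_le_pow_left₀ (by norm_num) ?_ 2)
    rw [norm_smul, norm_norm] at hzw
    have := norm_pos_iff.2 hz'
    nlinarith

/-! ### Contracting a ring -/

/-- The logarithmic fibre coordinate, centred at `i`, for the polar chart. -/
def expI (v : ℂ) : ℂ := Complex.I * Complex.exp v

theorem smoothEmb_expI : SmoothEmb expI {v | |v.im| < Real.pi} := by
  have ho : IsOpen {v : ℂ | |v.im| < Real.pi} :=
    isOpen_lt (continuous_abs.comp Complex.continuous_im) continuous_const
  have hlog : ∀ v : ℂ, |v.im| < Real.pi → Complex.log (Complex.exp v) = v := fun v hv =>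
    Complex.log_exp (abs_lt.1 hv).1 (abs_lt.1 hv).2.le
  have hdiv : ∀ v, expI v / Complex.I = Complex.exp v := fun v => by
    rw [expI, mul_div_cancel_left₀ _ Complex.I_ne_zero]
  refine SmoothEmb.of_leftInverse ho (g := fun w => Complex.log (w / Complex.I)) ?_ ?_ ?_
  · intro v _
    have : ContDiff ℝ ∞ (fun v : ℂ => Complex.exp v) := Complex.contDiff_exp
    exact (contDiff_const.mul this).contDiffAt
  · intro v hv
    have hs : expI v / Complex.I ∈ Complex.slitPlane := by
      rw [hdiv, Complex.mem_slitPlane_iff_arg]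
      refine ⟨?_, Complex.exp_ne_zero v⟩
      rw [← Complex.log_im, hlog v hv]
      exact (lt_of_abs_lt hv).ne
    have h1 : DifferentiableAt ℂ (fun w : ℂ => Complex.log (w / Complex.I)) (expI v) :=
      DifferentiableAt.clog (differentiableAt_id.div_const Complex.I) hs
    exact h1.restrictScalars ℝ
  · intro v hv
    simp only [hdiv]
    exact hlog v hv

/-- The point of the plane at which `closeUp` meets the ray through `tubeChart expI (z, v)`. -/
def polarPoint (z v : ℂ) : ℂ := (Real.exp (-v.re) / ‖z‖) • z

theorem norm_polarPoint {z : ℂ} (hz : z ≠ 0) (v : ℂ) : ‖polarPoint z v‖ = Real.exp (-v.re) := by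
  rw [polarPoint, norm_smul, norm_div, norm_norm, Real.norm_of_nonneg (Real.exp_pos _).le,
    div_mul_cancel₀ _ (norm_ne_zero_iff.2 hz)]

theorem tubeChart_expI_eq {z : ℂ} (hz : z ≠ 0) (v : ℂ) : ∃ r : ℝ, 0 < r ∧
    tubeChart expI (z, v) = r • closeUp (polarPoint z v, 1 / 2 + v.im / Real.pi) := by
  have hz' := norm_pos_iff.2 hz
  refine ⟨‖z‖ * Real.exp v.re * √(1 + ‖polarPoint z v‖ ^ 2), by
    have := sqrt_one_add_pos (polarPoint z v)
    positivity, ?_⟩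
  rw [closeUp, stdTorus, smul_smul, mul_assoc,
    mul_assoc, mul_inv_cancel₀ (sqrt_one_add_pos _).ne', mul_one, ← toE4_smul, tubeChart]
  congr 1
  simp only [Prod.smul_mk, Prod.mk.injEq]
  constructor
  · rw [polarPoint, smul_smul]
    have : ‖z‖ * Real.exp v.re * (Real.exp (-v.re) / ‖z‖) = 1 := by
      rw [Real.exp_neg]
      field_simp
    rw [this, one_smul]
  · rw [mul_smul]
    congr 1
    have h1 : ((Real.pi * (1 / 2 + v.im / Real.pi) : ℝ) : ℂ) * Complex.I =
        ((Real.pi / 2 : ℝ) : ℂ) * Complex.I + (v.im : ℂ) * Complex.I := by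
      have : Real.pi * (1 / 2 + v.im / Real.pi) = Real.pi / 2 + v.im := by
        field_simp
      rw [this]
      push_cast
      ring
    have h2 : Complex.exp (((Real.pi / 2 : ℝ) : ℂ) * Complex.I) = Complex.I := by
      push_cast
      exact Complex.exp_pi_div_two_mul_I
    rw [h1, Complex.exp_add, h2, expI, Complex.real_smul, Complex.ofReal_exp]
    nth_rewrite 1 [← Complex.re_add_im v]
    rw [Complex.exp_add]
    ring

theorem closeUp_eq_tubeChart {p : ℂ × ℝ} (hz : p.1 ≠ 0) : ∃ (v : ℂ) (r : ℝ), 0 < r ∧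
    v.re = -Real.log ‖p.1‖ ∧ v.im = Real.pi * (p.2 - 1 / 2) ∧
    (polarPoint p.1 v, 1 / 2 + v.im / Real.pi) = p ∧
    closeUp p = r • tubeChart expI (p.1, v) := by
  set v : ℂ := ⟨-Real.log ‖p.1‖, Real.pi * (p.2 - 1 / 2)⟩ with hv
  have e : (polarPoint p.1 v, 1 / 2 + v.im / Real.pi) = p := by
    refine Prod.ext ?_ ?_
    · simp only [polarPoint, hv, neg_neg, Real.exp_log (norm_pos_iff.2 hz)]
      rw [div_self (norm_ne_zero_iff.2 hz), one_smul]
    · simp only [hv]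
      have := Real.pi_ne_zero
      field_simp
      ring
  obtain ⟨r, hr, h⟩ := tubeChart_expI_eq hz v
  rw [e] at h
  exact ⟨v, r⁻¹, inv_pos.2 hr, rfl, rfl, e, by rw [h, inv_smul_smul₀ hr.ne']⟩

/-- The cutoff function, in logarithmic polar coordinates, that singles out a ring. -/
def ringCut (σ₁ σ₂ δ d : ℝ) (p : ℂ × ℂ) : ℝ :=
  boxCut d (polarPoint p.1 p.2, 1 / 2 + p.2.im / Real.pi) *
    (1 - stepDown (1 / 2) 1 (offStrip (polarPoint p.1 p.2) /
      width σ₁ σ₂ δ (1 / 2 + p.2.im / Real.pi)))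

section RingCut

variable {σ₁ σ₂ δ d : ℝ} (h : IsRingData σ₁ σ₂ δ d)

theorem ringCut_nonneg (p : ℂ × ℂ) : 0 ≤ ringCut σ₁ σ₂ δ d p :=
  mul_nonneg (boxCut_nonneg _ _) (sub_nonneg.2 (stepDown_le_one _ _ _))

theorem ringCut_le_one (p : ℂ × ℂ) : ringCut σ₁ σ₂ δ d p ≤ 1 :=
  mul_le_one₀ (boxCut_le_one _ _) (sub_nonneg.2 (stepDown_le_one _ _ _))
    (sub_le_self _ (stepDown_nonneg _ _ _))

theorem ringCut_smul {r : ℝ} (hr : 0 < r) (z v : ℂ) :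
    ringCut σ₁ σ₂ δ d (r • z, v) = ringCut σ₁ σ₂ δ d (z, v) := by
  have : polarPoint (r • z) v = polarPoint z v := by
    rw [polarPoint, polarPoint, norm_smul, Real.norm_of_nonneg hr.le, smul_smul]
    congr 1
    rw [div_mul_eq_mul_div, mul_comm r, mul_div_mul_right _ _ hr.ne']
  simp only [ringCut, this]

include h

theorem IsRingData.ringCut_eq_one {z v : ℂ}
    (hp : (polarPoint z v, 1 / 2 + v.im / Real.pi) ∈ ring σ₁ σ₂ δ d) :
    ringCut σ₁ σ₂ δ d (z, v) = 1 := by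
  have h1 := boxCut_eq_one h.posd hp.1
  have h2 := stepDown_eq_zero (by norm_num : (1 / 2 : ℝ) < 1)
    ((one_le_div (h.width_pos _)).2 hp.2)
  simp only [ringCut, h1, h2]
  norm_num

/-- Outside its support the cutoff vanishes. -/
theorem IsRingData.mem_of_ringCut_ne_zero {z v : ℂ} (hp : ringCut σ₁ σ₂ δ d (z, v) ≠ 0) :
    (polarPoint z v, 1 / 2 + v.im / Real.pi) ∈ box (2 * d) ∧
      width σ₁ σ₂ δ (1 / 2 + v.im / Real.pi) / 2 ≤ offStrip (polarPoint z v) := by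
  constructor
  · by_contra hc
    exact hp (by simp only [ringCut, boxCut_eq_zero h.posd hc, zero_mul])
  · by_contra! hc
    have hw := h.width_pos (1 / 2 + v.im / Real.pi)
    have := stepDown_eq_one (by norm_num : (1 / 2 : ℝ) < 1)
      ((div_le_iff₀ hw).2 (by linarith :
        offStrip (polarPoint z v) ≤ 1 / 2 * width σ₁ σ₂ δ (1 / 2 + v.im / Real.pi)))
    exact hp (by simp only [ringCut, this, sub_self, mul_zero])

theorem IsRingData.contDiffAt_ringCut {p : ℂ × ℂ} (hp : p.1 ≠ 0) :
    ContDiffAt ℝ ∞ (ringCut σ₁ σ₂ δ d) p := by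
  have hre : ContDiff ℝ ∞ fun p : ℂ × ℂ => p.2.re := Complex.reCLM.contDiff.comp contDiff_snd
  have him : ContDiff ℝ ∞ fun p : ℂ × ℂ => p.2.im := Complex.imCLM.contDiff.comp contDiff_snd
  have h1 : ContDiffAt ℝ ∞ (fun p : ℂ × ℂ => polarPoint p.1 p.2) p :=
    ((Real.contDiff_exp.comp hre.neg).contDiffAt.div
      ((contDiffAt_norm hp).comp p contDiffAt_fst) (norm_ne_zero_iff.2 hp)).smul contDiffAt_fst
  have h2 : ContDiffAt ℝ ∞ (fun p : ℂ × ℂ => 1 / 2 + p.2.im / Real.pi) p :=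
    (contDiff_const.add (him.div_const _)).contDiffAt
  refine ((contDiff_boxCut d).contDiffAt.comp p (h1.prodMk h2)).mul
    (contDiffAt_const.sub ((contDiff_stepDown _ _).contDiffAt.comp p ?_))
  exact (contDiff_offStrip.contDiffAt.comp p h1).div
    ((contDiff_width _ _ _).contDiffAt.comp p h2) (h.width_pos _).ne'

/-- The cutoff is monotone along the rays that emanate from the circle `w = i|z|`. -/
theorem IsRingData.antitoneOn_ringCut {z : ℂ} (hz : z ≠ 0) (v : ℂ) :
    AntitoneOn (fun μ : ℝ => ringCut σ₁ σ₂ δ d (z, 0 + μ • v)) (Ici 0) := by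
  intro μ hμ ν hν hle
  have hz' := norm_pos_iff.2 hz
  have hμ : 0 ≤ μ := hμ
  have hst : ∀ a b : ℝ, stepDown ((1 / 2 + d) ^ 2) ((1 / 2 + 2 * d) ^ 2) b ≤
      stepDown ((1 / 2 + d) ^ 2) ((1 / 2 + 2 * d) ^ 2) a ∨ b < a := fun a b => by
    rcases le_or_gt a b with hab | hab
    · exact Or.inl (antitone_stepDown (by nlinarith [h.posd]) hab)
    · exact Or.inr hab
  have ht : (1 / 2 + μ * v.im / Real.pi - 1 / 2) ^ 2 ≤ (1 / 2 + ν * v.im / Real.pi - 1 / 2) ^ 2 := by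
    rw [add_sub_cancel_left, add_sub_cancel_left, mul_div_assoc, mul_div_assoc, mul_pow, mul_pow]
    exact mul_le_mul_of_nonneg_right (pow_le_pow_left₀ hμ hle 2) (sq_nonneg _)
  have hst' := (hst _ _).resolve_right (not_lt.2 ht)
  have hab : (1 + d) ^ 2 < (1 + 2 * d) ^ 2 := by nlinarith [h.posd]
  have hp : ∀ μ : ℝ, polarPoint z (μ • v) = (Real.exp (-(μ * v.re)) / ‖z‖) • z := fun μ => by
    simp [polarPoint]
  have hn : ∀ μ : ℝ, ‖polarPoint z (μ • v)‖ = Real.exp (-(μ * v.re)) := fun μ => by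
    rw [norm_polarPoint hz]; simp
  have him : ∀ μ : ℝ, (μ • v).im = μ * v.im := fun μ => by simp
  simp only [zero_add, ringCut, boxCut, him]
  rcases le_total 0 v.re with hv | hv
  · -- the radius decreases along the ray
    have h1 : ∀ μ : ℝ, 0 ≤ μ →
        stepDown ((1 + d) ^ 2) ((1 + 2 * d) ^ 2) (‖polarPoint z (μ • v)‖ ^ 2) = 1 := by
      intro μ hμ
      refine stepDown_eq_one hab (pow_le_pow_left₀ (norm_nonneg _) ?_ 2)
      rw [hn]
      have : Real.exp (-(μ * v.re)) ≤ 1 := Real.exp_le_one_iff.2 (by nlinarith)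
      linarith [h.posd]
    rw [h1 μ hμ, h1 ν (hμ.trans hle), one_mul, one_mul]
    refine mul_le_mul hst' ?_ (sub_nonneg.2 (stepDown_le_one _ _ _)) (stepDown_nonneg _ _ _)
    refine sub_le_sub_left (antitone_stepDown (by norm_num) ?_) 1
    refine div_le_div₀ (offStrip_nonneg _) ?_ (h.width_pos _) ?_
    · rw [hp, hp]
      refine offStrip_smul_le z (by positivity) (div_le_div_of_nonneg_right ?_ hz'.le)
      exact Real.exp_le_exp.2 (by nlinarith)
    · unfold width
      have := antitone_stepDown h.lt_sq ht
      nlinarith [h.le]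
  · -- the radius increases along the ray
    have h1 : ∀ μ : ℝ, 0 ≤ μ → stepDown (1 / 2) 1 (offStrip (polarPoint z (μ • v)) /
        width σ₁ σ₂ δ (1 / 2 + μ * v.im / Real.pi)) = 0 := by
      intro μ hμ
      refine stepDown_eq_zero (by norm_num) ((one_le_div (h.width_pos _)).2 ?_)
      refine (h.width_le _).trans ?_
      by_contra! hc
      have := h.norm_lt _ hc.le
      rw [hn] at this
      have : (1 : ℝ) ≤ Real.exp (-(μ * v.re)) := Real.one_le_exp (by nlinarith)
      linarith
    rw [h1 μ hμ, h1 ν (hμ.trans hle), sub_zero, mul_one, mul_one]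
    refine mul_le_mul (antitone_stepDown hab (pow_le_pow_left₀ (norm_nonneg _) ?_ 2)) hst'
      (stepDown_nonneg _ _ _) (stepDown_nonneg _ _ _)
    rw [hn, hn]
    exact Real.exp_le_exp.2 (by nlinarith)

/-- A diffeomorphism, supported near a ring, that moves it into a thin tube around the circle
`w = i|z|`. -/
theorem IsRingData.exists_contraction {s : ℝ} (hs : 0 < s) :
    ∃ k, IsOrientedConeDiffeo k ∧
      (∀ p ∈ ring σ₁ σ₂ δ d, ∃ (r : ℝ) (z u : ℂ), 0 < r ∧ z ≠ 0 ∧ ‖u - Complex.I‖ < s ∧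
        k (closeUp p) = r • toE4 (z, ‖z‖ • u)) ∧
      (∀ x ∈ S3, (∀ p ∈ box (2 * d), width σ₁ σ₂ δ p.2 / 2 ≤ offStrip p.1 → x ≠ closeUp p) →
        k x = x) ∧
      ∀ z : ℂ, ‖z‖ = 1 → k (closeUp (z, 1 / 2)) = closeUp (z, 1 / 2) := by
  obtain ⟨η, hη, hηQ⟩ := Metric.continuousAt_iff.1
    (contDiff_offStrip.continuous.continuousAt (x := 0)) (σ₂ / 2) (half_pos h.pos₂)
  have h00 : offStrip 0 = 0 := offStrip_eq_zero_iff.2 ⟨0, by norm_num, by simp⟩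
  set R : ℝ := max 1 (-Real.log η) + 1 with hR
  have hR1 : 1 ≤ R := by linarith [le_max_left 1 (-Real.log η)]
  have hRη : Real.exp (-R) < η := by
    rw [← Real.lt_log_iff_exp_lt hη]
    linarith [le_max_right 1 (-Real.log η)]
  set Kv : Set ℂ := Icc (-R) R ×ℂ Icc (-(3 * Real.pi / 4)) (3 * Real.pi / 4) with hKv
  have hKc : IsCompact Kv := isCompact_Icc.reProdIm isCompact_Icc
  have hKconv : Convex ℝ Kv := ((convex_Icc _ _).linear_preimage Complex.reLm).inter
    ((convex_Icc _ _).linear_preimage Complex.imLm)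
  have hpi := Real.pi_pos
  have h0K : (0 : ℂ) ∈ Kv := ⟨⟨by simp; linarith, by simp; linarith⟩,
    ⟨by simp; positivity, by simp; positivity⟩⟩
  have hsupp : ∀ z v : ℂ, z ≠ 0 → ringCut σ₁ σ₂ δ d (z, v) ≠ 0 → v ∈ Kv := by
    intro z v hz hne
    obtain ⟨⟨hb1, hb2⟩, hw⟩ := h.mem_of_ringCut_ne_zero hne
    rw [norm_polarPoint hz] at hb1
    refine ⟨⟨?_, ?_⟩, ?_⟩
    · change -R ≤ v.re
      by_contra! hc
      have : Real.exp 1 < Real.exp (-v.re) := Real.exp_lt_exp.2 (by linarith)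
      have h1 := Real.add_one_le_exp (1 : ℝ)
      linarith [h.led]
    · change v.re ≤ R
      by_contra! hc
      have h1 : ‖polarPoint z v‖ < η := by
        rw [norm_polarPoint hz]
        exact (Real.exp_lt_exp.2 (by linarith)).trans hRη
      have h2 := hηQ (x := polarPoint z v) (by simpa using h1)
      rw [h00, Real.dist_0_eq_abs, abs_of_nonneg (offStrip_nonneg _)] at h2
      linarith [h.le_width (1 / 2 + v.im / Real.pi)]
    · change v.im ∈ Icc _ _
      refine abs_le.1 ?_
      simp only [add_sub_cancel_left, abs_div, abs_of_pos hpi] at hb2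
      rw [div_le_iff₀ hpi] at hb2
      nlinarith [h.led]
  obtain ⟨B, hB, hKB⟩ := hKc.isBounded.exists_pos_norm_le
  obtain ⟨η', hη', hexp⟩ := Metric.continuousAt_iff.1
    (Complex.continuous_exp.continuousAt (x := 0)) s hs
  set s₂ : ℝ := min 1 (η' / (2 * B)) with hs₂
  have hs₂0 : 0 < s₂ := lt_min one_pos (by positivity)
  have hKV : Kv ⊆ {v : ℂ | |v.im| < Real.pi} := fun v hv => by
    have : |v.im| ≤ 3 * Real.pi / 4 := abs_le.2 hv.2
    change |v.im| < Real.pi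
    linarith
  have hVconv : Convex ℝ {v : ℂ | |v.im| < Real.pi} := by
    have e : {v : ℂ | |v.im| < Real.pi} = Complex.imLm ⁻¹' Ioo (-Real.pi) Real.pi := by
      ext v; exact abs_lt (a := v.im) (b := Real.pi)
    rw [e]
    exact (convex_Ioo _ _).linear_preimage _
  obtain ⟨k, hk, hk1, hk2⟩ := exists_tube_shrink smoothEmb_expI hVconv hKc hKconv hKV h0K hs₂0
    (min_le_left _ _) (χ := ringCut σ₁ σ₂ δ d) ringCut_nonneg ringCut_le_one
    (fun p hp => h.contDiffAt_ringCut hp) (fun z hz v => h.antitoneOn_ringCut hz v)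
    (fun r hr z v => ringCut_smul hr z v)
    (fun z v hz _ hv => by_contra fun hc => hv (hsupp z v hz hc))
  refine ⟨k, hk, ?_, ?_, ?_⟩
  · intro p hp
    have hz : p.1 ≠ 0 := by
      intro hz
      have := hp.2
      rw [hz, h00] at this
      linarith [h.width_pos p.2]
    obtain ⟨v, r, hr, -, -, he, hc⟩ := closeUp_eq_tubeChart hz
    have h1 : ringCut σ₁ σ₂ δ d (p.1, v) = 1 := h.ringCut_eq_one (by rwa [he])
    have hv := hsupp p.1 v hz (by rw [h1]; exact one_ne_zero)
    obtain ⟨r', hr', e⟩ := hk1 p.1 v hz (hKV hv)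
    rw [shrink_of_eq_one h1] at e
    refine ⟨r * r', p.1, expI (0 + s₂ • (v - 0)), mul_pos hr hr', hz, ?_, ?_⟩
    · have h2 : dist (s₂ • v) 0 < η' := by
        rw [dist_zero_right, norm_smul, Real.norm_of_nonneg hs₂0.le]
        calc s₂ * ‖v‖ ≤ η' / (2 * B) * B :=
              mul_le_mul (min_le_right _ _) (hKB v hv) (norm_nonneg _) (by positivity)
          _ = η' / 2 := by field_simp
          _ < η' := by linarith
      have h3 := hexp h2
      rw [Complex.exp_zero, dist_eq_norm] at h3
      have h4 : expI (0 + s₂ • (v - 0)) - Complex.I =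
          Complex.I * (Complex.exp (s₂ • v) - 1) := by
        rw [expI, zero_add, sub_zero]
        ring
      rwa [h4, norm_mul, Complex.norm_I, one_mul]
    · rw [hc, hk.hom r hr, e, smul_smul]
      rfl
  · intro x hx hxp
    refine hk2 x fun z v hz hv he => ?_
    by_contra hne
    obtain ⟨hb, hw⟩ := h.mem_of_ringCut_ne_zero hne
    refine hxp _ hb hw ?_
    obtain ⟨r, hr, e⟩ := tubeChart_expI_eq hz v
    rw [e] at he
    have hn := congrArg norm he
    have hx1 : ‖x‖ = 1 := by simpa [S3] using hx
    rw [norm_smul, norm_closeUp, hx1, mul_one, Real.norm_of_nonneg hr.le] at hn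
    rw [he, ← hn, one_smul]
  · intro z hz
    have hz0 : z ≠ 0 := norm_ne_zero_iff.1 (by rw [hz]; exact one_ne_zero)
    obtain ⟨v, r, hr, hre, him, -, hc⟩ := closeUp_eq_tubeChart (p := (z, 1 / 2)) hz0
    have hv0 : v = 0 := Complex.ext (by simp [hre, hz]) (by simp [him])
    obtain ⟨r', hr', e⟩ := hk1 z v hz0 (by simpa [hv0] using hpi)
    have e2 : shrink 0 s₂ (ringCut σ₁ σ₂ δ d) (z, v) = (z, v) := by simp [shrink, hv0]
    rw [e2] at e
    have e3 : k (closeUp (z, 1 / 2)) = r' • closeUp (z, 1 / 2) := by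
      rw [hc, hk.hom r hr, e, smul_comm]
    have hn := congrArg norm e3
    rw [hk.norm, norm_smul, norm_closeUp, mul_one, Real.norm_of_nonneg hr'.le] at hn
    rw [e3, ← hn, one_smul]

end RingCut

/-! ### A solid torus that contains the surface -/

theorem closeUp_arg (z : ℂ) {u : ℂ} (hu : ‖u‖ = 1) :
    closeUp (z, Complex.arg u / Real.pi) = stdTorus (z, u) := by
  have h1 : Real.pi * (Complex.arg u / Real.pi) = Complex.arg u := by
    field_simp
  rw [closeUp]
  congr 2
  simp only [h1]
  have := Complex.norm_mul_exp_arg_mul_I u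
  rwa [hu, Complex.ofReal_one, one_mul] at this

theorem toE4L_symm_toE4 (p : ℂ × ℂ) : toE4L.symm (toE4 p) = p := toE4L.symm_apply_apply p

/-- The open cone over the solid torus of radius `2`. -/
def torusCone : Set E4 := {x | ‖(toE4L.symm x).1‖ < 2 * ‖(toE4L.symm x).2‖}

theorem isOpen_torusCone : IsOpen torusCone := isOpen_lt (by fun_prop) (by fun_prop)

theorem stdTorus_mem_torusCone {p : ℂ × ℂ} (hp : ‖p.1‖ < 2 * ‖p.2‖) : stdTorus p ∈ torusCone := by
  have hc := inv_pos.2 (sqrt_one_add_pos p.1)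
  rw [torusCone, mem_ofPred_eq, stdTorus, ← toE4_smul, toE4L_symm_toE4, Prod.smul_fst,
    Prod.smul_snd, norm_smul, norm_smul, Real.norm_of_nonneg hc.le]
  nlinarith

/-- On the circle bundle `w = i|z|` the polar chart meets the meridian of the cylinder. -/
theorem toE4_norm_smul_I {z : ℂ} (hz : z ≠ 0) : ∃ r : ℝ, 0 < r ∧
    toE4 (z, ‖z‖ • Complex.I) = r • closeUp (‖z‖⁻¹ • z, 1 / 2) := by
  obtain ⟨r, hr, h⟩ := tubeChart_expI_eq hz 0
  refine ⟨r, hr, ?_⟩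
  simpa [tubeChart, expI, polarPoint] using h

theorem exists_stdTorus_eq {a b : ℂ} (hn : ‖toE4 (a, b)‖ = 1) (hb : b ≠ 0) :
    stdTorus (‖b‖⁻¹ • a, ‖b‖⁻¹ • b) = toE4 (a, b) := by
  have hb' := norm_pos_iff.2 hb
  have h1 : ‖a‖ ^ 2 + ‖b‖ ^ 2 = 1 := by
    rw [← norm_toE4_sq (a, b), hn, one_pow]
  have h2 : stdTorus (‖b‖⁻¹ • a, ‖b‖⁻¹ • b) =
      ((√(1 + ‖‖b‖⁻¹ • a‖ ^ 2))⁻¹ * ‖b‖⁻¹) • toE4 (a, b) := by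
    rw [mul_smul, ← toE4_smul]
    rfl
  have h3 : (√(1 + ‖‖b‖⁻¹ • a‖ ^ 2)) = ‖b‖⁻¹ := by
    rw [Real.sqrt_eq_iff_mul_self_eq (by positivity) (by positivity), norm_smul, norm_inv,
      norm_norm]
    field_simp
    linarith
  rw [h2, h3, inv_inv, mul_inv_cancel₀ hb'.ne', one_smul]

/-- The unknotted solid torus that contains a given compact set `C` and avoids a ring. -/
theorem IsRingData.exists_tube {σ₁ σ₂ δ d : ℝ} (hR : IsRingData σ₁ σ₂ δ d) {C : Set E4}
    (hC : IsCompact C) (hCS : C ⊆ S3)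
    (hCr : ∀ p ∈ cylinder, closeUp p ∈ C → p ∈ incl '' rectangle)
    (hCbox : ∀ p ∈ box (2 * d), width σ₁ σ₂ δ p.2 / 2 ≤ offStrip p.1 → closeUp p ∉ C) :
    ∃ h, IsOrientedConeDiffeo h ∧
      (∀ z : ℂ, ‖z‖ = 1 → h (toE4 (z, 0)) = closeUp (z, 1 / 2)) ∧
      (∀ x ∈ C, ∃ p ∈ solidTorus, h (stdTorus p) = x) ∧
      (∀ x ∈ torusCone, h x ∉ insert 0 (coneChart closeUp '' (univ ×ˢ ring σ₁ σ₂ δ d))) ∧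
      ∀ x ∈ Icc (-1 / 2 : ℝ) (1 / 2), ∀ u : ℂ, ‖u‖ = 1 → h (stdTorus (x, u)) = stdTorus (x, u) := by
  have hCn : ∀ x ∈ C, ‖x‖ = 1 := fun x hx => by simpa [S3] using hCS hx
  have hreal : ∀ x ∈ Icc (-1 / 2 : ℝ) (1 / 2), ‖(x : ℂ)‖ ≤ 1 / 2 := fun x hx => by
    rw [Complex.norm_real, Real.norm_eq_abs]
    exact abs_le.2 ⟨by linarith [hx.1], hx.2⟩
  -- the set `C` stays away from the circle bundle `w = i|z|`
  obtain ⟨m, hm, hCm⟩ := exists_lt_of_isCompact hC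
    (f := fun x => ‖(toE4L.symm x).2 - ‖(toE4L.symm x).1‖ • Complex.I‖) (by fun_prop) (by
      intro x hx
      obtain ⟨⟨z, w⟩, rfl⟩ := exists_toE4 x
      have e : toE4L.symm (toE4 (z, w)) = (z, w) := toE4L.symm_apply_apply _
      simp only [e]
      rw [norm_pos_iff, sub_ne_zero]
      rintro rfl
      have hz : z ≠ 0 := by
        rintro rfl
        have h1 := hCn _ hx
        have h2 := norm_toE4_sq (0, ‖(0 : ℂ)‖ • Complex.I)
        rw [h1] at h2
        norm_num at h2
      obtain ⟨r, hr, h⟩ := toE4_norm_smul_I hz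
      have hn := congrArg norm h
      rw [hCn _ hx, norm_smul, norm_closeUp, mul_one, Real.norm_of_nonneg hr.le] at hn
      rw [← hn, one_smul] at h
      have hz1 : ‖‖z‖⁻¹ • z‖ = 1 := by
        rw [norm_smul, norm_inv, norm_norm, inv_mul_cancel₀ (norm_ne_zero_iff.2 hz)]
      rw [h] at hx
      obtain ⟨q, hq, hqe⟩ := hCr _ ⟨hz1.le, by norm_num⟩ hx
      have h3 := hreal q.1 hq.1
      have h4 : (q.1 : ℂ) = ‖z‖⁻¹ • z := congrArg Prod.fst hqe
      rw [h4, hz1] at h3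
      norm_num at h3)
  set s : ℝ := min (1 / 4) m with hs
  have hs0 : 0 < s := lt_min (by norm_num) hm
  obtain ⟨f, hf, hf1, hf2⟩ := exists_tube_contraction hs0 (min_le_left _ _)
  obtain ⟨k, hk, hk1, hk2, hk3⟩ := hR.exists_contraction (half_pos hs0)
  obtain ⟨g, hg, hgk, hkg⟩ := hk.exists_inverse
  refine ⟨fun x => g (f x), hg.comp hf, ?_, ?_, ?_, ?_⟩
  · intro z hz
    have hz0 : z ≠ 0 := norm_ne_zero_iff.1 (by rw [hz]; exact one_ne_zero)
    obtain ⟨r, hr, h1⟩ := hf1 z 0 hz0 (by simp)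
    obtain ⟨r', hr', h2⟩ := toE4_norm_smul_I hz0
    simp only [smul_zero, add_zero] at h1
    rw [h2, hz, inv_one, one_smul, smul_smul] at h1
    have hn := congrArg norm h1
    have h0 : ‖toE4 (z, 0)‖ = 1 := by
      have := norm_toE4_sq (z, 0)
      rw [hz] at this
      norm_num at this
      rcases this with h | h
      · exact h
      · linarith [norm_nonneg (toE4 (z, 0))]
    rw [hf.norm, h0, norm_smul, norm_closeUp, mul_one,
      Real.norm_of_nonneg (mul_pos hr hr').le] at hn
    rw [← hn, one_smul] at h1
    simp only [h1]
    rw [← hk3 z hz, hgk, hk3 z hz]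
  · intro x hx
    have hkx : k x = x := hk2 x (hCS hx) fun p hp hw he => hCbox p hp hw (he ▸ hx)
    obtain ⟨y, hy⟩ := hf.bijective.surjective x
    have hgf : g (f y) = x := by rw [hy, ← hkx, hgk, hkx]
    have hyn : ‖y‖ = 1 := by rw [← hf.norm y, hy, hCn x hx]
    obtain ⟨⟨a, b⟩, rfl⟩ := exists_toE4 y
    have hab : ‖a‖ ≤ ‖b‖ := by
      by_contra! hlt
      have ha : 0 < ‖a‖ := (norm_nonneg b).trans_lt hlt
      have hu : ‖‖a‖⁻¹ • b‖ ≤ 1 := by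
        rw [norm_smul, norm_inv, norm_norm, inv_mul_le_one₀ ha]
        exact hlt.le
      obtain ⟨r, hr, h1⟩ := hf1 a (‖a‖⁻¹ • b) (norm_pos_iff.1 ha) hu
      rw [smul_inv_smul₀ ha.ne', hy, ← toE4_smul] at h1
      have h2 := hCm x hx
      have e : toE4L.symm x = r • (a, ‖a‖ • (Complex.I + s • ‖a‖⁻¹ • b)) := by
        rw [h1]; exact toE4L.symm_apply_apply _
      have e1 : (toE4L.symm x).1 = r • a := by rw [e]; rfl
      have e2 : (toE4L.symm x).2 = r • ‖a‖ • (Complex.I + s • ‖a‖⁻¹ • b) := by rw [e]; rfl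
      simp only [e1, e2, norm_smul r a, Real.norm_of_nonneg hr.le] at h2
      rw [smul_smul r, ← smul_sub, add_sub_cancel_left, norm_smul, norm_smul s,
        Real.norm_of_nonneg (by positivity : 0 ≤ r * ‖a‖), Real.norm_of_nonneg hs0.le] at h2
      have h3 : r * ‖a‖ ≤ 1 := by
        have h4 := norm_toE4_sq (r • (a, ‖a‖ • (Complex.I + s • ‖a‖⁻¹ • b)))
        rw [← h1, hCn x hx] at h4
        have h5 : ‖(r • (a, ‖a‖ • (Complex.I + s • ‖a‖⁻¹ • b))).1‖ = r * ‖a‖ := by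
          rw [Prod.smul_fst, norm_smul, Real.norm_of_nonneg hr.le]
        rw [h5] at h4
        nlinarith [sq_nonneg ‖(r • (a, ‖a‖ • (Complex.I + s • ‖a‖⁻¹ • b))).2‖]
      have h6 : s * ‖‖a‖⁻¹ • b‖ ≤ m * 1 :=
        mul_le_mul (min_le_right _ _) hu (norm_nonneg _) hm.le
      have h7 : r * ‖a‖ * (s * ‖‖a‖⁻¹ • b‖) ≤ 1 * (m * 1) :=
        mul_le_mul h3 h6 (by positivity) zero_le_one
      linarith
    have hb : b ≠ 0 := by
      rintro rfl
      have ha : a = 0 := by simpa using hab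
      have := norm_toE4_sq (a, 0)
      rw [hyn, ha] at this
      norm_num at this
    have hb' := norm_pos_iff.2 hb
    refine ⟨(‖b‖⁻¹ • a, ‖b‖⁻¹ • b), ⟨?_, ?_⟩, ?_⟩
    · simp only [norm_smul, norm_inv, norm_norm]
      exact (inv_mul_le_one₀ hb').2 hab
    · simp only [norm_smul, norm_inv, norm_norm]
      exact inv_mul_cancel₀ hb'.ne'
    · simp only [exists_stdTorus_eq hyn hb, hgf]
  · intro x hp hmem
    obtain ⟨⟨ζ, w⟩, rfl⟩ := exists_toE4 x
    simp only [torusCone, mem_ofPred_eq, toE4L_symm_toE4] at hp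
    have hw : 0 < ‖w‖ := by linarith [norm_nonneg ζ]
    rcases hmem with h0 | hmem
    · refine hg.ne_zero (hf.ne_zero fun h => ?_) h0
      have := norm_toE4_sq (ζ, w)
      rw [h, norm_zero] at this
      nlinarith [sq_nonneg ‖ζ‖]
    · obtain ⟨r, hr, q, hq, he⟩ := exists_of_mem_image_coneChart hmem
      obtain ⟨r₁, z, u, hr₁, hz, hu, hku⟩ := hk1 q hq
      have h1 : f (toE4 (ζ, w)) = (r * r₁) • toE4 (z, ‖z‖ • u) := by
        have he' : g (f (toE4 (ζ, w))) = r • closeUp q := he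
        rw [← hkg (f (toE4 (ζ, w))), he', hk.hom r hr, hku, smul_smul]
      set v : ℂ := s⁻¹ • (u - Complex.I)
      have hv : ‖v‖ < 1 / 2 := by
        rw [norm_smul, norm_inv, Real.norm_of_nonneg hs0.le, inv_mul_lt_iff₀ hs0]
        linarith
      obtain ⟨r₂, hr₂, h2⟩ := hf1 z v hz (by linarith)
      have e : Complex.I + s • v = u := by
        rw [smul_inv_smul₀ hs0.ne']; ring
      rw [e] at h2
      have hρ : 0 < r * r₁ / r₂ := by positivity
      have h3 : f (toE4 (ζ, w)) = f ((r * r₁ / r₂) • toE4 (z, ‖z‖ • v)) := by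
        rw [h1, hf.hom _ hρ, h2, smul_smul, div_mul_cancel₀ _ hr₂.ne']
      have h4 := hf.bijective.injective h3
      rw [← toE4_smul] at h4
      have h5 := toE4_injective h4
      rw [Prod.smul_mk, Prod.mk.injEq] at h5
      have hz' := mul_pos hρ (norm_pos_iff.2 hz)
      rw [h5.1, h5.2, norm_smul, norm_smul, norm_smul, norm_norm, Real.norm_of_nonneg hρ.le] at hp
      nlinarith
  · intro x hx u hu
    have h1 : f (stdTorus (x, u)) = stdTorus (x, u) := by
      rw [stdTorus, hf.hom _ (inv_pos.2 (sqrt_one_add_pos _)), hf2 x u ?_]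
      rw [hu]
      linarith [hreal x hx]
    have h2 : k (stdTorus (x, u)) = stdTorus (x, u) := by
      refine hk2 _ (by simpa [S3] using norm_stdTorus (p := ((x : ℂ), u)) hu) fun p hp hw he => ?_
      rw [← closeUp_arg _ hu, closeUp_eq_iff] at he
      rw [← he.1, offStrip_eq_zero_iff.2 ⟨x, hx, rfl⟩] at hw
      linarith [hR.width_pos p.2]
    simp only [h1]
    nth_rewrite 1 [← h2]
    rw [hgk]

/-! ### The linking number of the boundary strands and the framing -/

/-- Algebraic linking number zero is preserved by continuous maps between the complements. -/
theorem LinkingNumberZero.map {γ δ γ' δ' : Circle → E4} (H : LinkingNumberZero γ δ) {g : E4 → E4}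
    (hg : ContinuousOn g S3) (hgS : MapsTo g S3 S3) (hδ : ∀ x ∈ S3, g x ∈ range δ' → x ∈ range δ)
    (hγ : ∀ u, g (γ u) = γ' u) : LinkingNumberZero γ' δ' := by
  obtain ⟨f, hf, h0⟩ := H
  let G : C(↥(S3 \ range δ), ↥(S3 \ range δ')) :=
    ⟨fun x => ⟨g x, hgS x.2.1, fun h => x.2.2 (hδ _ x.2.1 h)⟩,
      ((hg.mono sdiff_subset).domRestrict).subtype_mk _⟩
  refine ⟨G.comp f, fun u => ?_, ?_⟩
  · change g (f u) = γ' u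
    rw [hf, hγ]
  · rw [TopCat.ofHom_comp, CategoryTheory.Functor.map_comp, h0, CategoryTheory.Limits.zero_comp]

/-- A self-map of the disc of radius `3/2` that is the identity on the boundary circle, carries
`-1/2` to `1`, and takes the value `0` at `1/2` only: a displacement of `1/2` to the centre followed
by a twist. -/
def discTwist (ζ : ℂ) : ℂ :=
  (ζ - ((3 / 2 - ‖ζ‖) / 2 : ℝ)) *
    Complex.exp ((Real.pi * (3 - 2 * ‖ζ - ((3 / 2 - ‖ζ‖) / 2 : ℝ)‖) : ℝ) * Complex.I)

theorem continuous_discTwist : Continuous discTwist := by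
  unfold discTwist
  fun_prop

theorem norm_discTwist (ζ : ℂ) : ‖discTwist ζ‖ = ‖ζ - ((3 / 2 - ‖ζ‖) / 2 : ℝ)‖ := by
  rw [discTwist, norm_mul, Complex.norm_exp_ofReal_mul_I, mul_one]

theorem norm_discTwist_le {ζ : ℂ} (h : ‖ζ‖ ≤ 3 / 2) : ‖discTwist ζ‖ ≤ 3 / 2 := by
  rw [norm_discTwist]
  refine (norm_sub_le _ _).trans ?_
  rw [Complex.norm_real, Real.norm_of_nonneg (by linarith)]
  linarith

theorem discTwist_of_norm_eq {ζ : ℂ} (h : ‖ζ‖ = 3 / 2) : discTwist ζ = ζ := by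
  simp only [discTwist, h, sub_self, zero_div, Complex.ofReal_zero, sub_zero]
  norm_num

theorem discTwist_eq_zero {ζ : ℂ} (h : ‖ζ‖ ≤ 3 / 2) (h0 : discTwist ζ = 0) :
    ζ = ((1 / 2 : ℝ) : ℂ) := by
  have h1 := norm_discTwist ζ
  rw [h0, norm_zero, eq_comm, norm_eq_zero, sub_eq_zero] at h1
  have h2 := congrArg norm h1
  rw [Complex.norm_real, Real.norm_of_nonneg (by linarith)] at h2
  have h3 : ‖ζ‖ = 1 / 2 := by linarith
  rw [h1, h3]
  norm_num

theorem discTwist_neg_half : discTwist ((-1 / 2 : ℝ) : ℂ) = 1 := by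
  have h1 : ‖((-1 / 2 : ℝ) : ℂ)‖ = 1 / 2 := by
    rw [Complex.norm_real]; norm_num
  have h2 : ((-1 / 2 : ℝ) : ℂ) - (((3 / 2 - 1 / 2) / 2 : ℝ) : ℂ) = -1 := by push_cast; norm_num
  simp only [discTwist, h1, h2, norm_neg, norm_one]
  norm_num

open Classical in
/-- The self-map of the three-sphere that performs `discTwist` on each fibre of a solid torus. -/
def torusTwist (x : E4) : E4 :=
  if ‖(toE4L.symm x).1‖ ≤ 3 / 2 * ‖(toE4L.symm x).2‖ then
    stdTorus (discTwist (‖(toE4L.symm x).2‖⁻¹ • (toE4L.symm x).1),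
      ‖(toE4L.symm x).2‖⁻¹ • (toE4L.symm x).2)
  else x

theorem torusTwist_toE4 {z w : ℂ} (h : ‖z‖ ≤ 3 / 2 * ‖w‖) :
    torusTwist (toE4 (z, w)) = stdTorus (discTwist (‖w‖⁻¹ • z), ‖w‖⁻¹ • w) := by
  rw [torusTwist, toE4L_symm_toE4, if_pos h]

theorem torusTwist_of_lt {z w : ℂ} (h : 3 / 2 * ‖w‖ < ‖z‖) :
    torusTwist (toE4 (z, w)) = toE4 (z, w) := by
  rw [torusTwist, toE4L_symm_toE4, if_neg (not_le.2 h)]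

theorem torusTwist_stdTorus {ζ u : ℂ} (h : ‖ζ‖ ≤ 3 / 2) (hu : ‖u‖ = 1) :
    torusTwist (stdTorus (ζ, u)) = stdTorus (discTwist ζ, u) := by
  have hc := inv_pos.2 (sqrt_one_add_pos ζ)
  have e : stdTorus (ζ, u) = toE4 ((√(1 + ‖ζ‖ ^ 2))⁻¹ • ζ, (√(1 + ‖ζ‖ ^ 2))⁻¹ • u) := by
    rw [stdTorus, ← toE4_smul]; rfl
  rw [e, torusTwist_toE4]
  · rw [norm_smul, hu, mul_one, Real.norm_of_nonneg hc.le, inv_smul_smul₀ hc.ne',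
      inv_smul_smul₀ hc.ne']
  · rw [norm_smul, norm_smul, hu, mul_one, Real.norm_of_nonneg hc.le]
    nlinarith

theorem exists_eq_stdTorus {x : E4} (hx : x ∈ S3) {z w : ℂ} (he : x = toE4 (z, w)) {r : ℝ}
    (h : ‖z‖ ≤ r * ‖w‖) : ∃ ζ u : ℂ, ‖ζ‖ ≤ r ∧ ‖u‖ = 1 ∧ x = stdTorus (ζ, u) := by
  have hn : ‖toE4 (z, w)‖ = 1 := by rw [← he]; simpa [S3] using hx
  have hw : w ≠ 0 := by
    rintro rfl
    have hz : z = 0 := by simpa using h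
    have := norm_toE4_sq (z, 0)
    rw [hn, hz] at this
    norm_num at this
  have hw' := norm_pos_iff.2 hw
  refine ⟨_, _, ?_, ?_, he.trans (exists_stdTorus_eq hn hw).symm⟩
  · rw [norm_smul, norm_inv, norm_norm, inv_mul_le_iff₀ hw', mul_comm]
    exact h
  · rw [norm_smul, norm_inv, norm_norm, inv_mul_cancel₀ hw'.ne']

theorem stdTorus_mem_S3 {p : ℂ × ℂ} (hp : ‖p.2‖ = 1) : stdTorus p ∈ S3 := by
  simpa [S3] using norm_stdTorus hp

theorem mapsTo_torusTwist : MapsTo torusTwist S3 S3 := by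
  intro x hx
  obtain ⟨⟨z, w⟩, rfl⟩ := exists_toE4 x
  rcases le_or_gt ‖z‖ (3 / 2 * ‖w‖) with h | h
  · obtain ⟨ζ, u, hζ, hu, e⟩ := exists_eq_stdTorus hx rfl h
    rw [e, torusTwist_stdTorus hζ hu]
    exact stdTorus_mem_S3 hu
  · rwa [torusTwist_of_lt h]

theorem continuousOn_torusTwist : ContinuousOn torusTwist S3 := by
  have hc1 : Continuous fun x : E4 => ‖(toE4L.symm x).1‖ := by fun_prop
  have hc2 : Continuous fun x : E4 => 3 / 2 * ‖(toE4L.symm x).2‖ := by fun_prop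
  have hS : S3 = (S3 ∩ {x | ‖(toE4L.symm x).1‖ ≤ 3 / 2 * ‖(toE4L.symm x).2‖}) ∪
      (S3 ∩ {x | 3 / 2 * ‖(toE4L.symm x).2‖ ≤ ‖(toE4L.symm x).1‖}) := by
    rw [← inter_union_distrib_left, eq_comm, inter_eq_left]
    exact fun x _ => le_total ‖(toE4L.symm x).1‖ (3 / 2 * ‖(toE4L.symm x).2‖)
  have hcl : IsClosed S3 := Metric.isClosed_sphere
  rw [hS]
  refine ContinuousOn.union_of_isClosed ?_ ?_ (hcl.inter (isClosed_le hc1 hc2))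
    (hcl.inter (isClosed_le hc2 hc1))
  · have : ContinuousOn (fun x : E4 => stdTorus
        (discTwist (‖(toE4L.symm x).2‖⁻¹ • (toE4L.symm x).1),
          ‖(toE4L.symm x).2‖⁻¹ • (toE4L.symm x).2))
        (S3 ∩ {x | ‖(toE4L.symm x).1‖ ≤ 3 / 2 * ‖(toE4L.symm x).2‖}) := by
      have hne : ∀ x ∈ S3 ∩ {x | ‖(toE4L.symm x).1‖ ≤ 3 / 2 * ‖(toE4L.symm x).2‖},
          ‖(toE4L.symm x).2‖ ≠ 0 := by
        rintro x ⟨hx, hle⟩ h0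
        obtain ⟨⟨z, w⟩, rfl⟩ := exists_toE4 x
        simp only [mem_ofPred_eq, toE4L_symm_toE4] at hle
        obtain ⟨ζ, u, -, hu, e⟩ := exists_eq_stdTorus hx rfl hle
        rw [e] at h0
        rw [stdTorus, ← toE4_smul, toE4L_symm_toE4, Prod.smul_snd, norm_smul, hu, mul_one,
          norm_inv, inv_eq_zero, norm_eq_zero] at h0
        exact (sqrt_one_add_pos ζ).ne' h0
      have hi : ContinuousOn (fun x : E4 => ‖(toE4L.symm x).2‖⁻¹)
          (S3 ∩ {x | ‖(toE4L.symm x).1‖ ≤ 3 / 2 * ‖(toE4L.symm x).2‖}) :=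
        ContinuousOn.inv₀ (by fun_prop) hne
      refine contDiff_stdTorus.continuous.comp_continuousOn
        ((continuous_discTwist.comp_continuousOn (hi.smul (by fun_prop))).prodMk
          (hi.smul (by fun_prop)))
    refine this.congr fun x hx => ?_
    have h2 := hx.2
    rw [mem_ofPred_eq] at h2
    exact if_pos h2
  · refine continuousOn_id.congr fun x hx => ?_
    obtain ⟨⟨z, w⟩, rfl⟩ := exists_toE4 x
    have h2 := hx.2
    simp only [mem_ofPred_eq, toE4L_symm_toE4] at h2
    rcases h2.lt_or_eq with h | h
    · exact torusTwist_of_lt h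
    · obtain ⟨ζ, u, hζ, hu, e⟩ := exists_eq_stdTorus hx.1 rfl h.ge
      have hζ' : ‖ζ‖ = 3 / 2 := by
        have e' := e
        rw [stdTorus, ← toE4_smul] at e'
        have e2 := toE4_injective e'
        rw [Prod.smul_mk, Prod.mk.injEq] at e2
        rw [e2.1, e2.2] at h
        have hc := inv_pos.2 (sqrt_one_add_pos ζ)
        simp only at h
        rw [norm_smul, norm_smul, hu, mul_one, mul_comm] at h
        have := mul_left_cancel₀ (norm_ne_zero_iff.2 hc.ne') h
        exact this.symm
      rw [e, torusTwist_stdTorus hζ hu, discTwist_of_norm_eq hζ']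
      rfl

/-- If the strands over `-1/2` and `1/2` of an embedded solid torus have linking number zero, then
so have the strands over `1` and `0`. -/
theorem linkingNumberZero_of_strands {F : E4 → E4} (hF : SmoothEmb F torusCone)
    (hn : ∀ x, ‖F x‖ = ‖x‖) {γ δ : Circle → E4}
    (hγ : ∀ u : Circle, γ u = F (stdTorus (((-1 / 2 : ℝ) : ℂ), (u : ℂ))))
    (hδ : ∀ u : Circle, δ u = F (stdTorus (((1 / 2 : ℝ) : ℂ), (u : ℂ))))
    (H : LinkingNumberZero γ δ) {k : E4 → E4} (hk : IsConeDiffeo k) :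
    LinkingNumberZero (fun u => k (F (stdTorus (1, (u : ℂ)))))
      (fun u => k (F (stdTorus (0, (u : ℂ))))) := by
  have hu : ∀ u : Circle, ‖(u : ℂ)‖ = 1 := Circle.norm_coe
  have hFS : ∀ x, F x ∈ S3 ↔ x ∈ S3 := fun x => by simp [S3, hn]
  have hcone : ∀ y ∈ S3, y ∈ torusCone → torusTwist y ∈ torusCone := by
    intro y hy hyc
    obtain ⟨⟨z, w⟩, rfl⟩ := exists_toE4 y
    rcases le_or_gt ‖z‖ (3 / 2 * ‖w‖) with h | h
    · obtain ⟨ζ, u, hζ, hu, e⟩ := exists_eq_stdTorus hy rfl h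
      rw [e, torusTwist_stdTorus hζ hu]
      refine stdTorus_mem_torusCone ?_
      have := norm_discTwist_le hζ
      simp only [hu]
      linarith
    · rwa [torusTwist_of_lt h]
  have hT : ∀ y ∈ torusCone, transfer F torusCone torusTwist (F y) = F (torusTwist y) :=
    fun y hy => transfer_apply hF.injOn _ hy
  -- the closed solid torus outside which the map is the identity
  set A : Set E4 := S3 ∩ {x | ‖(toE4L.symm x).1‖ ≤ 3 / 2 * ‖(toE4L.symm x).2‖} with hA
  have hAc : IsCompact A := (isCompact_sphere (0 : E4) 1).inter_right
    (isClosed_le (by fun_prop) (by fun_prop))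
  have hAcone : A ⊆ torusCone := by
    rintro x ⟨hx, hle⟩
    obtain ⟨⟨z, w⟩, rfl⟩ := exists_toE4 x
    simp only [mem_ofPred_eq, toE4L_symm_toE4] at hle
    obtain ⟨ζ, u, hζ, hu, e⟩ := exists_eq_stdTorus hx rfl hle
    rw [e]
    exact stdTorus_mem_torusCone (by simp only [hu]; linarith)
  have hFA : IsClosed (F '' A) :=
    (hAc.image_of_continuousOn (hF.continuousOn.mono hAcone)).isClosed
  have hoff : ∀ x ∈ S3, x ∉ F '' A → transfer F torusCone torusTwist x = x := by
    intro x hx hxA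
    by_cases hxc : x ∈ F '' torusCone
    · obtain ⟨y, hy, rfl⟩ := hxc
      rw [hT y hy]
      congr 1
      have hyS := (hFS y).1 hx
      obtain ⟨⟨z, w⟩, rfl⟩ := exists_toE4 y
      refine torusTwist_of_lt ?_
      by_contra! h
      exact hxA ⟨_, ⟨hyS, by rw [mem_ofPred_eq, toE4L_symm_toE4]; exact h⟩, rfl⟩
    · rw [transfer, if_neg hxc]
  have hTS : MapsTo (transfer F torusCone torusTwist) S3 S3 := by
    intro x hx
    by_cases hxA : x ∈ F '' A
    · obtain ⟨y, hy, rfl⟩ := hxA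
      rw [hT y (hAcone hy), hFS]
      exact mapsTo_torusTwist hy.1
    · rwa [hoff x hx hxA]
  have hTc : ContinuousOn (transfer F torusCone torusTwist) S3 := by
    intro x hx
    by_cases hxA : x ∈ F '' A
    · have hVo : IsOpen (F '' torusCone) := hF.isOpen_image rfl hF.isOpen Subset.rfl
      have hxV : x ∈ F '' torusCone := image_mono hAcone hxA
      have hinv := (hF.inv rfl).continuousOn
      have hmaps : MapsTo (invFunOn F torusCone) (S3 ∩ F '' torusCone) (S3 ∩ torusCone) := by
        rintro _ ⟨hy, y, hyc, rfl⟩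
        rw [hF.injOn.leftInvOn_invFunOn hyc]
        exact ⟨(hFS y).1 hy, hyc⟩
      have h1 : ContinuousOn (fun x => F (torusTwist (invFunOn F torusCone x)))
          (S3 ∩ F '' torusCone) :=
        hF.continuousOn.comp ((continuousOn_torusTwist.mono inter_subset_left).comp
          (hinv.mono inter_subset_right) hmaps)
          (fun y hy => hcone _ (hmaps hy).1 (hmaps hy).2)
      have h2 : ContinuousOn (transfer F torusCone torusTwist) (S3 ∩ F '' torusCone) :=
        h1.congr fun y hy => by rw [transfer, if_pos hy.2]
      exact (h2 x ⟨hx, hxV⟩).mono_of_mem_nhdsWithin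
        (inter_mem_nhdsWithin _ (hVo.mem_nhds hxV))
    · refine (continuousWithinAt_id).congr_of_eventuallyEq ?_ (hoff x hx hxA)
      filter_upwards [self_mem_nhdsWithin,
        mem_nhdsWithin_of_mem_nhds (hFA.isOpen_compl.mem_nhds hxA)] with y hy hyA
        using hoff y hy hyA
  refine H.map (g := fun x => k (transfer F torusCone torusTwist x)) ?_
    (fun x hx => hk.mapsTo_S3 (hTS hx)) ?_ ?_
  · exact (hk.emb.continuousOn.mono fun x hx => ne_zero_of_mem_S3 hx).comp hTc hTS
  · rintro x hx ⟨u, hux⟩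
    have h1 := hk.bijective.injective hux
    have hmem : stdTorus (0, (u : ℂ)) ∈ torusCone :=
      stdTorus_mem_torusCone (by simp [hu])
    by_cases hxA : x ∈ F '' A
    · obtain ⟨y, hy, rfl⟩ := hxA
      rw [hT y (hAcone hy)] at h1
      have h2 := hF.injOn hmem (hcone y hy.1 (hAcone hy)) h1
      obtain ⟨⟨z, w⟩, rfl⟩ := exists_toE4 y
      obtain ⟨ζ, v, hζ, hv, e⟩ := exists_eq_stdTorus hy.1 rfl
        (by have := hy.2; rw [mem_ofPred_eq, toE4L_symm_toE4] at this; exact this)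
      rw [e, torusTwist_stdTorus hζ hv] at h2
      have h3 : discTwist ζ = 0 := by
        have h4 := congrArg (fun x => (toE4L.symm x).1) h2
        simp only [stdTorus, ← toE4_smul, toE4L_symm_toE4, Prod.smul_fst, smul_zero] at h4
        exact (smul_eq_zero.1 h4.symm).resolve_left (inv_ne_zero (sqrt_one_add_pos _).ne')
      obtain ⟨v', rfl⟩ : ∃ v' : Circle, (v' : ℂ) = v := ⟨⟨v, mem_sphere_zero_iff_norm.2 hv⟩, rfl⟩
      refine ⟨v', ?_⟩
      rw [hδ, e, discTwist_eq_zero hζ h3]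
    · rw [hoff x hx hxA] at h1
      exact absurd ⟨_, ⟨stdTorus_mem_S3 (hu u), by
        rw [mem_ofPred_eq, stdTorus, ← toE4_smul, toE4L_symm_toE4]
        simp only [Prod.smul_fst, smul_zero, norm_zero]
        positivity⟩, h1⟩ hxA
  · intro u
    have hh : ‖((-1 / 2 : ℝ) : ℂ)‖ = 1 / 2 := by rw [Complex.norm_real]; norm_num
    simp only [hγ]
    rw [hT _ (stdTorus_mem_torusCone (by simp only [hh, hu]; norm_num)),
      torusTwist_stdTorus (by rw [hh]; norm_num) (hu u), discTwist_neg_half]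

/-! ### Tying a knot into one band -/

theorem hasDerivAt_exp_pi (t : ℝ) :
    HasDerivAt (fun t : ℝ => Complex.exp ((Real.pi * t : ℝ) * Complex.I))
      (Real.pi • (Complex.I * Complex.exp ((Real.pi * t : ℝ) * Complex.I))) t := by
  have h1 : HasDerivAt (fun t : ℝ => ((Real.pi * t : ℝ) : ℂ) * Complex.I)
      ((Real.pi : ℂ) * Complex.I) t := by
    have := ((hasDerivAt_id t).const_mul Real.pi).ofReal_comp.mul_const Complex.I
    simpa using this
  convert h1.cexp using 1
  rw [Complex.real_smul]
  ring

/-- A diffeomorphism that parametrizes the meridian of a cylinder by the dual circle carries one to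
the other as oriented curves. -/
theorem pushforward_dualCircle {G : ℂ × ℝ → E4} (hG : IsCylinder G) {h : E4 → E4}
    (hh : IsConeDiffeo h) (hm : ∀ z : ℂ, ‖z‖ = 1 → h (toE4 (z, 0)) = G (z, 1 / 2)) :
    pushforward h dualCircle = meridian G := by
  have hu : ∀ u : Circle, ‖(u : ℂ)‖ = 1 := Circle.norm_coe
  have key : ∀ u : Circle, fderiv ℝ h (toE4 ((u : ℂ), 0)) (toE4 (Complex.I * u, 0)) =
      fderiv ℝ G ((u : ℂ), 1 / 2) (Complex.I * u, 0) := by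
    intro u
    set c : ℝ → ℂ := fun t => Complex.exp ((Real.pi * t : ℝ) * Complex.I) * u with hc
    have hcn : ∀ t, ‖c t‖ = 1 := fun t => by rw [hc, norm_mul, norm_exp_pi, hu, one_mul]
    have hc0 : c 0 = u := by simp [hc]
    have hcd : HasDerivAt c (Real.pi • (Complex.I * u)) 0 := by
      have := (hasDerivAt_exp_pi 0).mul_const (u : ℂ)
      simpa [mul_assoc, hc] using this
    obtain ⟨U, hUo, hU, hGU⟩ := hG.smooth
    have hmem : ((u : ℂ), (1 / 2 : ℝ)) ∈ cylinder := ⟨(hu u).le, by norm_num⟩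
    have hne : toE4 ((u : ℂ), 0) ≠ 0 := fun h0 => by
      have := norm_toE4_sq ((u : ℂ), 0)
      rw [h0, hu] at this
      norm_num at this
    have d1 : HasDerivAt (fun t => h (toE4 (c t, 0)))
        (fderiv ℝ h (toE4 ((u : ℂ), 0)) (toE4 (Real.pi • (Complex.I * u), 0))) 0 := by
      have e1 : HasDerivAt (fun t => (c t, (0 : ℂ))) (Real.pi • (Complex.I * u), (0 : ℂ)) 0 :=
        hcd.prodMk (hasDerivAt_const _ _)
      have e2 : HasDerivAt (fun t => toE4 (c t, 0)) (toE4 (Real.pi • (Complex.I * u), 0)) 0 :=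
        toE4L.hasFDerivAt.comp_hasDerivAt 0 e1
      have e3 : HasFDerivAt h (fderiv ℝ h (toE4 ((u : ℂ), 0))) (toE4 (c 0, 0)) := by
        rw [hc0]; exact (hh.emb.imm _ hne).differentiableAt.hasFDerivAt
      exact e3.comp_hasDerivAt 0 e2
    have d2 : HasDerivAt (fun t => G (c t, 1 / 2))
        (fderiv ℝ G ((u : ℂ), 1 / 2) (Real.pi • (Complex.I * u), 0)) 0 := by
      have e1 : HasDerivAt (fun t => (c t, (1 / 2 : ℝ))) (Real.pi • (Complex.I * u), (0 : ℝ)) 0 :=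
        hcd.prodMk (hasDerivAt_const _ _)
      have e3 : HasFDerivAt G (fderiv ℝ G ((u : ℂ), 1 / 2)) (c 0, 1 / 2) := by
        rw [hc0]
        exact ((hGU.contDiffAt (hUo.mem_nhds (hU hmem))).differentiableAt (by simp)).hasFDerivAt
      exact e3.comp_hasDerivAt 0 e1
    have e : (fun t => h (toE4 (c t, 0))) = fun t => G (c t, 1 / 2) :=
      funext fun t => hm _ (hcn t)
    rw [e] at d1
    have h1 := d1.unique d2
    have s1 : toE4 (Real.pi • (Complex.I * (u : ℂ)), 0) = Real.pi • toE4 (Complex.I * u, 0) := by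
      rw [← toE4_smul, Prod.smul_mk, smul_zero]
    have s2 : (Real.pi • (Complex.I * (u : ℂ)), (0 : ℝ)) =
        Real.pi • ((Complex.I * u, 0) : ℂ × ℝ) := by
      rw [Prod.smul_mk, smul_zero]
    rw [s1, s2, map_smul, map_smul] at h1
    exact smul_right_injective _ Real.pi_ne_zero h1
  ext p
  constructor
  · rintro ⟨_, ⟨u, a, ha, rfl⟩, rfl⟩
    refine ⟨u, a, ha, ?_⟩
    simp only [map_smul, key, hm _ (hu u)]
  · rintro ⟨u, a, ha, rfl⟩
    refine ⟨_, ⟨u, a, ha, rfl⟩, ?_⟩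
    simp only [map_smul, key, hm _ (hu u)]

/-- An embedding of the solid torus whose core follows the closure of a long knot carries the core
to that knot, as oriented curves. -/
theorem pushforward_torusCore {φ : ℝ × ℝ → ℂ × ℝ} {e : ℂ × ℂ → E4}
    (hd : ∀ u : ℂ, ‖u‖ = 1 → DifferentiableAt ℝ e (0, u))
    (he : ∀ t ∈ Ioo (-1 : ℝ) 2, e (0, Complex.exp ((Real.pi * t : ℝ) * Complex.I)) =
      closeUp (extendStrand φ 0 t)) :
    pushforward e torusCore = longKnotClosure φ := by
  have hpi := Real.pi_pos
  have key : ∀ t ∈ Ioo (-1 : ℝ) 2, deriv (fun s => closeUp (extendStrand φ 0 s)) t =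
      Real.pi • fderiv ℝ e (0, Complex.exp ((Real.pi * t : ℝ) * Complex.I))
        (0, Complex.I * Complex.exp ((Real.pi * t : ℝ) * Complex.I)) := by
    intro t ht
    have h1 : (fun s => closeUp (extendStrand φ 0 s)) =ᶠ[𝓝 t]
        fun s => e (0, Complex.exp ((Real.pi * s : ℝ) * Complex.I)) := by
      filter_upwards [isOpen_Ioo.mem_nhds ht] with s hs using (he s hs).symm
    rw [h1.deriv_eq]
    have e1 := (hasDerivAt_const t (0 : ℂ)).prodMk (hasDerivAt_exp_pi t)
    have e2 := ((hd _ (norm_exp_pi t)).hasFDerivAt.comp_hasDerivAt t e1).deriv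
    refine e2.trans ?_
    rw [← map_smul, Prod.smul_mk, smul_zero]
  have hvec : ∀ (a : ℝ) (u : ℂ), ((0 : ℂ), (a : ℂ) * (Complex.I * u)) =
      a • ((0, Complex.I * u) : ℂ × ℂ) := fun a u => by simp
  ext p
  constructor
  · rintro ⟨_, ⟨u, a, ha, rfl⟩, rfl⟩
    have hu : ‖(u : ℂ)‖ = 1 := Circle.norm_coe u
    have ht1 : Complex.arg u / Real.pi ∈ Ioc (-1 : ℝ) 1 := by
      constructor
      · rw [lt_div_iff₀ hpi]; linarith [Complex.neg_pi_lt_arg (u : ℂ)]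
      · rw [div_le_iff₀ hpi]; linarith [Complex.arg_le_pi (u : ℂ)]
    set t := Complex.arg u / Real.pi with ht
    have hut : Complex.exp ((Real.pi * t : ℝ) * Complex.I) = u := by
      have h1 : Real.pi * t = Complex.arg u := by rw [ht]; field_simp
      have := Complex.norm_mul_exp_arg_mul_I (u : ℂ)
      rwa [hu, Complex.ofReal_one, one_mul, ← h1] at this
    have ht2 : t ∈ Ioo (-1 : ℝ) 2 := ⟨ht1.1, by linarith [ht1.2]⟩
    refine ⟨t, ht1, a / Real.pi, by positivity, ?_⟩
    rw [← he t ht2, key t ht2, smul_smul, div_mul_cancel₀ _ hpi.ne', hut]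
    simp only [hvec, map_smul]
  · rintro ⟨t, ht, a, ha, rfl⟩
    have ht2 : t ∈ Ioo (-1 : ℝ) 2 := ⟨ht.1, by linarith [ht.2]⟩
    obtain ⟨u, hu⟩ : ∃ u : Circle, (u : ℂ) = Complex.exp ((Real.pi * t : ℝ) * Complex.I) :=
      ⟨⟨_, mem_sphere_zero_iff_norm.2 (norm_exp_pi t)⟩, rfl⟩
    refine ⟨_, ⟨u, a * Real.pi, by positivity, rfl⟩, ?_⟩
    simp only [hvec, map_smul]
    rw [← he t ht2, key t ht2, smul_smul, hu]

theorem isPreconnected_solidTorus : IsPreconnected solidTorus := by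
  have e : solidTorus = Metric.closedBall (0 : ℂ) 1 ×ˢ Metric.sphere (0 : ℂ) 1 := by
    ext p; simp [solidTorus]
  rw [e]
  refine (convex_closedBall _ _).isPreconnected.prod ?_
  refine isPreconnected_sphere ?_ 0 1
  rw [Complex.rank_real_complex]
  norm_num

theorem solidTorus_subset_torusCone : MapsTo stdTorus solidTorus torusCone := fun p hp =>
  stdTorus_mem_torusCone (by rw [hp.2]; linarith [hp.1])

/-- A norm preserving positively homogeneous embedding of the cone over a solid torus gives an
oriented embedding of the solid torus in the sphere. -/
theorem isZeroFramedEmbedding_comp_stdTorus {F h : E4 → E4} (hF : SmoothEmb F torusCone)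
    (hom : PosHom F) (hn : ∀ x, ‖F x‖ = ‖x‖) (hh : IsOrientedConeDiffeo h) {p₀ : ℂ × ℂ}
    (hp₀ : p₀ ∈ solidTorus) (hFh : F =ᶠ[𝓝 (stdTorus p₀)] h)
    (hl : LinkingNumberZero (fun u => F (stdTorus (1, (u : ℂ))))
      (fun u => F (stdTorus (0, (u : ℂ))))) :
    IsZeroFramedEmbedding fun p => F (stdTorus p) := by
  have hm := solidTorus_subset_torusCone
  have hne : ∀ p ∈ solidTorus, stdTorus p ≠ 0 := fun p hp h0 => by
    have := norm_stdTorus hp.2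
    rw [h0, norm_zero] at this
    exact zero_ne_one this
  have hdet : ∀ p ∈ solidTorus, 0 < (fderiv ℝ F (stdTorus p)).det := by
    intro p hp
    refine pos_of_preconnected isPreconnected_solidTorus
      (f := fun p => (fderiv ℝ F (stdTorus p)).det) ?_ ?_ hp₀ ?_ hp
    · intro q hq
      exact (ContinuousLinearMap.continuous_det.continuousAt.comp
        ((hF.imm _ (hm hq)).continuousAt_fderiv.comp
          contDiff_stdTorus.continuous.continuousAt)).continuousWithinAt
    · exact fun q hq => det_ne_zero_of_injective (hF.imm _ (hm hq)).inj
    · simp only [hFh.fderiv_eq]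
      exact hh.det_pos' _ (hne _ hp₀)
  refine ⟨⟨stdTorus ⁻¹' torusCone, isOpen_torusCone.preimage contDiff_stdTorus.continuous, hm,
    ?_⟩, ?_, ?_, ?_, hl⟩
  · exact hF.contDiffOn.comp contDiff_stdTorus.contDiffOn fun p hp => hp
  · intro p hp
    have := stdTorus_mem_S3 hp.2
    simpa [S3, hn] using this
  · intro p hp q hq he
    have h1 := hF.injOn (hm hp) (hm hq) he
    have e1 : ∀ p ∈ solidTorus, closeUp (p.1, Complex.arg p.2 / Real.pi) = stdTorus p :=
      fun p hp => closeUp_arg _ hp.2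
    have h2 := h1
    rw [← e1 p hp, ← e1 q hq, closeUp_eq_iff] at h2
    have hpq : p.1 = q.1 := h2.1
    refine Prod.ext hpq ?_
    have h3 : toE4 p = toE4 q := by
      simp only [stdTorus, hpq] at h1
      exact smul_right_injective _ (inv_pos.2 (sqrt_one_add_pos q.1)).ne' h1
    exact congrArg Prod.snd (toE4_injective h3)
  · intro p hp
    have hd : ∀ v, fderiv ℝ (fun p => F (stdTorus p)) p v =
        fderiv ℝ F (stdTorus p) (fderiv ℝ stdTorus p v) := by
      intro v
      have h1 := (hF.imm _ (hm hp)).differentiableAt.hasFDerivAt.comp p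
        (contDiff_stdTorus.differentiable (by simp) p).hasFDerivAt
      have h2 : fderiv ℝ (fun p => F (stdTorus p)) p = _ := h1.fderiv
      rw [h2]
      rfl
    change 0 < frameDet _ _ _ _
    rw [hd, hd, hd, ← hom.fderiv_self (hF.imm _ (hm hp)).differentiableAt, frameDet_map]
    refine mul_pos (hdet p hp) (frameDet_stdTorus_pos ?_)
    rw [← norm_ne_zero_iff, hp.2]
    exact one_ne_zero

/-- Trivial arcs of the closed strands do not meet the region that is moved. -/
theorem closeUp_notMem_cone_strip {σ δ : ℝ} (hδ : 0 < δ) {z : ℂ} {t : ℝ} (ht : t ∈ Ioo (-1 : ℝ) 2)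
    (ht' : t ∉ Icc (0 : ℝ) 1) : closeUp (z, t) ∉ coneChart closeUp '' (univ ×ˢ strip σ δ) := by
  intro h
  obtain ⟨r, hr, p, hp, he⟩ := exists_of_mem_image_coneChart h
  have hn := congrArg norm he
  rw [norm_smul, norm_closeUp, norm_closeUp, mul_one, Real.norm_of_nonneg hr.le] at hn
  rw [← hn, one_smul, closeUp_eq_iff] at he
  obtain ⟨-, n, hn⟩ := he
  have hpt := hp.2.2
  simp only at hn
  have h1 : (n : ℝ) < 1 := by linarith [ht.2, hpt.1]
  have h2 : (-1 : ℝ) < n := by linarith [ht.1, hpt.2]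
  have h3 : n = 0 := by
    have a1 : n < 1 := by exact_mod_cast h1
    have a2 : -1 < n := by exact_mod_cast h2
    omega
  rw [h3] at hn
  refine ht' ⟨?_, ?_⟩ <;> · push_cast at hn; linarith [hpt.1, hpt.2]

/-- Tying a knot into a closed band of a set `C`: there are an unknotted solid torus that contains
`C` and is complementary to a tube around the meridian `η` of the band, and an embedding `T` of the
torus in the sphere that follows the knot, moves the band to the tied band, and is the identity on
the rest of `C`. -/
theorem IsCylinder.exists_tying {G : ℂ × ℝ → E4} (hG : IsCylinder G) {φ : ℝ × ℝ → ℂ × ℝ}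
    {K : Set (E4 × E4)} (hφ : IsZeroFramedTangle φ K) {C : Set E4} (hC : IsCompact C)
    (hCS : C ⊆ S3) (hCr : ∀ p ∈ cylinder, G p ∈ C → p ∈ incl '' rectangle) :
    ∃ (h T : E4 → E4) (V : Set E4), IsOrientedConeDiffeo h ∧ SmoothEmb T V ∧
      (∀ x, ‖T x‖ = ‖x‖) ∧ pushforward h dualCircle = meridian G ∧
      (∀ x ∈ C, ∃ p ∈ solidTorus, h (stdTorus p) = x) ∧
      (∀ p ∈ solidTorus, h (stdTorus p) ∈ V) ∧
      IsZeroFramedEmbedding (fun p => T (h (stdTorus p))) ∧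
      KnotEquiv (pushforward (fun p => T (h (stdTorus p))) torusCore) K ∧
      (∀ q ∈ rectangle, T (G (incl q)) = G (φ q)) ∧
      ∀ x ∈ C, x ∉ G '' (incl '' rectangle) → T =ᶠ[𝓝 x] fun y => y := by
  obtain ⟨k, hk, hkG⟩ := hG.exists_diffeo
  obtain ⟨k', hk', hk'k, hkk'⟩ := hk.exists_inverse
  have hC0 : C ⊆ {0}ᶜ := fun x hx => ne_zero_of_mem_S3 (hCS hx)
  have hCc : IsCompact (k' '' C) := hC.image_of_continuousOn (hk'.emb.continuousOn.mono hC0)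
  have hCS' : k' '' C ⊆ S3 := by
    rintro _ ⟨x, hx, rfl⟩
    exact hk'.mapsTo_S3 (hCS hx)
  have hCr' : ∀ p ∈ cylinder, closeUp p ∈ k' '' C → p ∈ incl '' rectangle := by
    rintro p hp ⟨x, hx, he⟩
    refine hCr p hp ?_
    rwa [← hkG p hp, ← he, hkk']
  obtain ⟨σ₁, σ₂, δ, d, T, hR, hCbox, hT, hTh, hTn, hTφ, hTid⟩ :=
    hφ.exists_tying_map hCc.isClosed hCr'
  obtain ⟨h, hh, hm, hCh, hV, hst⟩ := hR.exists_tube hCc hCS' hCr' hCbox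
  set V := (insert 0 (coneChart closeUp '' (univ ×ˢ ring σ₁ σ₂ δ d)))ᶜ
  have hV0 : V ⊆ {0}ᶜ := fun x hx h0 => hx (Or.inl h0)
  -- the embedding of the solid torus before conjugation
  have hF : SmoothEmb (fun x => T (h x)) torusCone := by
    refine hT.comp (hh.emb.mono isOpen_torusCone fun x hx h0 => ?_) hV
    rw [mem_singleton_iff] at h0
    simp [h0, torusCone] at hx
  have hFn : ∀ x, ‖T (h x)‖ = ‖x‖ := fun x => by rw [hTn, hh.norm]
  have hstrand : ∀ x ∈ Icc (-1 / 2 : ℝ) (1 / 2), ∀ t ∈ Ioo (-1 : ℝ) 2,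
      T (closeUp (x, t)) = closeUp (extendStrand φ x t) := by
    intro x hx t ht
    by_cases ht' : t ∈ Icc (0 : ℝ) 1
    · rw [extendStrand, if_pos ht']
      exact hTφ (x, t) ⟨hx, ht'⟩
    · rw [extendStrand, if_neg ht']
      refine (hTid _ ?_ (closeUp_notMem_cone_strip hR.posδ ht ht')).eq_of_nhds
      rw [← norm_ne_zero_iff, norm_closeUp]
      exact one_ne_zero
  have hFst : ∀ x ∈ Icc (-1 / 2 : ℝ) (1 / 2), ∀ u : Circle,
      closedStrand φ x u = T (h (stdTorus (x, (u : ℂ)))) := by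
    intro x hx u
    have hu : ‖(u : ℂ)‖ = 1 := Circle.norm_coe u
    rw [hst x hx u hu, ← closeUp_arg _ hu, hstrand x hx]
    · rfl
    · have hpi := Real.pi_pos
      constructor
      · rw [lt_div_iff₀ hpi]; linarith [Complex.neg_pi_lt_arg (u : ℂ)]
      · rw [div_lt_iff₀ hpi]; linarith [Complex.arg_le_pi (u : ℂ)]
  have hF0 : ∀ x ∈ torusCone, T (h x) ≠ 0 := fun x hx h0 => by
    have h1 := hFn x
    rw [h0, norm_zero, eq_comm, norm_eq_zero] at h1
    exact hV0 (hV x hx) (by rw [h1]; exact norm_eq_zero.1 (by rw [hh.norm, norm_zero]))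
  have hkF : SmoothEmb (fun x => k (T (h x))) torusCone := hk.emb.comp hF hF0
  have hcd : ∀ p ∈ solidTorus, DifferentiableAt ℝ (fun p => T (h (stdTorus p))) p := fun p hp =>
    (hF.imm _ (solidTorus_subset_torusCone hp)).differentiableAt.comp p
      (contDiff_stdTorus.differentiable (by simp) p)
  have hcore : pushforward (fun p => T (h (stdTorus p))) torusCore = longKnotClosure φ := by
    refine pushforward_torusCore (fun u hu => hcd _ ⟨by simp, hu⟩) fun t ht => ?_
    have h0 := hst 0 (by norm_num) _ (norm_exp_pi t)
    have h1 := hstrand 0 (by norm_num) t ht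
    rw [Complex.ofReal_zero] at h0 h1
    rw [h0]
    exact h1
  have hcoreS : curveCarrier (longKnotClosure φ) ⊆ S3 := by
    rintro _ ⟨_, ⟨t, -, a, -, rfl⟩, rfl⟩
    simp [S3, norm_closeUp]
  have htc : ∀ x ∈ curveCarrier torusCore, x ∈ solidTorus := by
    rintro _ ⟨_, ⟨u, a, -, rfl⟩, rfl⟩
    exact ⟨by simp, Circle.norm_coe u⟩
  -- a point at which the embedding is the diffeomorphism `h`
  have hp₀ : ((0 : ℂ), -Complex.I) ∈ solidTorus := ⟨by simp, by simp⟩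
  have hp₀h : stdTorus (0, -Complex.I) = closeUp (0, -1 / 2) := by
    rw [← closeUp_arg 0 (by simp : ‖-Complex.I‖ = 1), Complex.arg_neg_I]
    congr 2
    field_simp
  have hev : (fun x => k (T (h x))) =ᶠ[𝓝 (stdTorus (0, -Complex.I))] fun x => k (h x) := by
    have h0 := hst 0 (by norm_num) (-Complex.I) (by simp)
    rw [Complex.ofReal_zero] at h0
    have hne : stdTorus (0, -Complex.I) ≠ 0 := by
      rw [← norm_ne_zero_iff, norm_stdTorus hp₀.2]
      exact one_ne_zero
    have h1 : T =ᶠ[𝓝 (h (stdTorus (0, -Complex.I)))] fun y => y := by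
      rw [h0]
      refine hTid _ hne ?_
      rw [hp₀h]
      exact closeUp_notMem_cone_strip hR.posδ (by norm_num) (by norm_num)
    have hcont : ContinuousAt h (stdTorus (0, -Complex.I)) :=
      (hh.emb.imm _ hne).differentiableAt.continuousAt
    filter_upwards [hcont.eventually h1] with x hx
    rw [hx]
  have hVo : IsOpen ({0}ᶜ ∩ k' ⁻¹' V) :=
    hk'.emb.continuousOn.isOpen_inter_preimage hk'.emb.isOpen hT.isOpen
  refine ⟨fun x => k (h x), fun x => k (T (k' x)), {0}ᶜ ∩ k' ⁻¹' V, hk.comp hh, ?_, ?_, ?_, ?_, ?_,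
    ?_, ?_, ?_, ?_⟩
  · have h1 : SmoothEmb (fun x => T (k' x)) ({0}ᶜ ∩ k' ⁻¹' V) :=
      hT.comp (hk'.emb.mono hVo inter_subset_left) fun x hx => hx.2
    refine hk.emb.comp h1 fun x hx h0 => ?_
    rw [mem_singleton_iff, ← norm_eq_zero, hTn, hk'.norm, norm_eq_zero] at h0
    exact hx.1 h0
  · intro x
    rw [hk.norm, hTn, hk'.norm]
  · refine pushforward_dualCircle hG (hk.comp hh).toIsConeDiffeo fun z hz => ?_
    rw [hm z hz, hkG _ ⟨hz.le, by norm_num⟩]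
  · intro x hx
    obtain ⟨p, hp, he⟩ := hCh (k' x) (mem_image_of_mem _ hx)
    exact ⟨p, hp, by simp only [he, hkk']⟩
  · intro p hp
    have h1 := hV _ (solidTorus_subset_torusCone hp)
    refine ⟨fun h0 => ?_, by rw [mem_preimage, hk'k]; exact h1⟩
    exact hk.ne_zero (hV0 h1) h0
  · simp only [hk'k]
    refine isZeroFramedEmbedding_comp_stdTorus hkF (hk.hom.comp (hTh.comp hh.hom))
      (fun x => by rw [hk.norm, hFn]) (hk.comp hh) hp₀ hev ?_
    exact linkingNumberZero_of_strands hF hFn (fun u => hFst _ (by norm_num) u)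
      (fun u => hFst _ (by norm_num) u) hφ.framing hk.toIsConeDiffeo
  · simp only [hk'k]
    have h1 : pushforward (fun p => k (T (h (stdTorus p)))) torusCore =
        pushforward k (longKnotClosure φ) := by
      rw [← hcore]
      exact pushforward_comp (fun x hx => hcd x (htc x hx)) fun x hx =>
        (hk.emb.imm _ (hF0 _ (solidTorus_subset_torusCone (htc x hx)))).differentiableAt
    rw [h1]
    exact hφ.knotType.comp_left hk hcoreS
  · intro q hq
    simp only [← hkG _ (incl_mem_cylinder hq), hk'k, hTφ q hq, hkG _ (hφ.mapsTo hq)]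
  · intro x hx hxr
    have hx0 := hC0 hx
    have hcont : ContinuousAt k' x := (hk'.emb.imm _ hx0).differentiableAt.continuousAt
    have h1 : T =ᶠ[𝓝 (k' x)] fun y => y := by
      refine hTid _ (hk'.ne_zero hx0) fun hmem => ?_
      obtain ⟨r, hr, p, hp, he⟩ := exists_of_mem_image_coneChart hmem
      have hn := congrArg norm he
      have hx1 : ‖x‖ = 1 := by simpa [S3] using hCS hx
      rw [norm_smul, norm_closeUp, mul_one, Real.norm_of_nonneg hr.le, hk'.norm, hx1] at hn
      rw [← hn, one_smul] at he
      have h2 : x = G p := by rw [← hkG p hp.1, ← he, hkk']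
      exact hxr ⟨p, hCr p hp.1 (h2 ▸ hx), h2.symm⟩
    filter_upwards [hcont.eventually h1] with y hy
    rw [hy, hkk']

/-! ### Tying knots into the bands one after another -/

theorem smoothEmb_stdTorus : SmoothEmb stdTorus univ := by
  have key : ∀ p : ℂ × ℂ, ‖(toE4L.symm (stdTorus p)).1‖ ^ 2 = 1 - (1 + ‖p.1‖ ^ 2)⁻¹ := by
    intro p
    rw [stdTorus, ← toE4_smul, toE4L_symm_toE4, Prod.smul_fst, norm_smul, mul_pow, norm_inv,
      Real.norm_of_nonneg (Real.sqrt_nonneg _), inv_pow, Real.sq_sqrt (by positivity)]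
    field_simp
    ring
  refine SmoothEmb.of_leftInverse isOpen_univ
    (g := fun x => (√(1 - ‖(toE4L.symm x).1‖ ^ 2))⁻¹ • toE4L.symm x)
    (fun p _ => contDiff_stdTorus.contDiffAt) (fun p _ => ?_) (fun p _ => ?_)
  · have h1 : DifferentiableAt ℝ (fun x => 1 - ‖(toE4L.symm x).1‖ ^ 2) (stdTorus p) :=
      (differentiableAt_const _).sub (toE4L.symm.differentiableAt.fst.norm_sq ℝ)
    have h2 : 1 - ‖(toE4L.symm (stdTorus p)).1‖ ^ 2 ≠ 0 := by
      rw [key, sub_sub_cancel]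
      positivity
    refine ((h1.sqrt h2).inv ?_).smul toE4L.symm.differentiableAt
    rw [key, sub_sub_cancel]
    positivity
  · simp only [key, sub_sub_cancel, Real.sqrt_inv, inv_inv]
    rw [stdTorus, ← toE4_smul, toE4L_symm_toE4, smul_inv_smul₀ (sqrt_one_add_pos _).ne']

/-- Two positive bases of the plane span the same set of positive bases. -/
theorem exists_det2_pos_iff {E : Type*} [NormedAddCommGroup E] [NormedSpace ℝ E]
    {L M : ℝ × ℝ →L[ℝ] E} {α β : ℝ × ℝ} (h : 0 < det2 α β) (h1 : M (1, 0) = L α)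
    (h2 : M (0, 1) = L β) {v w : E} :
    (∃ a b : ℝ × ℝ, 0 < det2 a b ∧ v = L a ∧ w = L b) ↔
      ∃ a b : ℝ × ℝ, 0 < det2 a b ∧ v = M a ∧ w = M b := by
  have hM : ∀ a : ℝ × ℝ, M a = L (a.1 • α + a.2 • β) := by
    intro a
    rw [map_add, map_smul, map_smul, ← h1, ← h2, ← map_smul, ← map_smul, ← map_add]
    congr 1
    ext <;> simp
  set D := det2 α β with hD
  have hD' : α.1 * β.2 - α.2 * β.1 = D := rfl
  -- Cramer's rule
  have hinv : ∀ a : ℝ × ℝ, L a = M (det2 a β / D, det2 α a / D) := by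
    intro a
    rw [hM]
    congr 1
    refine Prod.ext ?_ ?_ <;>
      · simp only [det2, Prod.fst_add, Prod.snd_add, Prod.smul_fst, Prod.smul_snd, smul_eq_mul]
        rw [div_mul_eq_mul_div, div_mul_eq_mul_div, ← add_div, eq_div_iff h.ne', ← hD']
        ring
  constructor
  · rintro ⟨a, b, hab, rfl, rfl⟩
    refine ⟨_, _, ?_, hinv a, hinv b⟩
    have e : det2 (det2 a β / D, det2 α a / D) (det2 b β / D, det2 α b / D) = det2 a b / D := by
      simp only [det2]
      rw [div_mul_div_comm, div_mul_div_comm, ← sub_div, div_eq_div_iff (by positivity) h.ne',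
        ← hD']
      ring
    rw [e]
    exact div_pos hab h
  · rintro ⟨a, b, hab, rfl, rfl⟩
    refine ⟨_, _, ?_, hM a, hM b⟩
    have e : det2 (a.1 • α + a.2 • β) (b.1 • α + b.2 • β) = det2 a b * D := by
      simp only [det2, Prod.fst_add, Prod.snd_add, Prod.smul_fst, Prod.smul_snd, smul_eq_mul,
        ← hD']
      ring
    rw [e]
    exact mul_pos hab h

section Band

variable {S : Set (E4 × E4 × E4)} {G : ℂ × ℝ → E4}

theorem IsClosedBand.differentiableAt (hG : IsClosedBand S G) {p : ℂ × ℝ} (hp : p ∈ cylinder) :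
    DifferentiableAt ℝ G p := by
  obtain ⟨U, hUo, hU, h⟩ := hG.smooth
  exact (h.contDiffAt (hUo.mem_nhds (hU hp))).differentiableAt (by simp)

theorem IsZeroFramedTangle.differentiableAt {φ : ℝ × ℝ → ℂ × ℝ} {K : Set (E4 × E4)}
    (hφ : IsZeroFramedTangle φ K) {q : ℝ × ℝ} (hq : q ∈ rectangle) : DifferentiableAt ℝ φ q := by
  obtain ⟨U, hUo, hU, h⟩ := hφ.smooth
  exact (h.contDiffAt (hUo.mem_nhds (hU hq))).differentiableAt (by simp)

theorem IsClosedBand.hasFDerivAt_comp_incl (hG : IsClosedBand S G) {q : ℝ × ℝ}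
    (hq : q ∈ rectangle) : HasFDerivAt (G ∘ incl) ((fderiv ℝ G (incl q)).comp inclL) q :=
  (hG.differentiableAt (incl_mem_cylinder hq)).hasFDerivAt.comp q inclL.hasFDerivAt

/-- The positive frames of a surface at the points of a closed band. -/
theorem IsClosedBand.mem_iff (hG : IsClosedBand S G)
    (hS : ∀ x ∈ surfaceCarrier S, ∃ U O c r, x ∈ O ∧ IsSurfaceChart S U O c r) {q : ℝ × ℝ}
    (hq : q ∈ rectangle) {v w : E4} : (G (incl q), v, w) ∈ S ↔
      ∃ a b : ℝ × ℝ, 0 < det2 a b ∧ v = fderiv ℝ (G ∘ incl) q a ∧ w = fderiv ℝ (G ∘ incl) q b := by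
  have hor := hG.surface_orientation q hq
  obtain ⟨U, O, c, r, hO, hc⟩ := hS _ ⟨_, hor, rfl⟩
  obtain ⟨q', hq', hqh, hcq, -⟩ := hc.exists_eq ⟨_, hor, rfl⟩ hO
  obtain ⟨-, -, -, -, -, -, hfr⟩ := hc
  simp only at hcq
  rw [← hcq, hfr q' ⟨hq', hqh⟩] at hor
  obtain ⟨α, β, hαβ, h1, h2⟩ := hor
  rw [← hcq, hfr q' ⟨hq', hqh⟩]
  have e1 : inclL (1, 0) = ((1 : ℂ), (0 : ℝ)) := by simp [inclL_apply, incl]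
  have e2 : inclL (0, 1) = ((0 : ℂ), (1 : ℝ)) := by simp [inclL_apply, incl]
  refine exists_det2_pos_iff hαβ ?_ ?_
  · rw [(hG.hasFDerivAt_comp_incl hq).fderiv, ContinuousLinearMap.comp_apply, e1, ← h1]
  · rw [(hG.hasFDerivAt_comp_incl hq).fderiv, ContinuousLinearMap.comp_apply, e2, ← h2]

theorem IsClosedBand.mem_of_mem_surfaceCarrier (hG : IsClosedBand S G) {p : ℂ × ℝ}
    (hp : p ∈ cylinder) (h : G p ∈ surfaceCarrier S) : p ∈ incl '' rectangle := by
  have h1 : G p ∈ G '' (incl '' rectangle) := by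
    rw [← hG.surface_inter]
    exact ⟨⟨p, hp, rfl⟩, h⟩
  obtain ⟨_, ⟨q, hq, rfl⟩, he⟩ := h1
  rw [← hG.injOn (incl_mem_cylinder hq) hp he]
  exact ⟨q, hq, rfl⟩

end Band

/-- The surface obtained by tying knots into the bands with index less than `n`. -/
def tieUpTo {t : ℕ} (S : Set (E4 × E4 × E4)) (G : Fin t → ℂ × ℝ → E4)
    (φ : Fin t → ℝ × ℝ → ℂ × ℝ) (n : ℕ) : Set (E4 × E4 × E4) :=
  {f ∈ S | ∀ i : Fin t, i.val < n → f.1 ∉ G i '' (incl '' rectangle)} ∪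
  {f | ∃ i : Fin t, i.val < n ∧ ∃ q ∈ rectangle, ∃ a b : ℝ × ℝ, 0 < det2 a b ∧
    f = (G i (φ i q), fderiv ℝ (G i ∘ φ i) q a, fderiv ℝ (G i ∘ φ i) q b)}

theorem tieUpTo_zero {t : ℕ} (S : Set (E4 × E4 × E4)) (G : Fin t → ℂ × ℝ → E4)
    (φ : Fin t → ℝ × ℝ → ℂ × ℝ) : tieUpTo S G φ 0 = S := by
  simp [tieUpTo]

theorem tieUpTo_eq_tie {t : ℕ} (S : Set (E4 × E4 × E4)) (G : Fin t → ℂ × ℝ → E4)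
    (φ : Fin t → ℝ × ℝ → ℂ × ℝ) : tieUpTo S G φ t = tie S G φ := by
  simp [tieUpTo, tie]

section Main

variable {t : ℕ} {F : Set (E4 × E4 × E4)} {G : Fin t → ℂ × ℝ → E4} {K : Fin t → Set (E4 × E4)}
  {φ : Fin t → ℝ × ℝ → ℂ × ℝ}

theorem mem_of_mem_surfaceCarrier_tieUpTo (hG : ∀ i, IsClosedBand F (G i))
    (hdisj : Pairwise fun i j => Disjoint (G i '' cylinder) (G j '' cylinder))
    (hφ : ∀ i, IsZeroFramedTangle (φ i) (K i)) (i : Fin t) {p : ℂ × ℝ} (hp : p ∈ cylinder)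
    (h : G i p ∈ surfaceCarrier (tieUpTo F G φ i)) : p ∈ incl '' rectangle := by
  obtain ⟨f, hf | ⟨j, hj, q, hq, a, b, -, rfl⟩, he⟩ := h
  · exact (hG i).mem_of_mem_surfaceCarrier hp ⟨f, hf.1, he⟩
  · exact ((hdisj (Fin.ne_of_lt hj)).ne_of_mem ⟨_, (hφ j).mapsTo hq, rfl⟩ ⟨p, hp, rfl⟩ he).elim

/-- Tying one further knot is the effect of the tying map of that knot. -/
theorem pushFrames_tieUpTo (hF : IsSeifertSurface F) (hG : ∀ i, IsClosedBand F (G i))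
    (hdisj : Pairwise fun i j => Disjoint (G i '' cylinder) (G j '' cylinder))
    (hφ : ∀ i, IsZeroFramedTangle (φ i) (K i)) (i : Fin t) {T : E4 → E4}
    (hTd : ∀ x ∈ surfaceCarrier (tieUpTo F G φ i), DifferentiableAt ℝ T x)
    (hTφ : ∀ q ∈ rectangle, T (G i (incl q)) = G i (φ i q))
    (hTid : ∀ x ∈ surfaceCarrier (tieUpTo F G φ i), x ∉ G i '' (incl '' rectangle) →
      T =ᶠ[𝓝 x] fun y => y) :
    pushFrames T (tieUpTo F G φ i) = tieUpTo F G φ (i + 1) := by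
  have hfix : ∀ f ∈ tieUpTo F G φ i, f.1 ∉ G i '' (incl '' rectangle) →
      (T f.1, fderiv ℝ T f.1 f.2.1, fderiv ℝ T f.1 f.2.2) = f := by
    intro f hf hfi
    have h1 := hTid f.1 ⟨f, hf, rfl⟩ hfi
    rw [h1.eq_of_nhds, h1.fderiv_eq, fderiv_fun_id]
    rfl
  -- points of different cylinders are different
  have hne : ∀ j : Fin t, j.val < i.val → ∀ p ∈ cylinder, G j p ∉ G i '' (incl '' rectangle) := by
    rintro j hj p hp ⟨_, ⟨q, hq, rfl⟩, he⟩
    exact (hdisj (Fin.ne_of_lt hj)).ne_of_mem ⟨p, hp, rfl⟩ ⟨_, incl_mem_cylinder hq, rfl⟩ he.symm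
  have hne' : ∀ j : Fin t, j.val < i.val → ∀ p ∈ cylinder, G i p ∉ G j '' (incl '' rectangle) := by
    rintro j hj p hp ⟨_, ⟨q, hq, rfl⟩, he⟩
    exact (hdisj (Fin.ne_of_lt hj)).ne_of_mem ⟨_, incl_mem_cylinder hq, rfl⟩ ⟨p, hp, rfl⟩ he
  have hmem : ∀ q ∈ rectangle, ∀ v w, (G i (incl q), v, w) ∈ F →
      (G i (incl q), v, w) ∈ tieUpTo F G φ i := fun q hq v w hf =>
    Or.inl ⟨hf, fun j hj => hne' j hj _ (incl_mem_cylinder hq)⟩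
  have hder : ∀ q ∈ rectangle, ∀ a, fderiv ℝ T (G i (incl q)) (fderiv ℝ (G i ∘ incl) q a) =
      fderiv ℝ (G i ∘ φ i) q a := by
    intro q hq a
    have hx : DifferentiableAt ℝ T (G i (incl q)) :=
      hTd _ ⟨_, hmem q hq _ _ ((hG i).surface_orientation q hq), rfl⟩
    have h1 : HasFDerivAt (T ∘ (G i ∘ incl))
        ((fderiv ℝ T (G i (incl q))).comp (fderiv ℝ (G i ∘ incl) q)) q :=
      HasFDerivAt.comp q hx.hasFDerivAt
        ((hG i).hasFDerivAt_comp_incl hq).differentiableAt.hasFDerivAt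
    have h2 : DifferentiableAt ℝ (G i ∘ φ i) q :=
      ((hG i).differentiableAt ((hφ i).mapsTo hq)).comp q ((hφ i).differentiableAt hq)
    rw [← fderiv_eq_of_eqOn_convex convex_rectangle nonempty_interior_rectangle hq
      h1.differentiableAt h2 (fun q' hq' => hTφ q' hq'), h1.fderiv]
    rfl
  ext f
  constructor
  · rintro ⟨⟨x, v, w⟩, hf, rfl⟩
    by_cases hfi : x ∈ G i '' (incl '' rectangle)
    · obtain ⟨_, ⟨q, hq, rfl⟩, rfl⟩ := hfi
      rcases hf with ⟨hf, -⟩ | ⟨j, hj, q', hq', a, b, -, he⟩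
      · obtain ⟨a, b, hab, rfl, rfl⟩ := ((hG i).mem_iff hF.chart hq).1 hf
        refine Or.inr ⟨i, Nat.lt_succ_self _, q, hq, a, b, hab, ?_⟩
        simp only [hder q hq, hTφ q hq]
      · exact absurd ⟨_, ⟨q, hq, rfl⟩, congrArg Prod.fst he⟩
          (hne j hj _ ((hφ j).mapsTo hq'))
    · have h1 := hfix _ hf hfi
      simp only at h1
      simp only [h1]
      rcases hf with ⟨hf, hfj⟩ | ⟨j, hj, hj'⟩
      · refine Or.inl ⟨hf, fun j hj => ?_⟩
        rcases Nat.lt_succ_iff_lt_or_eq.1 hj with hj | hj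
        · exact hfj j hj
        · rwa [Fin.ext hj]
      · exact Or.inr ⟨j, Nat.lt_succ_of_lt hj, hj'⟩
  · rintro (⟨hf, hfj⟩ | ⟨j, hj, q, hq, a, b, hab, rfl⟩)
    · have h1 : f ∈ tieUpTo F G φ i := Or.inl ⟨hf, fun j hj => hfj j (Nat.lt_succ_of_lt hj)⟩
      exact ⟨f, h1, hfix f h1 (hfj i (Nat.lt_succ_self _))⟩
    · rcases Nat.lt_succ_iff_lt_or_eq.1 hj with hj | hj
      · have h1 : (G j (φ j q), fderiv ℝ (G j ∘ φ j) q a, fderiv ℝ (G j ∘ φ j) q b) ∈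
            tieUpTo F G φ i := Or.inr ⟨j, hj, q, hq, a, b, hab, rfl⟩
        exact ⟨_, h1, hfix _ h1 (hne j hj _ ((hφ j).mapsTo hq))⟩
      · obtain rfl := Fin.ext hj
        refine ⟨_, hmem q hq _ _ (((hG j).mem_iff hF.chart hq).2 ⟨a, b, hab, rfl, rfl⟩), ?_⟩
        simp only [hder q hq, hTφ q hq]

/-- Tying one further knot preserves compactness, the boundary remains a link, and the new boundary
is a satellite of the old one. -/
theorem tieUpTo_succ (hF : IsSeifertSurface F) (hG : ∀ i, IsClosedBand F (G i))
    (hdisj : Pairwise fun i j => Disjoint (G i '' cylinder) (G j '' cylinder))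
    (hφ : ∀ i, IsZeroFramedTangle (φ i) (K i)) (i : Fin t)
    (hc : IsCompact (surfaceCarrier (tieUpTo F G φ i)))
    (hS : surfaceCarrier (tieUpTo F G φ i) ⊆ S3)
    (hL : IsLink S3 (boundary (tieUpTo F G φ i))) :
    IsCompact (surfaceCarrier (tieUpTo F G φ (i + 1))) ∧
      surfaceCarrier (tieUpTo F G φ (i + 1)) ⊆ S3 ∧
      IsLink S3 (boundary (tieUpTo F G φ (i + 1))) ∧
      IsSatelliteAlong (meridian (G i)) (K i) (boundary (tieUpTo F G φ i))
        (boundary (tieUpTo F G φ (i + 1))) := by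
  obtain ⟨h, T, V, hh, hT, hTn, hm, hCh, hV, hemb, hknot, hTφ, hTid⟩ :=
    (hG i).isCylinder.exists_tying (hφ i) hc hS
      fun p hp => mem_of_mem_surfaceCarrier_tieUpTo hG hdisj hφ i hp
  have hSV : surfaceCarrier (tieUpTo F G φ i) ⊆ V := fun x hx => by
    obtain ⟨p, hp, rfl⟩ := hCh x hx
    exact hV p hp
  have hpush := pushFrames_tieUpTo hF hG hdisj hφ i
    (fun x hx => (hT.imm x (hSV hx)).differentiableAt) hTφ hTid
  have hTS : MapsTo T S3 S3 := fun x hx => by simpa [S3, hTn] using hx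
  have hbV : curveCarrier (boundary (tieUpTo F G φ i)) ⊆ V :=
    (curveCarrier_boundary_subset _).trans hSV
  have hb : boundary (tieUpTo F G φ (i + 1)) = pushforward T (boundary (tieUpTo F G φ i)) := by
    rw [← hpush, boundary_pushFrames hT rfl hSV]
  -- the identification of the solid torus with the complement of a tube around the meridian
  have hne : ∀ p : ℂ × ℂ, p.2 ≠ 0 → stdTorus p ≠ 0 := by
    intro p hp h0
    have h1 := norm_stdTorus_sq p
    rw [h0, norm_zero, eq_comm, div_eq_iff (by positivity)] at h1
    have := norm_pos_iff.2 hp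
    nlinarith [sq_nonneg ‖p.1‖]
  have hH : SmoothEmb (fun p => h (stdTorus p)) {p : ℂ × ℂ | p.2 ≠ 0} :=
    hh.emb.comp (smoothEmb_stdTorus.mono (isOpen_ne_fun continuous_snd continuous_const)
      (subset_univ _)) fun p hp => hne p hp
  have htorus : ∀ p ∈ solidTorus, p.2 ≠ 0 := fun p hp => by
    rw [← norm_ne_zero_iff, hp.2]
    exact one_ne_zero
  set H := fun p => h (stdTorus p) with hHdef
  set N : Set (ℂ × ℂ) := {p | p.2 ≠ 0}
  have hbN : ∀ x ∈ curveCarrier (boundary (tieUpTo F G φ i)), ∃ p ∈ solidTorus, H p = x :=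
    fun x hx => hCh x (curveCarrier_boundary_subset _ hx)
  have hbN' : curveCarrier (boundary (tieUpTo F G φ i)) ⊆ H '' N := fun x hx => by
    obtain ⟨p, hp, e⟩ := hbN x hx
    exact ⟨p, htorus p hp, e⟩
  have hPmaps : MapsTo (invFunOn H N) (curveCarrier (boundary (tieUpTo F G φ i))) solidTorus := by
    intro x hx
    obtain ⟨p, hp, rfl⟩ := hbN x hx
    rwa [hH.injOn.leftInvOn_invFunOn (htorus p hp)]
  set P := pushforward (invFunOn H N) (boundary (tieUpTo F G φ i)) with hP
  have hPH : pushforward H P = boundary (tieUpTo F G φ i) :=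
    pushforward_pushforward_inv hH finrank_tube hbN'
  have hPc : curveCarrier P ⊆ solidTorus := by
    rw [hP, curveCarrier_pushforward]
    exact hPmaps.image_subset
  refine ⟨?_, ?_, ?_, P, ?_, ⟨h, hh.isOrientedDiffeo, hm, hPH⟩, _, hemb, hknot, ?_⟩
  · rw [← hpush, surfaceCarrier_pushFrames]
    exact hc.image_of_continuousOn (hT.continuousOn.mono hSV)
  · rw [← hpush, surfaceCarrier_pushFrames]
    exact (hTS.mono_left hS).image_subset
  · rw [hb]
    exact hL.map hT rfl hbV fun x hx => hTS (hL.subset hx)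
  · exact hL.map (hH.inv finrank_tube) finrank_tube.symm hbN' hPmaps
  · have h1 : pushforward (T ∘ H) P = pushforward T (pushforward H P) :=
      pushforward_comp (fun p hp => (hH.imm p (htorus p (hPc hp))).differentiableAt)
        fun p hp => (hT.imm _ (hV p (hPc hp))).differentiableAt
    rw [hb, ← hPH, ← h1]
    rfl

theorem tieUpTo_isLink (hF : IsSeifertSurface F) (hG : ∀ i, IsClosedBand F (G i))
    (hdisj : Pairwise fun i j => Disjoint (G i '' cylinder) (G j '' cylinder))
    (hφ : ∀ i, IsZeroFramedTangle (φ i) (K i)) : ∀ n ≤ t,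
    IsCompact (surfaceCarrier (tieUpTo F G φ n)) ∧ surfaceCarrier (tieUpTo F G φ n) ⊆ S3 ∧
      IsLink S3 (boundary (tieUpTo F G φ n)) := by
  intro n
  induction n with
  | zero =>
    intro _
    rw [tieUpTo_zero]
    exact ⟨hF.compact, hF.subset, isLink_boundary hF.compact hF.subset hF.chart⟩
  | succ n ih =>
    intro hn
    obtain ⟨h1, h2, h3⟩ := ih (Nat.le_of_succ_le hn)
    obtain ⟨h1', h2', h3', -⟩ := tieUpTo_succ hF hG hdisj hφ ⟨n, hn⟩ h1 h2 h3
    exact ⟨h1', h2', h3'⟩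

end Main

end

end BandTying

theorem mainTheorem5 {t : ℕ}
    (F : Set (BandTying.E4 × BandTying.E4 × BandTying.E4)) (hF : BandTying.IsSeifertSurface F)
    (G : Fin t → ℂ × ℝ → BandTying.E4) (hG : ∀ i, BandTying.IsClosedBand F (G i))
    (hdisj : Pairwise fun i j => Disjoint (G i '' BandTying.cylinder) (G j '' BandTying.cylinder))
    (K : Fin t → Set (BandTying.E4 × BandTying.E4)) (hK : ∀ i, BandTying.IsKnot (K i))
    (φ : Fin t → ℝ × ℝ → ℂ × ℝ) (hφ : ∀ i, BandTying.IsZeroFramedTangle (φ i) (K i)) :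
    ∃ L : Fin (t + 1) → Set (BandTying.E4 × BandTying.E4),
      (∀ i, BandTying.IsLink BandTying.S3 (L i)) ∧
      L 0 = BandTying.boundary F ∧
      L (Fin.last t) = BandTying.boundary (BandTying.tie F G φ) ∧
      ∀ i : Fin t, BandTying.IsSatelliteAlong (BandTying.meridian (G i)) (K i)
        (L i.castSucc) (L i.succ) := by
  have hinv := BandTying.tieUpTo_isLink hF hG hdisj hφ
  refine ⟨fun i => BandTying.boundary (BandTying.tieUpTo F G φ i), fun i =>
    (hinv i (Nat.lt_succ_iff.1 i.2)).2.2, ?_, ?_, fun i => ?_⟩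
  · simp only [Fin.val_zero, BandTying.tieUpTo_zero]
  · simp only [Fin.val_last, BandTying.tieUpTo_eq_tie]
  · obtain ⟨h1, h2, h3⟩ := hinv i i.2.le
    exact (BandTying.tieUpTo_succ hF hG hdisj hφ i h1 h2 h3).2.2.2
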